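/- **The pure heap model.** A *pure heap* stores items with pairwise distinct keys from a totally ordered abelian group $K\neq 0$ (for example $\mathbb Z$ or $\mathbb R$) in the nodes of an ordered forest. $\mathrm{Insert}(k)$ adds the new item as a new leftmost one-node tree, at cost $1$. $\text{Decrease-Key}(x,\delta)$, $\delta\ge 0$, disconnects the node $x$ from its parent (if it has one), decreases its key by $\delta$, and makes the tree of $x$ the leftmost tree of the forest, at cost $1$. $\text{Extract-Min}$ (on a nonempty heap) executes a sequence of suboperations using $\rho$ pointers $p_1,\dots,p_\rho$, all initially at the leftmost root; its cost is the number of suboperations. The suboperations are - the tests $\mathrm{HasParent}(i)$, $\mathrm{HasLeftSibling}(i)$, $\mathrm{HasRightSibling}(i)$, $\mathrm{HasChildren}(i)$ and $\mathrm{Compare}(i,j)$ (is the key at $p_i$ at most the key at $p_j$?), where the roots count as siblings of each other; - $\mathrm{Pair}(i,j)$: the tree with root $p_j$ becomes the leftmost subtree of $p_i$; required: $p_i,p_j$ are roots, the key at $p_i$ is smaller than the key at $p_j$, and tests have verified this; - $\mathrm{Unpair}(i)$: the leftmost child of $p_i$ becomes the left sibling of $p_i$; required: this child exists, and it was paired with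 $p_i$ by a $\mathrm{Pair}$ in the same Extract-Min; - $\mathrm{Set}(i,j)$: $p_i$ is set to the node of $p_j$; $\mathrm{Swap}(i,j)$: the trees with roots $p_i$ and $p_j$ exchange their places in the forest; - moving $p_i$ to the parent, the leftmost child, the right sibling or the left sibling; required: that node exists, and a test has verified this; - $\mathrm{End}$, the last suboperation; required: the forest is a single tree, and the tests HasParent, HasLeftSibling and HasRightSibling have verified this at a pointer to its root. "Verified" means by a test on the same nodes earlier in the same Extract-Min. After $\mathrm{End}$ the root of the single tree (the minimum) is removed and returned, and its children become the roots. A *pure heap algorithm with $\rho$ pointers* is any rule that chooses, for every Extract-Min request, a valid sequence of suboperations as a function of the whole sequence of operations (with keys) requested so far; in particular there is no bound on the data that it may store in the nodes. Functions $a,b,d:\mathbb N\to\mathbb R$ are *amortized costs* of Insert, Extract-Min and Decrease-Key for the algorithm if for every $n$ and every sequence of operations on an initially empty heap during which the heap never holds more than $n$ items, the total cost is at most $a(n)\cdot\#\mathrm{Insert}+b(n)\cdot\#\text{Extract-Min}+d(n)\cdot\#\text{Decrease-Key}$. **Theorem.** Let $\rho$ be a constant, and let $a,b,d$ be amortized costs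 of Insert, Extract-Min and Decrease-Key for a pure heap algorithm with $\rho$ pointers. If $a(n)=O(\log n)$ and $b(n)=O(\log n)$, then $d(n)=\Omega(\log\log n)$, that is, there is $\varepsilon>0$ such that $d(n)\ge\varepsilon\log\log n$ for all sufficiently large $n$. -/

import Mathlib

/-!
# The pure heap model

A heap is an ordered forest whose nodes are named by natural numbers: the item inserted by the
`t`-th `Insert` of a sequence (counting from `0`) is node `t`, and `t` is the pointer that
`Insert` returns.
-/

namespace PureHeap

/-- The priority queue operations. `decreaseKey x δ` lowers the key of node `x` by `δ`. -/
inductive Op (K : Type*) where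
  | insert (k : K)
  | decreaseKey (x : ℕ) (δ : K)
  | extractMin

/-- An ordered forest of nodes with keys. `roots` lists the roots from left to right and `kids x`
lists the children of `x` from left to right. `live` is the set of the nodes present and `next` is
the name of the next node to be inserted. -/
structure Heap (K : Type*) where
  roots : List ℕ
  kids : ℕ → List ℕ
  key : ℕ → K
  live : Finset ℕ
  next : ℕ

namespace Heap

variable {K : Type*}

/-- The empty heap. -/
def empty [Zero K] : Heap K where
  roots := []
  kids := fun _ => []
  key := fun _ => 0
  live := ∅
  next := 0

/-- The number of items in the heap. -/
def size (H : Heap K) : ℕ := H.live.card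

/-- The parent of `x`, if `x` has one. -/
def parent? (H : Heap K) (x : ℕ) : Option ℕ :=
  (List.range H.next).find? fun p => decide (x ∈ H.kids p)

/-- The left-to-right list of the siblings of `x`, including `x` itself. The siblings of a root are
the roots. -/
def siblings (H : Heap K) (x : ℕ) : List ℕ :=
  match H.parent? x with
  | none => H.roots
  | some p => H.kids p

/-- The sibling immediately to the right of `x`. -/
def rightSibling? (H : Heap K) (x : ℕ) : Option ℕ :=
  (H.siblings x)[(H.siblings x).idxOf x + 1]?

/-- The sibling immediately to the left of `x`. -/
def leftSibling? (H : Heap K) (x : ℕ) : Option ℕ :=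
  (H.siblings x).reverse[(H.siblings x).reverse.idxOf x + 1]?

/-- The leftmost child of `x`. -/
def leftmostChild? (H : Heap K) (x : ℕ) : Option ℕ := (H.kids x).head?

/-- `Insert`: the new item becomes the leftmost heap of the forest. -/
def insertKey (H : Heap K) (k : K) : Heap K where
  roots := H.next :: H.roots
  kids := Function.update H.kids H.next []
  key := Function.update H.key H.next k
  live := insert H.next H.live
  next := H.next + 1

/-- `Decrease-Key`: `x` is disconnected from its parent (if it has one), its key is decreased by
`δ`, and the tree of `x` becomes the leftmost heap of the forest. -/
def decreaseKey [Sub K] (H : Heap K) (x : ℕ) (δ : K) : Heap K where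
  roots := x :: H.roots.erase x
  kids := fun z => (H.kids z).erase x
  key := Function.update H.key x (H.key x - δ)
  live := H.live
  next := H.next

/-- The tree with root `y` becomes the leftmost subtree of the root `x`. -/
def pair (H : Heap K) (x y : ℕ) : Heap K :=
  { H with
    roots := H.roots.erase y
    kids := Function.update H.kids x (y :: H.kids x) }

/-- Put `y` immediately to the left of `x` in the list `l`, if `x` occurs in `l`. -/
def insertLeft (x y : ℕ) (l : List ℕ) : List ℕ :=
  l.flatMap fun z => if z = x then [y, x] else [z]

/-- The leftmost child `y` of `x` is disconnected from `x` and becomes the left sibling of `x`. -/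
def unpair (H : Heap K) (x y : ℕ) : Heap K :=
  { H with
    roots := insertLeft x y H.roots
    kids := fun z => insertLeft x y (if z = x then (H.kids x).tail else H.kids z) }

/-- The trees with the roots `x` and `y` exchange their places among the heaps of the forest. -/
def swap (H : Heap K) (x y : ℕ) : Heap K :=
  { H with roots := H.roots.map (Equiv.swap x y) }

/-- The unique root `m` is removed, and its children become the roots. -/
def removeRoot (H : Heap K) (m : ℕ) : Heap K where
  roots := H.kids m
  kids := Function.update H.kids m []
  key := H.key
  live := H.live.erase m
  next := H.next

/-- The requests that a user of the data structure may make. Stored keys are pairwise distinct,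
`Decrease-Key` is applied to a stored item and decreases its key by a nonnegative amount, and
`Extract-Min` is applied to a nonempty heap. -/
def Legal [AddCommGroup K] [LinearOrder K] (H : Heap K) : Op K → Prop
  | .insert k => ∀ y ∈ H.live, H.key y ≠ k
  | .decreaseKey x δ =>
      x ∈ H.live ∧ 0 ≤ δ ∧ ∀ y ∈ H.live, y ≠ x → H.key y ≠ H.key x - δ
  | .extractMin => H.live.Nonempty

end Heap

/-- The suboperations, with `ρ` pointers, that execute an `Extract-Min`. -/
inductive SubOp (ρ : ℕ) where
  | hasParent (i : Fin ρ)
  | hasLeftSibling (i : Fin ρ)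
  | hasRightSibling (i : Fin ρ)
  | hasChildren (i : Fin ρ)
  | compare (i j : Fin ρ)
  | pair (i j : Fin ρ)
  | unpair (i : Fin ρ)
  | set (i j : Fin ρ)
  | swap (i j : Fin ρ)
  | moveToParent (i : Fin ρ)
  | moveToLeftmostChild (i : Fin ρ)
  | moveToRightSibling (i : Fin ρ)
  | moveToLeftSibling (i : Fin ρ)
  | finish

/-- A test performed on nodes by one of the suboperations that return a boolean, together with the
answer. -/
inductive Fact where
  | parent (x : ℕ) (answer : Bool)
  | leftSibling (x : ℕ) (answer : Bool)
  | rightSibling (x : ℕ) (answer : Bool)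
  | children (x : ℕ) (answer : Bool)
  | le (x y : ℕ) (answer : Bool)
  deriving DecidableEq

/-- The state of an `Extract-Min` in progress: the forest, the nodes to which the pointers point,
and the tests (with answers) and the pairings performed so far in this `Extract-Min`. -/
structure Config (ρ : ℕ) (K : Type*) where
  heap : Heap K
  ptr : Fin ρ → ℕ
  tests : List Fact
  pairings : List (ℕ × ℕ)

namespace Config

variable {ρ : ℕ} {K : Type*}

/-- Record the outcome of a test. -/
def record (c : Config ρ K) (t : Fact) : Config ρ K := { c with tests := t :: c.tests }

/-- Let pointer `i` point to node `x`. -/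
def point (c : Config ρ K) (i : Fin ρ) (x : ℕ) : Config ρ K :=
  { c with ptr := Function.update c.ptr i x }

variable [LinearOrder K]

/-- `x` and `y` are roots, the key of `x` is smaller than the key of `y`, and all this has been
verified. -/
def CanPair (c : Config ρ K) (x y : ℕ) : Prop :=
  x ∈ c.heap.roots ∧ y ∈ c.heap.roots ∧ c.heap.key x < c.heap.key y ∧
  Fact.parent x false ∈ c.tests ∧ Fact.parent y false ∈ c.tests ∧
  (Fact.le x y true ∈ c.tests ∨ Fact.le y x false ∈ c.tests)

/-- The forest has a single heap, and this has been verified through a pointer that points to its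
root `m`. -/
def CanFinish (c : Config ρ K) (m : ℕ) : Prop :=
  c.heap.roots = [m] ∧ (∃ i, c.ptr i = m) ∧ Fact.parent m false ∈ c.tests ∧
  Fact.leftSibling m false ∈ c.tests ∧ Fact.rightSibling m false ∈ c.tests

open Classical in
/-- The effect of a suboperation other than `finish`; `none` if a precondition fails. -/
noncomputable def step (c : Config ρ K) : SubOp ρ → Option (Config ρ K)
  | .hasParent i => some (c.record (.parent (c.ptr i) (c.heap.parent? (c.ptr i)).isSome))
  | .hasLeftSibling i =>
      some (c.record (.leftSibling (c.ptr i) (c.heap.leftSibling? (c.ptr i)).isSome))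
  | .hasRightSibling i =>
      some (c.record (.rightSibling (c.ptr i) (c.heap.rightSibling? (c.ptr i)).isSome))
  | .hasChildren i =>
      some (c.record (.children (c.ptr i) (c.heap.leftmostChild? (c.ptr i)).isSome))
  | .compare i j =>
      some (c.record (.le (c.ptr i) (c.ptr j)
        (decide (c.heap.key (c.ptr i) ≤ c.heap.key (c.ptr j)))))
  | .pair i j =>
      if c.CanPair (c.ptr i) (c.ptr j) then
        some { c with
          heap := c.heap.pair (c.ptr i) (c.ptr j)
          pairings := (c.ptr i, c.ptr j) :: c.pairings }
      else none
  | .unpair i =>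
      (c.heap.leftmostChild? (c.ptr i)).bind fun y =>
        if (c.ptr i, y) ∈ c.pairings then some { c with heap := c.heap.unpair (c.ptr i) y }
        else none
  | .set i j => some (c.point i (c.ptr j))
  | .swap i j =>
      if c.ptr i ∈ c.heap.roots ∧ c.ptr j ∈ c.heap.roots then
        some { c with heap := c.heap.swap (c.ptr i) (c.ptr j) }
      else none
  | .moveToParent i =>
      if Fact.parent (c.ptr i) true ∈ c.tests then
        (c.heap.parent? (c.ptr i)).map (c.point i)
      else none
  | .moveToLeftmostChild i =>
      if Fact.children (c.ptr i) true ∈ c.tests then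
        (c.heap.leftmostChild? (c.ptr i)).map (c.point i)
      else none
  | .moveToRightSibling i =>
      if Fact.rightSibling (c.ptr i) true ∈ c.tests then
        (c.heap.rightSibling? (c.ptr i)).map (c.point i)
      else none
  | .moveToLeftSibling i =>
      if Fact.leftSibling (c.ptr i) true ∈ c.tests then
        (c.heap.leftSibling? (c.ptr i)).map (c.point i)
      else none
  | .finish => none

open Classical in
/-- Execute a sequence of suboperations, which has to end in its only `finish`, and then remove
the unique root; `none` if the sequence is not valid. -/
noncomputable def exec (c : Config ρ K) : List (SubOp ρ) → Option (Heap K)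
  | [] => none
  | .finish :: rest =>
      if rest = [] then
        c.heap.roots.head?.bind fun m =>
          if c.CanFinish m then some (c.heap.removeRoot m) else none
      else none
  | s :: rest => (c.step s).bind fun c' => c'.exec rest

end Config

/-- Execute `Extract-Min` by the given suboperations. All pointers start at the leftmost root. -/
noncomputable def Heap.extractMin {ρ : ℕ} {K : Type*} [LinearOrder K] (H : Heap K)
    (l : List (SubOp ρ)) : Option (Heap K) :=
  H.roots.head?.bind fun x => Config.exec ⟨H, fun _ => x, [], []⟩ l

/-- What distinguishes one pure heap with `ρ` pointers from another: the choice of the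
suboperations for each `Extract-Min`. The choice may depend in any way on the whole list of
operations (with their keys) requested so far, which determines everything that the data structure
could know or store. Histories are lists with the most recent operation first, and the argument is
the history before the `Extract-Min`. -/
def Algorithm (ρ : ℕ) (K : Type*) := List (Op K) → List (SubOp ρ)

namespace Algorithm

variable {ρ : ℕ} {K : Type*} [AddCommGroup K] [LinearOrder K]

open Classical in
/-- The heap after the operations of a history (most recent first), starting from the empty heap;
`none` if an operation was not legal or an `Extract-Min` was not validly executed. -/
noncomputable def run (A : Algorithm ρ K) : List (Op K) → Option (Heap K)
  | [] => some Heap.empty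
  | op :: h => (run A h).bind fun H =>
      if H.Legal op then
        match op with
        | .insert k => some (H.insertKey k)
        | .decreaseKey x δ => some (H.decreaseKey x δ)
        | .extractMin => H.extractMin (A h)
      else none

/-- The algorithm is correct: whenever an `Extract-Min` is requested on a nonempty heap, the chosen
sequence of suboperations is valid. -/
def IsValid (A : Algorithm ρ K) : Prop :=
  ∀ h H, A.run h = some H → H.live.Nonempty → (H.extractMin (A h)).isSome

/-- The cost of a history: `1` for each `Insert` and each `Decrease-Key`, and the number of
suboperations for each `Extract-Min`. -/
def cost (A : Algorithm ρ K) : List (Op K) → ℕ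
  | [] => 0
  | .insert _ :: h => cost A h + 1
  | .decreaseKey _ _ :: h => cost A h + 1
  | .extractMin :: h => cost A h + (A h).length

end Algorithm

/-- The sum of the charges `a`, `b` and `d` for each `Insert`, `Extract-Min` and `Decrease-Key` of
a history. -/
noncomputable def charge {K : Type*} (a b d : ℝ) : List (Op K) → ℝ
  | [] => 0
  | .insert _ :: h => charge a b d h + a
  | .extractMin :: h => charge a b d h + b
  | .decreaseKey _ _ :: h => charge a b d h + d

/-- `Insert`, `Extract-Min` and `Decrease-Key` have amortized costs at most `a n`, `b n` and `d n`
on heaps of at most `n` items: the cost of every legal sequence of operations on an initially empty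
heap, in the course of which the heap never holds more than `n` items, is at most the sum of the
amortized costs of its operations. -/
def Algorithm.HasAmortizedCosts {ρ : ℕ} {K : Type*} [AddCommGroup K] [LinearOrder K]
    (A : Algorithm ρ K) (a b d : ℕ → ℝ) : Prop :=
  ∀ (n : ℕ) (h : List (Op K)), (A.run h).isSome →
    (∀ h' H, h' <:+ h → A.run h' = some H → H.size ≤ n) →
    (A.cost h : ℝ) ≤ charge (a n) (b n) (d n) h

end PureHeap

/-! The proof is an information-theoretic adversary argument. The adversary keeps `n` items in the
heap and plays rounds of one Extract-Min, several Decrease-Keys and one Insert. In the order of the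
Decrease-Keys of a round it can hide an arbitrary permutation of `κ` nodes. The permutations can be
decoded from a description of the execution that takes `O(ρ)` bits per suboperation and little else,
so after `n` rounds some execution has at least about `n * log κ!` suboperations, up to a factor
that depends only on `ρ`. With `s` about `(log n)^(2/q)` and `κ` a tenth of `log_s n`, `log κ!` is
at least `q * log n / 160`. A round needs `O(log_s n)` Decrease-Keys, apart from a few that the
suboperations pay for. If each cost less than `(log log n) / q`, the amortized bounds would allow
only `O(n log n)` suboperations, with a constant independent of `q`. A large `q` gives the
contradiction.

Sizes. Every node has a label, and a higher label means a smaller key (`nodeKey`). The label of a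
root is the integer part of the logarithm to base `s` of the size of its tree, so a root is only
ever linked below a root with at least the same label. After an Extract-Min the adversary cuts off
those linked trees that collect at least `s` start roots, and it raises the labels of new roots that
have outgrown them (`Sized.exists_round`). Then a child linked when its parent had label `r` has
size less than `s^(r+2)`, while a node of label greater than `r` has almost `s^(r+1)` nodes below
the children linked at labels up to `r`. A removed minimum with few children must therefore have
children of `κ` clearly different magnitudes, called windows (`Sized.exists_designated`). These
designated nodes get their Decrease-Keys in the hidden order. If there are too many roots or
children, the round hides nothing and its permutation is written out; such rounds are rare, because
many roots make an Extract-Min expensive.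

Decoding. An Extract-Min links the start roots in a way that depends only on its suboperations and
one extra bit for each, not on keys or on the insides of the trees (`SymConf.Describes.exists_exec`,
`Heap.exists_linked`). The decoder can thus follow the forest without knowing which designated node
has which window. It needs a window only when the children of a node become roots, that is, when the
node is removed, and then the description states it. When a node is designated again, only the
change of its window is stated; these changes add up to little, since labels never decrease. That
this suffices is `Sim.step`. The bookkeeping is `Stage.Inv.succ`, injectivity of the code is
`Stage.Inv.eq_of_code_eq`, and the counting results are collected in `exists_execution` and combined
with `exists_parameters`. -/

/-! ### Prefix-free code lengths -/

namespace PureHeap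

/-- The lengths `b` satisfy the Kraft inequality. -/
def Kraft {α : Type*} (b : α → ℕ) : Prop :=
  ∀ F : Finset α, ∑ x ∈ F, (1 / 2 : ℝ) ^ b x ≤ 1

namespace Kraft

variable {α β : Type*}

theorem comp {b : β → ℕ} (hb : Kraft b) {f : α → β} (hf : Function.Injective f) :
    Kraft (b ∘ f) := by
  intro F
  have h := hb (F.map ⟨f, hf⟩)
  rwa [Finset.sum_map] at h

theorem prod {b : α → ℕ} {b' : β → ℕ} (hb : Kraft b) (hb' : Kraft b') :
    Kraft (fun p : α × β => b p.1 + b' p.2) := by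
  classical
  intro F
  calc ∑ x ∈ F, (1 / 2 : ℝ) ^ (b x.1 + b' x.2)
      ≤ ∑ x ∈ F.image Prod.fst ×ˢ F.image Prod.snd, (1 / 2 : ℝ) ^ (b x.1 + b' x.2) := by
        apply Finset.sum_le_sum_of_subset_of_nonneg
        · intro x hx
          simp only [Finset.mem_product, Finset.mem_image]
          exact ⟨⟨x, hx, rfl⟩, ⟨x, hx, rfl⟩⟩
        · intros; positivity
    _ = (∑ x ∈ F.image Prod.fst, (1 / 2 : ℝ) ^ b x) *
          ∑ y ∈ F.image Prod.snd, (1 / 2 : ℝ) ^ b' y := by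
        rw [Finset.sum_mul_sum, Finset.sum_product]
        simp only [pow_add]
    _ ≤ 1 * 1 := by
        gcongr
        · exact hb _
        · exact hb' _
    _ = 1 := one_mul 1

/-- One bit announces each further element and one bit ends the list. By induction on a bound for
the length, the empty list weighs `1/2` and the nonempty lists weigh at most `1/2 * 1 * 1`. -/
theorem list {b : α → ℕ} (hb : Kraft b) :
    Kraft (fun l : List α => (l.map fun x => b x + 1).sum + 1) := by
  classical
  have key : ∀ k : ℕ, ∀ F : Finset (List α), (∀ l ∈ F, l.length ≤ k) →
      ∑ l ∈ F, (1 / 2 : ℝ) ^ ((l.map fun x => b x + 1).sum + 1) ≤ 1 := by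
    intro k
    induction k with
    | zero =>
      intro F hF
      have : F ⊆ {[]} := by
        intro l hl
        simpa using hF l hl
      refine (Finset.sum_le_sum_of_subset_of_nonneg this ?_).trans ?_
      · intros; positivity
      · norm_num
    | succ k ih =>
      intro F hF
      set G := F.filter (· ≠ []) with hG
      set T := G.image List.tail
      set Hd := G.biUnion fun l => l.head?.toFinset
      have hsub : F ⊆ insert [] ((Hd ×ˢ T).image fun p => p.1 :: p.2) := by
        intro l hl
        cases l with
        | nil => simp
        | cons a l =>
          simp only [Finset.mem_insert, Finset.mem_image, Finset.mem_product]
          right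
          refine ⟨(a, l), ⟨?_, ?_⟩, rfl⟩
          · simp only [Hd, Finset.mem_biUnion]
            exact ⟨a :: l, by simp [hG, hl], by simp⟩
          · exact Finset.mem_image.2 ⟨a :: l, by simp [hG, hl], rfl⟩
      refine (Finset.sum_le_sum_of_subset_of_nonneg hsub ?_).trans ?_
      · intros; positivity
      rw [Finset.sum_insert (by simp), Finset.sum_image (by
        rintro ⟨a, l⟩ - ⟨a', l'⟩ - h
        simpa using h), Finset.sum_product]
      simp only [List.map_cons, List.sum_cons, List.map_nil, List.sum_nil]
      have h1 : ∀ (x : α) (y : List α), (1 / 2 : ℝ) ^ (b x + 1 + (y.map fun x => b x + 1).sum + 1)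
          = (1 / 2) * ((1 / 2 : ℝ) ^ b x * (1 / 2) ^ ((y.map fun x => b x + 1).sum + 1)) := by
        intro x y; ring
      simp only [h1, ← Finset.mul_sum]
      rw [← Finset.sum_mul]
      have h2 := hb Hd
      have h3 : ∑ l ∈ T, (1 / 2 : ℝ) ^ ((l.map fun x => b x + 1).sum + 1) ≤ 1 := by
        apply ih
        intro l hl
        obtain ⟨l', hl', rfl⟩ := Finset.mem_image.1 hl
        have := hF l' (Finset.mem_filter.1 hl').1
        simp only [List.length_tail]
        omega
      have h4 : (∑ x ∈ Hd, (1 / 2 : ℝ) ^ b x) *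
          ∑ l ∈ T, (1 / 2 : ℝ) ^ ((l.map fun x => b x + 1).sum + 1) ≤ 1 := by
        refine (mul_le_mul h2 h3 ?_ zero_le_one).trans (by norm_num)
        exact Finset.sum_nonneg fun _ _ => by positivity
      norm_num at h4 ⊢
      linarith
  intro F
  exact key (F.sup List.length) F fun l hl => Finset.le_sup (f := List.length) hl

theorem const_of_card_le [Fintype α] {k : ℕ} (h : Fintype.card α ≤ 2 ^ k) :
    Kraft (fun _ : α => k) := by
  intro F
  rw [Finset.sum_const, nsmul_eq_mul]
  have h1 : (F.card : ℝ) ≤ 2 ^ k := by exact_mod_cast (Finset.card_le_univ F).trans h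
  rw [div_pow, one_pow, mul_one_div, div_le_one (by positivity)]
  exact h1

theorem nat : Kraft (fun k : ℕ => k + 1) := by
  intro F
  have h1 : HasSum (fun k : ℕ => (1 / 2 : ℝ) ^ (k + 1)) 1 := by
    have := hasSum_geometric_two.mul_left (1 / 2)
    simpa [pow_succ, mul_comm] using this
  have h2 := h1.summable.sum_le_tsum F (fun _ _ => by positivity)
  rwa [h1.tsum_eq] at h2

theorem bool : Kraft (fun _ : Bool => 1) := const_of_card_le (by simp)

theorem int : Kraft (fun k : ℤ => 1 + (k.natAbs + 1)) := by
  refine (bool.prod nat).comp (f := fun k : ℤ => (decide (0 ≤ k), k.natAbs)) ?_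
  intro a b h
  simp only [Prod.mk.injEq, decide_eq_decide] at h
  omega

theorem option {b : α → ℕ} (hb : Kraft b) :
    Kraft (fun o : Option α => o.elim 1 fun x => b x + 1) := by
  classical
  intro F
  have hsub : F ⊆ insert none ((F.eraseNone).map Function.Embedding.some) := by
    intro o ho
    cases o with
    | none => simp
    | some x => simp [ho]
  refine (Finset.sum_le_sum_of_subset_of_nonneg hsub ?_).trans ?_
  · intros; positivity
  rw [Finset.sum_insert (by simp), Finset.sum_map]
  simp only [Option.elim_none, Function.Embedding.some_apply, Option.elim_some, pow_succ,
    ← Finset.sum_mul]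
  have := hb F.eraseNone
  norm_num at this ⊢
  linarith

/-- An injective code has a codeword of at least logarithmic length. -/
theorem exists_card_le [Fintype α] [Nonempty α] {b : β → ℕ} (hb : Kraft b) {f : α → β}
    (hf : Function.Injective f) : ∃ x, Fintype.card α ≤ 2 ^ b (f x) := by
  by_contra! h
  have h1 := hb.comp hf Finset.univ
  have h2 : ∑ _x : α, (1 : ℝ) / Fintype.card α < ∑ x : α, (1 / 2 : ℝ) ^ (b ∘ f) x := by
    apply Finset.sum_lt_sum_of_nonempty Finset.univ_nonempty
    intro x _
    have h3 : (2 : ℝ) ^ b (f x) < Fintype.card α := by exact_mod_cast h x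
    rw [div_pow, one_pow]
    exact one_div_lt_one_div_of_lt (by positivity) h3
  rw [Finset.sum_const, nsmul_eq_mul, Finset.card_univ, mul_one_div_cancel] at h2
  · linarith
  · exact_mod_cast Fintype.card_ne_zero

end Kraft

/-- A code for suboperations. -/
def SubOp.code {ρ : ℕ} : SubOp ρ → ℕ × ℕ × ℕ
  | .hasParent i => (0, i, 0)
  | .hasLeftSibling i => (1, i, 0)
  | .hasRightSibling i => (2, i, 0)
  | .hasChildren i => (3, i, 0)
  | .compare i j => (4, i, j)
  | .pair i j => (5, i, j)
  | .unpair i => (6, i, 0)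
  | .set i j => (7, i, j)
  | .swap i j => (8, i, j)
  | .moveToParent i => (9, i, 0)
  | .moveToLeftmostChild i => (10, i, 0)
  | .moveToRightSibling i => (11, i, 0)
  | .moveToLeftSibling i => (12, i, 0)
  | .finish => (13, 0, 0)

theorem SubOp.code_injective {ρ : ℕ} : Function.Injective (SubOp.code (ρ := ρ)) := by
  intro a b h
  cases a <;> cases b <;> simp [SubOp.code, Fin.val_inj] at h <;> simp [h]

/-- The length of the code of a suboperation. -/
def SubOp.bits {ρ : ℕ} (s : SubOp ρ) : ℕ := s.code.1 + 1 + (s.code.2.1 + 1 + (s.code.2.2 + 1))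

theorem SubOp.kraft_bits {ρ : ℕ} : Kraft (SubOp.bits (ρ := ρ)) :=
  (Kraft.nat.prod (Kraft.nat.prod Kraft.nat)).comp SubOp.code_injective

theorem SubOp.bits_le {ρ : ℕ} (s : SubOp ρ) : s.bits ≤ 2 * ρ + 16 := by
  cases s <;> simp [SubOp.bits, SubOp.code] <;> omega

end PureHeap


/-! ### Forests -/

namespace PureHeap

/-- Used to compare two views of the same sibling list around a pointer, one with positions and one
with nodes. -/
theorem eq_of_append_cons_eq {α : Type*} {a b c d : List α} {x : α} (hn : (a ++ x :: b).Nodup)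
    (h : a ++ x :: b = c ++ x :: d) : a = c ∧ b = d := by
  induction a generalizing c with
  | nil =>
    cases c with
    | nil => simpa using h
    | cons y c =>
      simp only [List.nil_append, List.cons_append, List.cons.injEq] at h
      obtain ⟨rfl, rfl⟩ := h
      simp at hn
  | cons y a ih =>
    cases c with
    | nil =>
      simp only [List.nil_append, List.cons_append, List.cons.injEq] at h
      obtain ⟨rfl, rfl⟩ := h
      simp at hn
    | cons z c =>
      simp only [List.cons_append, List.cons.injEq] at h
      obtain ⟨rfl, h⟩ := h
      obtain ⟨rfl, rfl⟩ := ih (by simp only [List.cons_append, List.nodup_cons] at hn; exact hn.2) h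
      exact ⟨rfl, rfl⟩

theorem getElem?_idxOf_succ {l : List ℕ} {x y : ℕ} (h : l[l.idxOf x + 1]? = some y) :
    ∃ a b, l = a ++ x :: y :: b := by
  obtain ⟨h1, h2⟩ := List.getElem?_eq_some_iff.1 h
  have h3 : l.idxOf x < l.length := by omega
  have h4 : l[l.idxOf x] = x := List.getElem_idxOf h3
  refine ⟨l.take (l.idxOf x), l.drop (l.idxOf x + 2), ?_⟩
  have e1 : l.drop (l.idxOf x) = x :: y :: l.drop (l.idxOf x + 2) := by
    rw [List.drop_eq_getElem_cons h3, List.drop_eq_getElem_cons h1, h4, h2]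
  rw [← e1, List.take_append_drop]

theorem getElem?_idxOf_succ_of_eq {l a b : List ℕ} {x y : ℕ} (hn : l.Nodup)
    (h : l = a ++ x :: y :: b) : l[l.idxOf x + 1]? = some y := by
  subst h
  have hx : x ∉ a := by
    intro hx
    rw [List.nodup_append] at hn
    exact hn.2.2 x hx x (by simp) rfl
  rw [List.idxOf_append_of_notMem hx]
  simp

namespace Heap

/-- A forest with the given roots, children and set of nodes. -/
structure IsForest (roots : List ℕ) (kids : ℕ → List ℕ) (live : Finset ℕ) : Prop where
  nodup_roots : roots.Nodup
  nodup_kids : ∀ x, (kids x).Nodup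
  root_notMem : ∀ x ∈ roots, ∀ p, x ∉ kids p
  parent_unique : ∀ x p q, x ∈ kids p → x ∈ kids q → p = q
  mem_live : ∀ x, x ∈ live ↔ x ∈ roots ∨ ∃ p, x ∈ kids p
  parent_live : ∀ x p, x ∈ kids p → p ∈ live

theorem mem_insertLeft {x y z : ℕ} {l : List ℕ} :
    z ∈ insertLeft x y l ↔ z ∈ l ∨ (z = y ∧ x ∈ l) := by
  unfold insertLeft
  simp only [List.mem_flatMap]
  constructor
  · rintro ⟨w, hw, hz⟩
    split_ifs at hz with h
    · subst h
      simp only [List.mem_cons, List.not_mem_nil, or_false] at hz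
      rcases hz with rfl | rfl
      · exact Or.inr ⟨rfl, hw⟩
      · exact Or.inl hw
    · simp only [List.mem_cons, List.not_mem_nil, or_false] at hz
      exact Or.inl (hz ▸ hw)
  · rintro (h | ⟨rfl, h⟩)
    · refine ⟨z, h, ?_⟩
      split_ifs with h' <;> simp [h']
    · exact ⟨x, h, by simp⟩

theorem insertLeft_cons {x y w : ℕ} {l : List ℕ} :
    insertLeft x y (w :: l) = if w = x then y :: x :: insertLeft x y l
      else w :: insertLeft x y l := by
  unfold insertLeft
  split_ifs with h <;> simp [h]

theorem insertLeft_eq_self {x y : ℕ} {l : List ℕ} (h : x ∉ l) : insertLeft x y l = l := by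
  induction l with
  | nil => rfl
  | cons w l ih =>
    simp only [List.mem_cons, not_or] at h
    rw [insertLeft_cons, if_neg (Ne.symm h.1), ih h.2]

theorem insertLeft_append {x y : ℕ} {l l' : List ℕ} :
    insertLeft x y (l ++ l') = insertLeft x y l ++ insertLeft x y l' := by
  simp [insertLeft]

theorem nodup_insertLeft {x y : ℕ} {l : List ℕ} (hl : l.Nodup) (hy : y ∉ l) :
    (insertLeft x y l).Nodup := by
  induction l with
  | nil => exact List.nodup_nil
  | cons w l ih =>
    simp only [List.mem_cons, not_or] at hy
    simp only [List.nodup_cons] at hl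
    rw [insertLeft_cons]
    split_ifs with h
    · subst h
      rw [insertLeft_eq_self hl.1]
      simp [hy, hl]
    · simp only [List.nodup_cons, mem_insertLeft, not_or, not_and]
      exact ⟨⟨hl.1, fun e => absurd e.symm hy.1⟩, ih hl.2 hy.2⟩

theorem map_insertLeft {f : ℕ → ℕ} (hf : Function.Injective f) {x y : ℕ} {l : List ℕ} :
    (insertLeft x y l).map f = insertLeft (f x) (f y) (l.map f) := by
  induction l with
  | nil => rfl
  | cons w l ih =>
    simp only [List.map_cons, insertLeft_cons, hf.eq_iff]
    split_ifs <;> simp [ih]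

theorem length_le_length_insertLeft {x y : ℕ} {l : List ℕ} :
    l.length ≤ (insertLeft x y l).length := by
  induction l with
  | nil => simp
  | cons w l ih =>
    rw [insertLeft_cons]
    split_ifs <;> simp <;> omega

namespace IsForest

variable {roots : List ℕ} {kids : ℕ → List ℕ} {live : Finset ℕ}

theorem kids_live (h : IsForest roots kids live) {x p : ℕ} (hx : x ∈ kids p) : x ∈ live :=
  (h.mem_live x).2 (Or.inr ⟨p, hx⟩)

theorem roots_live (h : IsForest roots kids live) {x : ℕ} (hx : x ∈ roots) : x ∈ live :=
  (h.mem_live x).2 (Or.inl hx)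

theorem pair (h : IsForest roots kids live) {x y : ℕ} (hx : x ∈ roots) (hy : y ∈ roots)
    (hxy : x ≠ y) :
    IsForest (roots.erase y) (Function.update kids x (y :: kids x)) live := by
  have hm : ∀ z p, z ∈ Function.update kids x (y :: kids x) p ↔ z ∈ kids p ∨ (z = y ∧ p = x) := by
    intro z p
    by_cases hp : p = x
    · subst hp; simp [or_comm]
    · simp [hp]
  refine ⟨h.nodup_roots.erase y, ?_, ?_, ?_, ?_, ?_⟩
  · intro z
    by_cases hz : z = x
    · subst hz
      simp [h.nodup_kids, h.root_notMem y hy]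
    · simp [hz, h.nodup_kids]
  · intro z hz p
    rw [h.nodup_roots.mem_erase_iff] at hz
    rw [hm]
    rintro (h1 | h1)
    · exact h.root_notMem z hz.2 p h1
    · exact hz.1 h1.1
  · intro z p q hp hq
    rw [hm] at hp hq
    rcases hp with hp | hp <;> rcases hq with hq | hq
    · exact h.parent_unique z p q hp hq
    · exact absurd (hq.1 ▸ hp) (h.root_notMem y hy p)
    · exact absurd (hp.1 ▸ hq) (h.root_notMem y hy q)
    · rw [hp.2, hq.2]
  · intro z
    rw [h.mem_live, h.nodup_roots.mem_erase_iff]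
    simp only [hm]
    constructor
    · rintro (h1 | ⟨p, h1⟩)
      · by_cases hz : z = y
        · exact Or.inr ⟨x, Or.inr ⟨hz, rfl⟩⟩
        · exact Or.inl ⟨hz, h1⟩
      · exact Or.inr ⟨p, Or.inl h1⟩
    · rintro (h1 | ⟨p, h1 | h1⟩)
      · exact Or.inl h1.2
      · exact Or.inr ⟨p, h1⟩
      · exact Or.inl (h1.1 ▸ hy)
  · intro z p hz
    rw [hm] at hz
    rcases hz with hz | hz
    · exact h.parent_live z p hz
    · exact hz.2 ▸ h.roots_live hx

/-- Exactly one of the lists contains `x`, so `insertLeft` changes only that one, and `y` joins the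
siblings of `x` wherever `x` is. -/
theorem unpair (h : IsForest roots kids live) {x y : ℕ} (hy : (kids x).head? = some y)
    (hxy : x ≠ y) :
    IsForest (insertLeft x y roots)
      (fun z => insertLeft x y (if z = x then (kids x).tail else kids z)) live := by
  obtain ⟨l, hl⟩ : ∃ l, kids x = y :: l := by
    cases hk : kids x with
    | nil => simp [hk] at hy
    | cons a l => simp [hk] at hy; exact ⟨l, by rw [hy]⟩
  have hyx : y ∈ kids x := by simp [hl]
  have hnd := h.nodup_kids x
  rw [hl, List.nodup_cons] at hnd
  set k' : ℕ → List ℕ := fun z => if z = x then (kids x).tail else kids z with hk'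
  have hm : ∀ z p, z ∈ k' p ↔ z ∈ kids p ∧ z ≠ y := by
    intro z p
    simp only [hk']
    split_ifs with hp
    · subst hp
      rw [hl, List.tail_cons, List.mem_cons]
      constructor
      · intro hz
        exact ⟨Or.inr hz, fun e => hnd.1 (e ▸ hz)⟩
      · rintro ⟨h1 | h1, h2⟩
        · exact absurd h1 h2
        · exact h1
    · constructor
      · intro hz
        refine ⟨hz, ?_⟩
        rintro rfl
        exact hp (h.parent_unique z p x hz hyx)
      · exact fun hz => hz.1
  have hyr : y ∉ roots := fun hr => h.root_notMem y hr x hyx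
  have hxy' : ∀ p, x ∈ k' p ↔ x ∈ kids p := fun p => by simp [hm, hxy]
  change IsForest (insertLeft x y roots) (fun z => insertLeft x y (k' z)) live
  refine ⟨nodup_insertLeft h.nodup_roots hyr, ?_, ?_, ?_, ?_, ?_⟩
  · intro z
    refine nodup_insertLeft ?_ ?_
    · simp only [hk']
      split_ifs
      · rw [hl]; exact hnd.2
      · exact h.nodup_kids z
    · simp [hm]
  · intro z hz p hp
    rw [mem_insertLeft] at hz hp
    rw [hm, hxy'] at hp
    rcases hz with hz | hz <;> rcases hp with hp | hp
    · exact h.root_notMem z hz p hp.1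
    · exact hyr (hp.1 ▸ hz)
    · exact hp.2 hz.1
    · exact h.root_notMem x hz.2 p hp.2
  · intro z p q hp hq
    rw [mem_insertLeft, hm, hxy'] at hp hq
    rcases hp with hp | hp <;> rcases hq with hq | hq
    · exact h.parent_unique z p q hp.1 hq.1
    · exact absurd hq.1 hp.2
    · exact absurd hp.1 hq.2
    · exact h.parent_unique x p q hp.2 hq.2
  · intro z
    simp only [mem_insertLeft, hm]
    by_cases hz : z = y
    · subst hz
      have h1 := (h.mem_live x).1 (h.parent_live z x hyx)
      have h2 := h.kids_live hyx
      simpa [h2, hyr, hxy] using h1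
    · rw [h.mem_live]
      simp [hz]
  · intro z p hz
    rw [mem_insertLeft, hm, hxy'] at hz
    rcases hz with hz | hz
    · exact h.parent_live z p hz.1
    · exact h.parent_live x p hz.2

theorem swap (h : IsForest roots kids live) {x y : ℕ} (hx : x ∈ roots) (hy : y ∈ roots) :
    IsForest (roots.map (Equiv.swap x y)) kids live := by
  have hm : ∀ z, z ∈ roots.map (Equiv.swap x y) ↔ z ∈ roots := by
    intro z
    rw [List.mem_map]
    constructor
    · rintro ⟨w, hw, rfl⟩
      by_cases h1 : w = x
      · subst h1; simpa
      · by_cases h2 : w = y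
        · subst h2; simpa
        · rwa [Equiv.swap_apply_of_ne_of_ne h1 h2]
    · intro hz
      refine ⟨Equiv.swap x y z, ?_, by simp⟩
      by_cases h1 : z = x
      · subst h1; simpa
      · by_cases h2 : z = y
        · subst h2; simpa
        · rwa [Equiv.swap_apply_of_ne_of_ne h1 h2]
  refine ⟨h.nodup_roots.map (Equiv.swap x y).injective, h.nodup_kids, ?_, h.parent_unique, ?_,
    h.parent_live⟩
  · intro z hz
    exact h.root_notMem z ((hm z).1 hz)
  · intro z
    rw [h.mem_live, hm]

end IsForest

section Navigation

variable {K : Type*} {H : Heap K} {live : Finset ℕ}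

theorem parent?_eq_some (h : IsForest H.roots H.kids live) (hlt : ∀ x ∈ live, x < H.next)
    {x p : ℕ} :
    H.parent? x = some p ↔ x ∈ H.kids p := by
  unfold parent?
  constructor
  · intro hp
    simpa using List.find?_some hp
  · intro hp
    cases hq : (List.range H.next).find? fun p => decide (x ∈ H.kids p) with
    | none =>
      rw [List.find?_eq_none] at hq
      have := hq p (List.mem_range.2 (hlt p (h.parent_live x p hp)))
      simp [hp] at this
    | some q =>
      have : x ∈ H.kids q := by simpa using List.find?_some hq
      rw [h.parent_unique x p q hp this]

theorem siblings_of_mem_kids (h : IsForest H.roots H.kids live) (hlt : ∀ x ∈ live, x < H.next)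
    {x p : ℕ} (hx : x ∈ H.kids p) : H.siblings x = H.kids p := by
  unfold siblings
  rw [(parent?_eq_some h hlt).2 hx]

theorem siblings_of_mem_roots (h : IsForest H.roots H.kids live) (hlt : ∀ x ∈ live, x < H.next)
    {x : ℕ} (hx : x ∈ H.roots) : H.siblings x = H.roots := by
  unfold siblings
  cases hp : H.parent? x with
  | none => rfl
  | some p => exact absurd ((parent?_eq_some h hlt).1 hp) (h.root_notMem x hx p)

theorem nodup_siblings (h : IsForest H.roots H.kids live) {x : ℕ} : (H.siblings x).Nodup := by
  unfold siblings
  split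
  · exact h.nodup_roots
  · exact h.nodup_kids _

theorem mem_siblings (h : IsForest H.roots H.kids live) (hlt : ∀ x ∈ live, x < H.next) {x : ℕ}
    (hx : x ∈ live) : x ∈ H.siblings x := by
  rcases (h.mem_live x).1 hx with h1 | ⟨p, h1⟩
  · rwa [siblings_of_mem_roots h hlt h1]
  · rwa [siblings_of_mem_kids h hlt h1]

theorem exists_of_rightSibling? {x y : ℕ} (h : H.rightSibling? x = some y) :
    ∃ a b, H.siblings x = a ++ x :: y :: b := getElem?_idxOf_succ h

theorem exists_of_leftSibling? {x y : ℕ} (h : H.leftSibling? x = some y) :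
    ∃ a b, H.siblings x = a ++ y :: x :: b := by
  obtain ⟨a, b, e⟩ := getElem?_idxOf_succ h
  refine ⟨b.reverse, a.reverse, ?_⟩
  rw [← List.reverse_reverse (H.siblings x), e]
  simp

theorem rightSibling?_eq_some {x y : ℕ} {a b : List ℕ} (hn : (H.siblings x).Nodup)
    (h : H.siblings x = a ++ x :: y :: b) : H.rightSibling? x = some y :=
  getElem?_idxOf_succ_of_eq hn h

theorem leftSibling?_eq_some {x y : ℕ} {a b : List ℕ} (hn : (H.siblings x).Nodup)
    (h : H.siblings x = a ++ y :: x :: b) : H.leftSibling? x = some y := by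
  refine getElem?_idxOf_succ_of_eq (a := b.reverse) (b := a.reverse) (List.nodup_reverse.2 hn) ?_
  rw [h]; simp

end Navigation

/-- A well-formed heap: a heap-ordered forest. -/
structure WF {K : Type*} [LinearOrder K] (H : Heap K) : Prop where
  forest : IsForest H.roots H.kids H.live
  live_lt : ∀ x ∈ H.live, x < H.next
  order : ∀ x z, z ∈ H.kids x → H.key x < H.key z

end Heap

end PureHeap


/-! ### Symbolic execution of the suboperations -/

namespace PureHeap

/-- The state of an `Extract-Min` in terms of the positions of the roots at its start: the links
made so far between these positions, and for each pointer the position of the start root in whose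
part of the forest it is, and whether it is strictly below that start root. -/
structure SymConf (ρ : ℕ) where
  heap : Heap Unit
  ptr : Fin ρ → ℕ × Bool

namespace SymConf

variable {ρ : ℕ}

/-- Let pointer `i` point to the place `x`. -/
def point (c : SymConf ρ) (i : Fin ρ) (x : ℕ × Bool) : SymConf ρ :=
  { c with ptr := Function.update c.ptr i x }

/-- The start of an `Extract-Min` with `d` roots. -/
def start (ρ d : ℕ) : SymConf ρ where
  heap := ⟨List.range d, fun _ => [], fun _ => (), Finset.range d, d⟩
  ptr := fun _ => (0, false)

/-- The effect of a suboperation. The flag tells whether a move from below a start root leads to a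
start root. -/
def step (c : SymConf ρ) (flag : Bool) : SubOp ρ → SymConf ρ
  | .pair i j => { c with heap := c.heap.pair (c.ptr i).1 (c.ptr j).1 }
  | .unpair i =>
      match c.heap.leftmostChild? (c.ptr i).1 with
      | some q => { c with heap := c.heap.unpair (c.ptr i).1 q }
      | none => c
  | .set i j => c.point i (c.ptr j)
  | .swap i j => { c with heap := c.heap.swap (c.ptr i).1 (c.ptr j).1 }
  | .moveToParent i =>
      if (c.ptr i).2 then c.point i ((c.ptr i).1, !flag)
      else c.point i ((c.heap.parent? (c.ptr i).1).getD 0, false)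
  | .moveToLeftmostChild i =>
      if (c.ptr i).2 then c
      else match c.heap.leftmostChild? (c.ptr i).1 with
        | some q => c.point i (q, false)
        | none => c.point i ((c.ptr i).1, true)
  | .moveToRightSibling i =>
      if (c.ptr i).2 then c
      else match c.heap.rightSibling? (c.ptr i).1 with
        | some q => c.point i (q, false)
        | none => c.point i ((c.heap.parent? (c.ptr i).1).getD 0, true)
  | .moveToLeftSibling i =>
      if (c.ptr i).2 then
        if flag then c.point i ((c.heap.kids (c.ptr i).1).getLast?.getD 0, false) else c
      else c.point i ((c.heap.leftSibling? (c.ptr i).1).getD 0, false)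
  | _ => c

/-- The effect of a sequence of suboperations. -/
def exec (c : SymConf ρ) (w : List (SubOp ρ × Bool)) : SymConf ρ :=
  w.foldl (fun c p => c.step p.2 p.1) c

end SymConf

namespace Heap

variable {K : Type*}

/-- The root at position `p`. -/
def rootAt (H : Heap K) (p : ℕ) : ℕ :=
  -- Positions beyond the list get unused names, all different, so that the map is injective on all
  -- of `ℕ`.
  if h : p < H.roots.length then H.roots[p] else H.next + p

theorem rootAt_mem {H : Heap K} {p : ℕ} (h : p < H.roots.length) : H.rootAt p ∈ H.roots := by
  rw [rootAt, dif_pos h]; exact List.getElem_mem h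

theorem exists_rootAt_eq {H : Heap K} {x : ℕ} (hx : x ∈ H.roots) :
    ∃ p < H.roots.length, H.rootAt p = x := by
  obtain ⟨p, hp, e⟩ := List.getElem_of_mem hx
  exact ⟨p, hp, by rw [rootAt, dif_pos hp, e]⟩

theorem map_rootAt_range (H : Heap K) : (List.range H.roots.length).map H.rootAt = H.roots := by
  apply List.ext_getElem
  · simp
  · intro i h1 h2
    simp [rootAt, h2]

variable [LinearOrder K]

theorem WF.rootAt_injective {H : Heap K} (h : H.WF) : Function.Injective H.rootAt := by
  have hlt : ∀ p, p < H.roots.length → H.rootAt p < H.next := fun p hp =>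
    h.live_lt _ (h.forest.roots_live (rootAt_mem hp))
  intro p q e
  by_cases hp : p < H.roots.length <;> by_cases hq : q < H.roots.length
  · simp only [rootAt, hp, hq, dif_pos] at e
    exact (h.forest.nodup_roots.getElem_inj_iff).1 e
  · have h1 := hlt p hp
    have h2 : H.rootAt q = H.next + q := by rw [rootAt, dif_neg hq]
    omega
  · have h1 := hlt q hq
    have h2 : H.rootAt p = H.next + p := by rw [rootAt, dif_neg hp]
    omega
  · have h1 : H.rootAt p = H.next + p := by rw [rootAt, dif_neg hp]
    have h2 : H.rootAt q = H.next + q := by rw [rootAt, dif_neg hq]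
    omega

theorem WF.pair {H : Heap K} (h : H.WF) {x y : ℕ} (hx : x ∈ H.roots) (hy : y ∈ H.roots)
    (hxy : H.key x < H.key y) : (H.pair x y).WF := by
  refine ⟨h.forest.pair hx hy (fun e => ?_), h.live_lt, ?_⟩
  · subst e; exact lt_irrefl _ hxy
  · intro z w hw
    change w ∈ Function.update H.kids x (y :: H.kids x) z at hw
    change H.key z < H.key w
    by_cases hz : z = x
    · subst hz
      simp only [Function.update_self, List.mem_cons] at hw
      rcases hw with rfl | hw
      · exact hxy
      · exact h.order _ _ hw
    · rw [Function.update_of_ne hz] at hw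
      exact h.order _ _ hw

theorem WF.unpair {H : Heap K} (h : H.WF) {x y : ℕ} (hy : H.leftmostChild? x = some y) :
    (H.unpair x y).WF := by
  have hyx : y ∈ H.kids x := List.mem_of_head? hy
  have hlt := h.order x y hyx
  have hxy : x ≠ y := by rintro rfl; exact lt_irrefl _ hlt
  refine ⟨h.forest.unpair hy hxy, h.live_lt, ?_⟩
  intro z w hw
  change w ∈ insertLeft x y (if z = x then (H.kids x).tail else H.kids z) at hw
  change H.key z < H.key w
  rw [mem_insertLeft] at hw
  have h1 : ∀ v, v ∈ (if z = x then (H.kids x).tail else H.kids z) → H.key z < H.key v := by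
    intro v hv
    split_ifs at hv with hz
    · subst hz; exact h.order _ _ (List.mem_of_mem_tail hv)
    · exact h.order _ _ hv
  rcases hw with hw | ⟨rfl, hw⟩
  · exact h1 w hw
  · exact (h1 x hw).trans hlt

theorem WF.swap {H : Heap K} (h : H.WF) {x y : ℕ} (hx : x ∈ H.roots) (hy : y ∈ H.roots) :
    (H.swap x y).WF :=
  ⟨h.forest.swap hx hy, h.live_lt, h.order⟩

end Heap

variable {ρ : ℕ} {K : Type*} [LinearOrder K]

/-- `y` is strictly below `x`. -/
def Heap.Below (H : Heap K) : ℕ → ℕ → Prop := Relation.TransGen fun x y => y ∈ H.kids x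

/-- The state `c` of an `Extract-Min` that started from `H` is described by `s`. -/
structure SymConf.Describes (s : SymConf ρ) (H : Heap K) (c : Config ρ K) : Prop where
  start_wf : H.WF
  wf : c.heap.WF
  key_eq : c.heap.key = H.key
  live_eq : c.heap.live = H.live
  next_eq : c.heap.next = H.next
  roots_eq : c.heap.roots = s.heap.roots.map H.rootAt
  -- New links stand to the left of all children that the root had at the start; this makes the old
  -- part invisible to the positions.
  kids_root : ∀ p < H.roots.length,
    c.heap.kids (H.rootAt p) = (s.heap.kids p).map H.rootAt ++ H.kids (H.rootAt p)
  kids_other : ∀ x ∉ H.roots, c.heap.kids x = H.kids x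
  forest : Heap.IsForest s.heap.roots s.heap.kids (Finset.range H.roots.length)
  sym_next : s.heap.next = H.roots.length
  ptr_lt : ∀ i, (s.ptr i).1 < H.roots.length
  ptr_root : ∀ i, (s.ptr i).2 = false → c.ptr i = H.rootAt (s.ptr i).1
  ptr_below : ∀ i, (s.ptr i).2 = true → H.Below (H.rootAt (s.ptr i).1) (c.ptr i)
  pairings : ∀ p ∈ c.pairings, p.1 ∈ H.roots ∧ p.2 ∈ H.roots

namespace SymConf.Describes

variable {s : SymConf ρ} {H : Heap K} {c : Config ρ K}

theorem sym_lt (h : s.Describes H c) : ∀ x ∈ Finset.range H.roots.length, x < s.heap.next := by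
  intro x hx
  rw [h.sym_next]
  exact Finset.mem_range.1 hx

theorem start (hH : H.WF) {x : ℕ} (hx : H.roots.head? = some x) :
    (SymConf.start ρ H.roots.length).Describes H ⟨H, fun _ => x, [], []⟩ := by
  have hpos : 0 < H.roots.length := by
    cases hr : H.roots with
    | nil => simp [hr] at hx
    | cons a l => simp
  refine ⟨hH, hH, rfl, rfl, rfl, (H.map_rootAt_range).symm, ?_, fun _ _ => rfl, ?_, rfl, ?_, ?_, ?_,
    by simp⟩
  · intro p _
    simp [SymConf.start]
  · refine ⟨List.nodup_range, ?_, ?_, ?_, ?_, ?_⟩ <;> simp [SymConf.start]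
  · intro i
    exact hpos
  · intro i _
    change x = H.rootAt 0
    rw [Heap.rootAt, dif_pos hpos]
    rw [List.head?_eq_getElem?, List.getElem?_eq_getElem hpos] at hx
    exact (Option.some.inj hx).symm
  · intro i hi
    simp [SymConf.start] at hi

theorem mem_roots_iff (h : s.Describes H c) {p : ℕ} :
    H.rootAt p ∈ c.heap.roots ↔ p ∈ s.heap.roots := by
  rw [h.roots_eq, List.mem_map_of_injective h.start_wf.rootAt_injective]

theorem root_mem_start (h : s.Describes H c) {x : ℕ} (hx : x ∈ c.heap.roots) : x ∈ H.roots := by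
  rw [h.roots_eq, List.mem_map] at hx
  obtain ⟨p, hp, rfl⟩ := hx
  exact Heap.rootAt_mem (Finset.mem_range.1 (h.forest.roots_live hp))

theorem not_below_root (h : s.Describes H c) {x y : ℕ} (hy : y ∈ H.roots) : ¬ H.Below x y := by
  intro hb
  cases hb with
  | single h1 => exact h.start_wf.forest.root_notMem y hy _ h1
  | tail _ h1 => exact h.start_wf.forest.root_notMem y hy _ h1

theorem ptr_of_mem_roots (h : s.Describes H c) {i : Fin ρ} (hi : c.ptr i ∈ H.roots) :
    (s.ptr i).2 = false ∧ c.ptr i = H.rootAt (s.ptr i).1 := by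
  cases hb : (s.ptr i).2 with
  | false => exact ⟨rfl, h.ptr_root i hb⟩
  | true => exact absurd (h.ptr_below i hb) (h.not_below_root hi)

theorem kids_lt (h : s.Describes H c) {p q : ℕ} (hq : q ∈ s.heap.kids p) :
    q < H.roots.length ∧ p < H.roots.length :=
  ⟨Finset.mem_range.1 (h.forest.kids_live hq), Finset.mem_range.1 (h.forest.parent_live _ _ hq)⟩

theorem mem_kids_iff (h : s.Describes H c) {p q : ℕ} (hp : p < H.roots.length)
    (hq : q < H.roots.length) : H.rootAt q ∈ c.heap.kids (H.rootAt p) ↔ q ∈ s.heap.kids p := by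
  rw [h.kids_root p hp, List.mem_append, List.mem_map_of_injective h.start_wf.rootAt_injective]
  constructor
  · rintro (h1 | h1)
    · exact h1
    · exact absurd h1 (h.start_wf.forest.root_notMem _ (Heap.rootAt_mem hq) _)
  · exact Or.inl

theorem kids_suffix (h : s.Describes H c) (x : ℕ) : H.kids x <:+ c.heap.kids x := by
  by_cases hx : x ∈ H.roots
  · obtain ⟨p, hp, rfl⟩ := Heap.exists_rootAt_eq hx
    rw [h.kids_root p hp]
    exact List.suffix_append _ _
  · rw [h.kids_other x hx]

theorem siblings_root (h : s.Describes H c) {p : ℕ} (hp : p < H.roots.length) :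
    ∃ old, c.heap.siblings (H.rootAt p) = (s.heap.siblings p).map H.rootAt ++ old ∧
      (old = [] ∨ ∃ q, s.heap.parent? p = some q ∧ q < H.roots.length ∧
        old = H.kids (H.rootAt q)) := by
  rcases (h.forest.mem_live p).1 (Finset.mem_range.2 hp) with h1 | ⟨q, h1⟩
  · refine ⟨[], ?_, Or.inl rfl⟩
    rw [Heap.siblings_of_mem_roots h.forest h.sym_lt h1,
      Heap.siblings_of_mem_roots h.wf.forest h.wf.live_lt (h.mem_roots_iff.2 h1), h.roots_eq,
      List.append_nil]
  · have hq := (h.kids_lt h1).2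
    refine ⟨H.kids (H.rootAt q), ?_, Or.inr ⟨q, ?_, hq, rfl⟩⟩
    · rw [Heap.siblings_of_mem_kids h.forest h.sym_lt h1,
        Heap.siblings_of_mem_kids h.wf.forest h.wf.live_lt ((h.mem_kids_iff hq hp).2 h1),
        h.kids_root q hq]
    · exact (Heap.parent?_eq_some h.forest h.sym_lt).2 h1

theorem nodup_siblings (h : s.Describes H c) (x : ℕ) : (c.heap.siblings x).Nodup :=
  Heap.nodup_siblings h.wf.forest

/-- A pointer below a start root: its parent, and the children of the parent. -/
theorem exists_parent_of_below (h : s.Describes H c) {p x : ℕ} (hp : p < H.roots.length)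
    (hb : H.Below (H.rootAt p) x) :
    ∃ y, x ∈ H.kids y ∧ c.heap.parent? x = some y ∧ c.heap.siblings x = c.heap.kids y ∧
      ((y = H.rootAt p ∧ c.heap.kids y = (s.heap.kids p).map H.rootAt ++ H.kids y) ∨
        (H.Below (H.rootAt p) y ∧ c.heap.kids y = H.kids y)) := by
  have key : ∀ y, x ∈ H.kids y → c.heap.parent? x = some y ∧ c.heap.siblings x = c.heap.kids y := by
    intro y hy
    have h1 : x ∈ c.heap.kids y := (h.kids_suffix y).mem hy
    exact ⟨(Heap.parent?_eq_some h.wf.forest h.wf.live_lt).2 h1,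
      Heap.siblings_of_mem_kids h.wf.forest h.wf.live_lt h1⟩
  cases hb with
  | single h1 => exact ⟨_, h1, (key _ h1).1, (key _ h1).2, Or.inl ⟨rfl, h.kids_root p hp⟩⟩
  | tail h1 h2 =>
    exact ⟨_, h2, (key _ h2).1, (key _ h2).2,
      Or.inr ⟨h1, h.kids_other _ fun hr => h.not_below_root hr h1⟩⟩

theorem congr_heap (h : s.Describes H c) {c' : Config ρ K} (h1 : c'.heap = c.heap)
    (h2 : c'.ptr = c.ptr) (h3 : c'.pairings = c.pairings) : s.Describes H c' := by
  obtain ⟨a1, a2, a3, a4, a5, a6, a7, a8, a9, a10, a11, a12, a13, a14⟩ := h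
  exact ⟨a1, h1 ▸ a2, h1 ▸ a3, h1 ▸ a4, h1 ▸ a5, h1 ▸ a6, h1 ▸ a7, h1 ▸ a8, a9, a10, a11, h2 ▸ a12,
    h2 ▸ a13, h3 ▸ a14⟩

theorem point_root (h : s.Describes H c) {i : Fin ρ} {p : ℕ} (hp : p < H.roots.length) :
    (s.point i (p, false)).Describes H (c.point i (H.rootAt p)) := by
  refine ⟨h.start_wf, h.wf, h.key_eq, h.live_eq, h.next_eq, h.roots_eq, h.kids_root, h.kids_other,
    h.forest, h.sym_next, ?_, ?_, ?_, h.pairings⟩ <;> intro j <;> by_cases hj : j = i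
  · subst hj; simpa [SymConf.point] using hp
  · simpa [SymConf.point, hj] using h.ptr_lt j
  · subst hj; simp [SymConf.point, Config.point]
  · simpa [SymConf.point, Config.point, hj] using h.ptr_root j
  · subst hj; simp [SymConf.point]
  · simpa [SymConf.point, Config.point, hj] using h.ptr_below j

theorem point_below (h : s.Describes H c) {i : Fin ρ} {p x : ℕ} (hp : p < H.roots.length)
    (hx : H.Below (H.rootAt p) x) : (s.point i (p, true)).Describes H (c.point i x) := by
  refine ⟨h.start_wf, h.wf, h.key_eq, h.live_eq, h.next_eq, h.roots_eq, h.kids_root, h.kids_other,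
    h.forest, h.sym_next, ?_, ?_, ?_, h.pairings⟩ <;> intro j <;> by_cases hj : j = i
  · subst hj; simpa [SymConf.point] using hp
  · simpa [SymConf.point, hj] using h.ptr_lt j
  · subst hj; simp [SymConf.point]
  · simpa [SymConf.point, Config.point, hj] using h.ptr_root j
  · subst hj; simpa [SymConf.point, Config.point] using hx
  · simpa [SymConf.point, Config.point, hj] using h.ptr_below j

theorem point_same (s : SymConf ρ) (i : Fin ρ) : s.point i (s.ptr i) = s := by
  simp [SymConf.point]

theorem pair (h : s.Describes H c) {i j : Fin ρ} (hc : c.CanPair (c.ptr i) (c.ptr j)) :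
    (s.step false (.pair i j)).Describes H
      { c with heap := c.heap.pair (c.ptr i) (c.ptr j)
               pairings := (c.ptr i, c.ptr j) :: c.pairings } := by
  obtain ⟨hi, hj, hlt, -⟩ := hc
  obtain ⟨hi2, hi3⟩ := h.ptr_of_mem_roots (h.root_mem_start hi)
  obtain ⟨hj2, hj3⟩ := h.ptr_of_mem_roots (h.root_mem_start hj)
  have inj := h.start_wf.rootAt_injective
  have wf' := h.wf.pair hi hj hlt
  rw [hi3] at hi wf' hlt
  rw [hj3] at hj wf' hlt
  set p := (s.ptr i).1
  set q := (s.ptr j).1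
  have hpq : p ≠ q := by
    intro e; rw [e] at hlt; exact lt_irrefl _ hlt
  refine ⟨h.start_wf, by rw [hi3, hj3]; exact wf', h.key_eq, h.live_eq, h.next_eq, ?_, ?_, ?_, ?_,
    h.sym_next, h.ptr_lt, h.ptr_root, h.ptr_below, ?_⟩
  · change c.heap.roots.erase (c.ptr j) = (s.heap.roots.erase q).map H.rootAt
    rw [h.roots_eq, hj3, List.map_erase inj]
  · intro r hr
    change Function.update c.heap.kids (c.ptr i) (c.ptr j :: c.heap.kids (c.ptr i)) (H.rootAt r) =
      (Function.update s.heap.kids p (q :: s.heap.kids p) r).map H.rootAt ++ H.kids (H.rootAt r)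
    rw [hi3, hj3]
    by_cases e : r = p
    · subst e
      simp [h.kids_root _ hr]
    · rw [Function.update_of_ne (inj.ne e), Function.update_of_ne e, h.kids_root _ hr]
  · intro x hx
    change Function.update c.heap.kids (c.ptr i) (c.ptr j :: c.heap.kids (c.ptr i)) x = H.kids x
    rw [Function.update_of_ne, h.kids_other x hx]
    rw [hi3]
    rintro rfl
    exact hx (Heap.rootAt_mem (h.ptr_lt i))
  · exact h.forest.pair (h.mem_roots_iff.1 hi) (h.mem_roots_iff.1 hj) hpq
  · intro r hr
    simp only [List.mem_cons] at hr
    rcases hr with rfl | hr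
    · exact ⟨hi3 ▸ Heap.rootAt_mem (h.ptr_lt i), hj3 ▸ Heap.rootAt_mem (h.ptr_lt j)⟩
    · exact h.pairings r hr

/-- Only links made in the same Extract-Min can be undone, so both ends are start roots. Undoing an
older link would bring an unknown node to the surface. -/
theorem unpair (h : s.Describes H c) {i : Fin ρ} {y : ℕ}
    (hy : c.heap.leftmostChild? (c.ptr i) = some y) (hmem : (c.ptr i, y) ∈ c.pairings) :
    (s.step false (.unpair i)).Describes H { c with heap := c.heap.unpair (c.ptr i) y } := by
  obtain ⟨hx, hyr⟩ := h.pairings _ hmem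
  obtain ⟨-, hi3⟩ := h.ptr_of_mem_roots hx
  obtain ⟨q, hq, rfl⟩ := Heap.exists_rootAt_eq hyr
  have inj := h.start_wf.rootAt_injective
  have wf' := h.wf.unpair hy
  have hp := h.ptr_lt i
  rw [hi3] at hy wf'
  have hlt := h.wf.order _ _ (List.mem_of_head? hy)
  set p := (s.ptr i).1 with hpdef
  have hpq : p ≠ q := by
    intro e; rw [e] at hlt; exact lt_irrefl _ hlt
  obtain ⟨l, hl⟩ : ∃ l, s.heap.kids p = q :: l := by
    have h1 : q ∈ s.heap.kids p := (h.mem_kids_iff hp hq).1 (List.mem_of_head? hy)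
    cases hk : s.heap.kids p with
    | nil => simp [hk] at h1
    | cons a l =>
      rw [Heap.leftmostChild?, h.kids_root p hp, hk] at hy
      simp only [List.map_cons, List.cons_append, List.head?_cons, Option.some.injEq] at hy
      exact ⟨l, by rw [inj hy]⟩
  have hq' : s.heap.leftmostChild? p = some q := by simp [Heap.leftmostChild?, hl]
  have hs : s.step false (.unpair i) = { s with heap := s.heap.unpair p q } := by
    simp only [SymConf.step, ← hpdef, hq']
  have hnot : ∀ z, H.rootAt p ∉ H.kids z := fun z =>
    h.start_wf.forest.root_notMem _ (Heap.rootAt_mem hp) z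
  rw [hs]
  refine ⟨h.start_wf, by rw [hi3]; exact wf', h.key_eq, h.live_eq, h.next_eq, ?_, ?_, ?_, ?_,
    h.sym_next, h.ptr_lt, h.ptr_root, h.ptr_below, h.pairings⟩
  · change Heap.insertLeft (c.ptr i) (H.rootAt q) c.heap.roots =
      (Heap.insertLeft p q s.heap.roots).map H.rootAt
    rw [h.roots_eq, hi3, Heap.map_insertLeft inj]
  · intro r hr
    change Heap.insertLeft (c.ptr i) (H.rootAt q) (if H.rootAt r = c.ptr i then
      (c.heap.kids (c.ptr i)).tail else c.heap.kids (H.rootAt r)) =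
      (Heap.insertLeft p q (if r = p then (s.heap.kids p).tail else s.heap.kids r)).map H.rootAt ++
        H.kids (H.rootAt r)
    rw [hi3, Heap.map_insertLeft inj]
    by_cases e : r = p
    · subst e
      rw [if_pos rfl, if_pos rfl, h.kids_root _ hr, hl, List.map_cons, List.cons_append,
        List.tail_cons, List.tail_cons, Heap.insertLeft_append,
        Heap.insertLeft_eq_self (l := H.kids _) (hnot _)]
    · rw [if_neg (inj.ne e), if_neg e, h.kids_root _ hr, Heap.insertLeft_append,
        Heap.insertLeft_eq_self (l := H.kids _) (hnot _)]
  · intro x hx'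
    change Heap.insertLeft (c.ptr i) (H.rootAt q) (if x = c.ptr i then
      (c.heap.kids (c.ptr i)).tail else c.heap.kids x) = H.kids x
    rw [if_neg, h.kids_other x hx', hi3, Heap.insertLeft_eq_self (hnot _)]
    rintro rfl
    exact hx' hx
  · exact h.forest.unpair hq' hpq

theorem swap (h : s.Describes H c) {i j : Fin ρ} (hi : c.ptr i ∈ c.heap.roots)
    (hj : c.ptr j ∈ c.heap.roots) :
    (s.step false (.swap i j)).Describes H
      { c with heap := c.heap.swap (c.ptr i) (c.ptr j) } := by
  obtain ⟨hi2, hi3⟩ := h.ptr_of_mem_roots (h.root_mem_start hi)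
  obtain ⟨hj2, hj3⟩ := h.ptr_of_mem_roots (h.root_mem_start hj)
  have inj := h.start_wf.rootAt_injective
  have wf' := h.wf.swap hi hj
  rw [hi3] at hi
  rw [hj3] at hj
  refine ⟨h.start_wf, wf', h.key_eq, h.live_eq, h.next_eq, ?_, h.kids_root, h.kids_other,
    h.forest.swap (h.mem_roots_iff.1 hi) (h.mem_roots_iff.1 hj),
    h.sym_next, h.ptr_lt, h.ptr_root, h.ptr_below, h.pairings⟩
  change c.heap.roots.map (Equiv.swap (c.ptr i) (c.ptr j)) =
    (s.heap.roots.map (Equiv.swap (s.ptr i).1 (s.ptr j).1)).map H.rootAt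
  rw [h.roots_eq, hi3, hj3, List.map_map, List.map_map]
  congr 1
  funext z
  simp only [Function.comp]
  exact inj.swap_apply _ _ _

theorem moveToParent (h : s.Describes H c) {i : Fin ρ} {y : ℕ}
    (hy : c.heap.parent? (c.ptr i) = some y) :
    ∃ flag, (s.step flag (.moveToParent i)).Describes H (c.point i y) := by
  have hp := h.ptr_lt i
  cases hb : (s.ptr i).2 with
  | false =>
    refine ⟨false, ?_⟩
    simp only [SymConf.step, hb, Bool.false_eq_true, if_false]
    have h1 := h.ptr_root i hb
    rw [h1, Heap.parent?_eq_some h.wf.forest h.wf.live_lt] at hy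
    rcases (h.forest.mem_live (s.ptr i).1).1 (Finset.mem_range.2 hp) with h2 | ⟨q, h2⟩
    · exact absurd hy (h.wf.forest.root_notMem _ (h.mem_roots_iff.2 h2) y)
    · have hq := (h.kids_lt h2).2
      have := h.wf.forest.parent_unique _ _ _ hy ((h.mem_kids_iff hq hp).2 h2)
      rw [this, (Heap.parent?_eq_some h.forest h.sym_lt).2 h2]
      exact h.point_root hq
  | true =>
    obtain ⟨z, -, h2, -, h3⟩ := h.exists_parent_of_below hp (h.ptr_below i hb)
    obtain rfl : z = y := Option.some.inj (h2.symm.trans hy)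
    rcases h3 with ⟨rfl, -⟩ | ⟨h3, -⟩
    · refine ⟨true, ?_⟩
      simp only [SymConf.step, hb, if_true]
      exact h.point_root hp
    · refine ⟨false, ?_⟩
      simp only [SymConf.step, hb, if_true]
      exact h.point_below hp h3

theorem moveToLeftmostChild (h : s.Describes H c) {i : Fin ρ} {y : ℕ}
    (hy : c.heap.leftmostChild? (c.ptr i) = some y) :
    (s.step false (.moveToLeftmostChild i)).Describes H (c.point i y) := by
  have hp := h.ptr_lt i
  cases hb : (s.ptr i).2 with
  | false =>
    simp only [SymConf.step, hb, Bool.false_eq_true, if_false]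
    rw [h.ptr_root i hb, Heap.leftmostChild?, h.kids_root _ hp] at hy
    cases hk : s.heap.kids (s.ptr i).1 with
    | nil =>
      rw [hk, List.map_nil, List.nil_append] at hy
      simp only [Heap.leftmostChild?, hk, List.head?_nil]
      exact h.point_below hp (.single (List.mem_of_head? hy))
    | cons q l =>
      rw [hk, List.map_cons, List.cons_append, List.head?_cons, Option.some.injEq] at hy
      simp only [Heap.leftmostChild?, hk, List.head?_cons, ← hy]
      exact h.point_root (h.kids_lt (p := (s.ptr i).1) (by simp [hk])).1
  | true =>
    simp only [SymConf.step, hb, if_true]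
    have h1 := h.ptr_below i hb
    have h2 : H.Below (H.rootAt (s.ptr i).1) y := by
      refine h1.tail ?_
      have := List.mem_of_head? hy
      rwa [h.kids_other _ fun hr => h.not_below_root hr h1] at this
    have h3 := h.point_below (i := i) hp h2
    rw [← hb, Prod.mk.eta, point_same] at h3
    exact h3

/-- No flag is needed. From a start root, the move runs through the start roots among its siblings
and after the last of them enters the old children of the parent; among old children it never leaves
them. -/
theorem moveToRightSibling (h : s.Describes H c) {i : Fin ρ} {y : ℕ}
    (hy : c.heap.rightSibling? (c.ptr i) = some y) :
    (s.step false (.moveToRightSibling i)).Describes H (c.point i y) := by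
  have hp := h.ptr_lt i
  cases hb : (s.ptr i).2 with
  | false =>
    simp only [SymConf.step, hb, Bool.false_eq_true, if_false]
    have h1 := h.ptr_root i hb
    set p := (s.ptr i).1
    obtain ⟨old, h2, h3⟩ := h.siblings_root hp
    obtain ⟨a, b, h4⟩ := Heap.exists_of_rightSibling? hy
    have hnd := h.nodup_siblings (H.rootAt p)
    rw [h1, h2] at h4
    rw [h2] at hnd
    obtain ⟨a', b', h5⟩ := List.append_of_mem
      (Heap.mem_siblings h.forest h.sym_lt (Finset.mem_range.2 hp))
    rw [h5, List.map_append, List.map_cons, List.append_assoc, List.cons_append] at h4 hnd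
    obtain ⟨-, h6⟩ := eq_of_append_cons_eq hnd h4
    have hnd' : (s.heap.siblings p).Nodup := Heap.nodup_siblings h.forest
    cases b' with
    | cons q b' =>
      simp only [List.map_cons, List.cons_append, List.cons.injEq] at h6
      rw [Heap.rightSibling?_eq_some hnd' h5, ← h6.1]
      refine h.point_root ?_
      have hq : q ∈ s.heap.siblings p := by simp [h5]
      rcases (h.forest.mem_live p).1 (Finset.mem_range.2 hp) with h7 | ⟨r, h7⟩
      · rw [Heap.siblings_of_mem_roots h.forest h.sym_lt h7] at hq
        exact Finset.mem_range.1 (h.forest.roots_live hq)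
      · rw [Heap.siblings_of_mem_kids h.forest h.sym_lt h7] at hq
        exact (h.kids_lt hq).1
    | nil =>
      have h7 : s.heap.rightSibling? p = none := by
        cases hr : s.heap.rightSibling? p with
        | none => rfl
        | some q =>
          obtain ⟨a2, b2, h8⟩ := Heap.exists_of_rightSibling? hr
          rw [h5] at h8 hnd'
          have := (eq_of_append_cons_eq hnd' h8).2
          simp at this
      rw [h7]
      simp only [List.map_nil, List.nil_append] at h6
      rcases h3 with rfl | ⟨q, h8, hq, h9⟩
      · simp at h6
      · rw [h8, Option.getD_some]
        refine h.point_below hq (.single ?_)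
        rw [← h9, h6]
        simp
  | true =>
    simp only [SymConf.step, hb, if_true]
    have h1 := h.ptr_below i hb
    obtain ⟨z, h2, -, h4, h5⟩ := h.exists_parent_of_below hp h1
    obtain ⟨a, b, h6⟩ := Heap.exists_of_rightSibling? hy
    have hnd := h.nodup_siblings (c.ptr i)
    have key : H.Below (H.rootAt (s.ptr i).1) y := by
      obtain ⟨a', b', h7⟩ := List.append_of_mem h2
      rcases h5 with ⟨rfl, h5⟩ | ⟨h8, h5⟩
      · refine .single ?_
        rw [h4, h5] at h6 hnd
        rw [h7, ← List.append_assoc] at h6 hnd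
        have := (eq_of_append_cons_eq hnd h6).2
        rw [h7, this]
        simp
      · refine h8.tail ?_
        rw [← h5, ← h4, h6]
        simp
    have h3 := h.point_below (i := i) hp key
    rw [← hb, Prod.mk.eta, point_same] at h3
    exact h3

/-- The flag marks the one case that the positions do not determine: from the leftmost old child of
a start root the move leads to the last start root linked below that parent. -/
theorem moveToLeftSibling (h : s.Describes H c) {i : Fin ρ} {y : ℕ}
    (hy : c.heap.leftSibling? (c.ptr i) = some y) :
    ∃ flag, (s.step flag (.moveToLeftSibling i)).Describes H (c.point i y) := by
  have hp := h.ptr_lt i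
  cases hb : (s.ptr i).2 with
  | false =>
    refine ⟨false, ?_⟩
    simp only [SymConf.step, hb, Bool.false_eq_true, if_false]
    have h1 := h.ptr_root i hb
    set p := (s.ptr i).1
    obtain ⟨old, h2, h3⟩ := h.siblings_root hp
    obtain ⟨a, b, h4⟩ := Heap.exists_of_leftSibling? hy
    have hnd := h.nodup_siblings (H.rootAt p)
    rw [h1, h2] at h4
    rw [h2] at hnd
    obtain ⟨a', b', h5⟩ := List.append_of_mem
      (Heap.mem_siblings h.forest h.sym_lt (Finset.mem_range.2 hp))
    rw [h5, List.map_append, List.map_cons, List.append_assoc, List.cons_append] at h4 hnd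
    rw [List.append_cons a] at h4
    obtain ⟨h6, -⟩ := eq_of_append_cons_eq hnd h4
    have hnd' : (s.heap.siblings p).Nodup := Heap.nodup_siblings h.forest
    obtain ⟨a2, q, rfl, rfl⟩ : ∃ a2 q, a' = a2 ++ [q] ∧ H.rootAt q = y := by
      obtain ⟨a2, b2, e1, e2, e3⟩ := List.map_eq_append_iff.1 h6
      obtain ⟨q, l, e4, e5, e6⟩ := List.map_eq_cons_iff.1 e3
      rw [List.map_eq_nil_iff] at e6
      subst e6 e4
      exact ⟨a2, q, e1, e5⟩
    rw [List.append_assoc, List.singleton_append] at h5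
    rw [Heap.leftSibling?_eq_some hnd' h5]
    refine h.point_root ?_
    have hq : q ∈ s.heap.siblings p := by simp [h5]
    rcases (h.forest.mem_live p).1 (Finset.mem_range.2 hp) with h7 | ⟨r, h7⟩
    · rw [Heap.siblings_of_mem_roots h.forest h.sym_lt h7] at hq
      exact Finset.mem_range.1 (h.forest.roots_live hq)
    · rw [Heap.siblings_of_mem_kids h.forest h.sym_lt h7] at hq
      exact (h.kids_lt hq).1
  | true =>
    have h1 := h.ptr_below i hb
    obtain ⟨z, h2, -, h4, h5⟩ := h.exists_parent_of_below hp h1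
    obtain ⟨a, b, h6⟩ := Heap.exists_of_leftSibling? hy
    have hnd := h.nodup_siblings (c.ptr i)
    have stay : H.Below (H.rootAt (s.ptr i).1) y →
        ∃ flag, (s.step flag (.moveToLeftSibling i)).Describes H (c.point i y) := by
      intro key
      refine ⟨false, ?_⟩
      simp only [SymConf.step, hb, if_true, Bool.false_eq_true, if_false]
      have h3 := h.point_below (i := i) hp key
      rw [← hb, Prod.mk.eta, point_same] at h3
      exact h3
    rcases h5 with ⟨rfl, h5⟩ | ⟨h8, h5⟩
    · obtain ⟨a', b', h7⟩ := List.append_of_mem h2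
      rw [h4, h5] at h6 hnd
      rw [h7, ← List.append_assoc] at h6 hnd
      rw [List.append_cons a] at h6
      have h8 := (eq_of_append_cons_eq hnd h6).1
      rcases List.eq_nil_or_concat a' with rfl | ⟨a2, y', rfl⟩
      · refine ⟨true, ?_⟩
        simp only [SymConf.step, hb, if_true]
        rw [List.append_nil] at h8
        obtain ⟨a2, b2, e1, e2, e3⟩ := List.map_eq_append_iff.1 h8
        obtain ⟨q, l, e4, e5, e6⟩ := List.map_eq_cons_iff.1 e3
        rw [List.map_eq_nil_iff] at e6
        subst e6 e4 e5
        rw [e1]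
        simp only [List.getLast?_append, List.getLast?_singleton, Option.some_or,
          Option.getD_some]
        exact h.point_root (h.kids_lt (p := (s.ptr i).1) (by simp [e1])).1
      · refine stay (.single ?_)
        rw [List.concat_eq_append, ← List.append_assoc] at h8
        have := List.append_inj_right' h8 rfl
        simp only [List.cons.injEq, and_true] at this
        rw [h7, ← this]
        simp
    · refine stay (h8.tail ?_)
      rw [← h5, ← h4, h6]
      simp

/-- Keys and test results have no effect on the places of pointers and trees; only the moves to the
parent and to the left sibling need their flag. Among all suboperations only `pair` removes a root,
and it removes one. -/
theorem exists_step (h : s.Describes H c) {op : SubOp ρ} {c' : Config ρ K}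
    (hc : c.step op = some c') :
    ∃ flag, (s.step flag op).Describes H c' ∧
      c.heap.roots.length ≤ c'.heap.roots.length + 1 := by
  cases op with
  | hasParent i =>
    simp only [Config.step, Option.some.injEq] at hc
    exact ⟨false, hc ▸ h.congr_heap rfl rfl rfl, by rw [← hc]; exact Nat.le_succ _⟩
  | hasLeftSibling i =>
    simp only [Config.step, Option.some.injEq] at hc
    exact ⟨false, hc ▸ h.congr_heap rfl rfl rfl, by rw [← hc]; exact Nat.le_succ _⟩
  | hasRightSibling i =>
    simp only [Config.step, Option.some.injEq] at hc
    exact ⟨false, hc ▸ h.congr_heap rfl rfl rfl, by rw [← hc]; exact Nat.le_succ _⟩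
  | hasChildren i =>
    simp only [Config.step, Option.some.injEq] at hc
    exact ⟨false, hc ▸ h.congr_heap rfl rfl rfl, by rw [← hc]; exact Nat.le_succ _⟩
  | compare i j =>
    simp only [Config.step, Option.some.injEq] at hc
    exact ⟨false, hc ▸ h.congr_heap rfl rfl rfl, by rw [← hc]; exact Nat.le_succ _⟩
  | pair i j =>
    simp only [Config.step] at hc
    split_ifs at hc with hp
    obtain rfl := Option.some.inj hc
    refine ⟨false, h.pair hp, ?_⟩
    change c.heap.roots.length ≤ (c.heap.roots.erase (c.ptr j)).length + 1
    rw [List.length_erase_of_mem hp.2.1]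
    omega
  | unpair i =>
    simp only [Config.step, Option.bind_eq_some_iff] at hc
    obtain ⟨y, hy, hc⟩ := hc
    split_ifs at hc with hp
    obtain rfl := Option.some.inj hc
    exact ⟨false, h.unpair hy hp, Heap.length_le_length_insertLeft.trans (Nat.le_succ _)⟩
  | set i j =>
    simp only [Config.step, Option.some.injEq] at hc
    subst hc
    refine ⟨false, ?_, Nat.le_succ _⟩
    change (s.point i (s.ptr j)).Describes H _
    cases hb : (s.ptr j).2 with
    | false =>
      rw [← Prod.mk.eta (p := s.ptr j), hb, h.ptr_root j hb]
      exact h.point_root (h.ptr_lt j)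
    | true =>
      rw [← Prod.mk.eta (p := s.ptr j), hb]
      exact h.point_below (h.ptr_lt j) (h.ptr_below j hb)
  | swap i j =>
    simp only [Config.step] at hc
    split_ifs at hc with hp
    obtain rfl := Option.some.inj hc
    refine ⟨false, h.swap hp.1 hp.2, ?_⟩
    change c.heap.roots.length ≤ (c.heap.roots.map _).length + 1
    rw [List.length_map]
    exact Nat.le_succ _
  | moveToParent i =>
    simp only [Config.step] at hc
    split_ifs at hc with hp
    obtain ⟨y, hy, rfl⟩ := Option.map_eq_some_iff.1 hc
    obtain ⟨flag, h1⟩ := h.moveToParent hy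
    exact ⟨flag, h1, Nat.le_succ _⟩
  | moveToLeftmostChild i =>
    simp only [Config.step] at hc
    split_ifs at hc with hp
    obtain ⟨y, hy, rfl⟩ := Option.map_eq_some_iff.1 hc
    exact ⟨false, h.moveToLeftmostChild hy, Nat.le_succ _⟩
  | moveToRightSibling i =>
    simp only [Config.step] at hc
    split_ifs at hc with hp
    obtain ⟨y, hy, rfl⟩ := Option.map_eq_some_iff.1 hc
    exact ⟨false, h.moveToRightSibling hy, Nat.le_succ _⟩
  | moveToLeftSibling i =>
    simp only [Config.step] at hc
    split_ifs at hc with hp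
    obtain ⟨y, hy, rfl⟩ := Option.map_eq_some_iff.1 hc
    obtain ⟨flag, h1⟩ := h.moveToLeftSibling hy
    exact ⟨flag, h1, Nat.le_succ _⟩
  | finish => simp [Config.step] at hc

/-- The number of roots falls by at most one per suboperation and is one at `finish`, which itself
counts. Hence an Extract-Min costs at least the number of roots, and this pays for everything
proportional to that number. -/
theorem exists_exec {l : List (SubOp ρ)} {H' : Heap K} :
    ∀ {s : SymConf ρ} {c : Config ρ K}, s.Describes H c → c.exec l = some H' →
    ∃ (w : List (SubOp ρ × Bool)) (c' : Config ρ K) (p : ℕ), w.map Prod.fst = l ∧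
      (s.exec w).Describes H c' ∧ (s.exec w).heap.roots = [p] ∧
      H' = c'.heap.removeRoot (H.rootAt p) ∧ c.heap.roots.length ≤ l.length := by
  classical
  induction l with
  | nil => intro s c _ hc; simp [Config.exec] at hc
  | cons op l ih =>
    intro s c h hc
    by_cases hop : op = .finish
    · subst hop
      simp only [Config.exec] at hc
      split_ifs at hc with hl
      subst hl
      obtain ⟨m, hm, hc⟩ := Option.bind_eq_some_iff.1 hc
      split_ifs at hc with hf
      obtain ⟨p, hp⟩ : ∃ p, s.heap.roots = [p] := by
        have h1 := h.roots_eq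
        rw [hf.1] at h1
        have := congrArg List.length h1
        rw [List.length_map, List.length_singleton] at this
        exact List.length_eq_one_iff.1 this.symm
      have hmp : m = H.rootAt p := by
        have h1 := h.roots_eq
        rw [hf.1, hp] at h1
        simpa using h1
      refine ⟨[(.finish, false)], c, p, rfl, h, hp, ?_, ?_⟩
      · rw [← hmp]; exact (Option.some.inj hc).symm
      · rw [hf.1]; simp
    · have hc' : (c.step op).bind (fun c' => c'.exec l) = some H' := by
        cases op <;> first | exact absurd rfl hop | simpa only [Config.exec] using hc
      obtain ⟨c1, h1, h2⟩ := Option.bind_eq_some_iff.1 hc'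
      obtain ⟨flag, h3, h4⟩ := h.exists_step h1
      obtain ⟨w, c2, p, h5, h6, h7, h8, h9⟩ := ih h3 h2
      refine ⟨(op, flag) :: w, c2, p, by simp [h5], h6, h7, h8, ?_⟩
      rw [List.length_cons]
      omega

end SymConf.Describes

end PureHeap


/-! ### Effects of the operations -/

namespace PureHeap

namespace Heap

variable {K : Type*}

/-- The heap after `Decrease-Key`s of the nodes `L` to the keys `nk`. -/
def decreaseKeys (H : Heap K) (L : List ℕ) (nk : ℕ → K) : Heap K where
  roots := L.reverse ++ H.roots.filter (· ∉ L)
  kids := fun z => (H.kids z).filter (· ∉ L)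
  key := fun z => if z ∈ L then nk z else H.key z
  live := H.live
  next := H.next

theorem decreaseKeys_nil (H : Heap K) (nk : ℕ → K) : H.decreaseKeys [] nk = H := by
  cases H; simp [decreaseKeys]

theorem decreaseKeys_append [AddCommGroup K] {H : Heap K} (hr : H.roots.Nodup)
    (hk : ∀ z, (H.kids z).Nodup) {L : List ℕ} {x : ℕ} (hx : x ∉ L) (nk : ℕ → K) :
    (H.decreaseKeys L nk).decreaseKey x (H.key x - nk x) = H.decreaseKeys (L ++ [x]) nk := by
  have hfil : ∀ l : List ℕ, l.Nodup →
      (l.filter (· ∉ L)).erase x = l.filter (· ∉ L ++ [x]) := by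
    intro l hl
    rw [(hl.filter _).erase_eq_filter, List.filter_filter]
    congr 1
    funext y
    simp only [List.mem_append, List.mem_singleton, not_or, Bool.decide_and]
    rw [Bool.and_comm]
    congr 1
    simp [bne, beq_eq_decide]
  unfold decreaseKey decreaseKeys
  simp only [Heap.mk.injEq, and_true]
  refine ⟨?_, ?_, ?_⟩
  · rw [List.erase_append_right _ (by simpa using hx), hfil _ hr]
    simp
  · funext z
    exact hfil _ (hk z)
  · funext z
    by_cases hz : z = x
    · subst hz
      simp [hx]
    · simp [hz]

variable [LinearOrder K]

/-- `H'` is the result of an `Extract-Min` on `H` that removes the root `m`, after the roots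
`nw x` have been linked below each root `x`. -/
structure Linked (H H' : Heap K) (m : ℕ) (nw : ℕ → List ℕ) : Prop where
  min_mem : m ∈ H.roots
  parent_mem : ∀ x z, z ∈ nw x → x ∈ H.roots
  child_mem : ∀ x z, z ∈ nw x → z ∈ H.roots
  child_ne : ∀ x z, z ∈ nw x → z ≠ m
  lt : ∀ x z, z ∈ nw x → H.key x < H.key z
  nodup : ∀ x, (nw x).Nodup
  unique : ∀ x y z, z ∈ nw x → z ∈ nw y → x = y
  cover : ∀ z ∈ H.roots, z ≠ m → ∃ x, z ∈ nw x
  roots_eq : H'.roots = nw m ++ H.kids m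
  kids_eq : ∀ z, H'.kids z = if z = m then [] else nw z ++ H.kids z
  key_eq : H'.key = H.key
  live_eq : H'.live = H.live.erase m
  next_eq : H'.next = H.next

/-- The roots linked below `x` by the suboperations `w`. -/
def linksOf {ρ : ℕ} (H : Heap K) (w : List (SubOp ρ × Bool)) (x : ℕ) : List ℕ :=
  if x ∈ H.roots then
    (((SymConf.start ρ H.roots.length).exec w).heap.kids (H.roots.idxOf x)).map H.rootAt
  else []

theorem WF.idxOf_rootAt {H : Heap K} (h : H.WF) {p : ℕ} (hp : p < H.roots.length) :
    H.roots.idxOf (H.rootAt p) = p := by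
  rw [rootAt, dif_pos hp]
  exact h.forest.nodup_roots.idxOf_getElem p hp

theorem linksOf_rootAt {ρ : ℕ} {H : Heap K} (h : H.WF) (w : List (SubOp ρ × Bool)) {p : ℕ}
    (hp : p < H.roots.length) : H.linksOf w (H.rootAt p) =
      (((SymConf.start ρ H.roots.length).exec w).heap.kids p).map H.rootAt := by
  rw [linksOf, if_pos (rootAt_mem hp), h.idxOf_rootAt hp]

/-- All that the adversary and the decoder need to know about an Extract-Min. `Linked` is what the
adversary reacts to; the statements about positions let the decoder compute the same links from `w`
and the number of roots alone. -/
theorem exists_linked {ρ : ℕ} {H H' : Heap K} (h : H.WF) {l : List (SubOp ρ)}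
    (he : H.extractMin l = some H') :
    ∃ (w : List (SubOp ρ × Bool)) (p : ℕ), w.map Prod.fst = l ∧ p < H.roots.length ∧
      ((SymConf.start ρ H.roots.length).exec w).heap.roots = [p] ∧
      (∀ q p', p' ∈ ((SymConf.start ρ H.roots.length).exec w).heap.kids q →
        p' < H.roots.length ∧ q < H.roots.length) ∧
      H.Linked H' (H.rootAt p) (H.linksOf w) ∧ H.roots.length ≤ l.length := by
  obtain ⟨x, hx, he⟩ := Option.bind_eq_some_iff.1 he
  obtain ⟨w, c, p, h1, h2, h3, rfl, h5⟩ := (SymConf.Describes.start h hx).exists_exec he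
  set s := (SymConf.start ρ H.roots.length).exec w
  have inj := h.rootAt_injective
  have hp : p < H.roots.length :=
    Finset.mem_range.1 (h2.forest.roots_live (by rw [h3]; simp))
  have hmem : ∀ x z, z ∈ H.linksOf w x → ∃ q r, q < H.roots.length ∧ x = H.rootAt q ∧
      r ∈ s.heap.kids q ∧ z = H.rootAt r ∧ r < H.roots.length := by
    intro x z hz
    have hxr : x ∈ H.roots := by
      by_contra hxr
      simp [linksOf, hxr] at hz
    obtain ⟨q, hq, rfl⟩ := exists_rootAt_eq hxr
    rw [linksOf_rootAt h w hq, List.mem_map] at hz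
    obtain ⟨r, hr, rfl⟩ := hz
    exact ⟨q, r, hq, rfl, hr, rfl, (h2.kids_lt hr).1⟩
  have hkids : ∀ x, c.heap.kids x = H.linksOf w x ++ H.kids x := by
    intro x
    by_cases hxr : x ∈ H.roots
    · obtain ⟨q, hq, rfl⟩ := exists_rootAt_eq hxr
      rw [linksOf_rootAt h w hq, h2.kids_root q hq]
    · rw [h2.kids_other x hxr]
      simp [linksOf, hxr]
  refine ⟨w, p, h1, hp, h3, fun q p' hq => h2.kids_lt hq,
    ⟨rootAt_mem hp, ?_, ?_, ?_, ?_, ?_, ?_, ?_, hkids _, ?_, h2.key_eq, ?_, h2.next_eq⟩, h5⟩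
  · intro x z hz
    obtain ⟨q, r, hq, rfl, -⟩ := hmem x z hz
    exact rootAt_mem hq
  · intro x z hz
    obtain ⟨q, r, hq, rfl, hr, rfl, hr'⟩ := hmem x z hz
    exact rootAt_mem hr'
  · intro x z hz e
    obtain ⟨q, r, hq, rfl, hr, rfl, hr'⟩ := hmem x z hz
    rw [inj e] at hr
    exact h2.forest.root_notMem p (by rw [h3]; simp) q hr
  · intro x z hz
    rw [← h2.key_eq]
    refine h2.wf.order x z ?_
    rw [hkids]
    exact List.mem_append_left _ hz
  · intro x
    unfold linksOf
    split_ifs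
    · exact (h2.forest.nodup_kids _).map inj
    · exact List.nodup_nil
  · intro x y z hx hy
    refine h2.wf.forest.parent_unique z x y ?_ ?_ <;> rw [hkids]
    · exact List.mem_append_left _ hx
    · exact List.mem_append_left _ hy
  · intro z hz hne
    obtain ⟨r, hr, rfl⟩ := exists_rootAt_eq hz
    rcases (h2.forest.mem_live r).1 (Finset.mem_range.2 hr) with h6 | ⟨q, h6⟩
    · rw [h3, List.mem_singleton] at h6
      exact absurd (by rw [h6]) hne
    · refine ⟨H.rootAt q, ?_⟩
      rw [linksOf_rootAt h w (h2.kids_lt h6).2]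
      exact List.mem_map_of_mem h6
  · intro z
    change Function.update c.heap.kids (H.rootAt p) [] z = _
    split_ifs with hz
    · rw [hz, Function.update_self]
    · rw [Function.update_of_ne hz, hkids]
  · change c.heap.live.erase (H.rootAt p) = _
    rw [h2.live_eq]

theorem WF.decreaseKeys {H : Heap K} (h : H.WF) {L : List ℕ} {nk : ℕ → K} (hL : L.Nodup)
    (hlive : ∀ x ∈ L, x ∈ H.live) (hnk : ∀ x ∈ L, nk x ≤ H.key x) : (H.decreaseKeys L nk).WF := by
  have hm : ∀ z, z ∈ L.reverse ++ H.roots.filter (· ∉ L) ↔ z ∈ L ∨ z ∈ H.roots := by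
    intro z
    simp only [List.mem_append, List.mem_reverse, List.mem_filter, decide_eq_true_eq]
    tauto
  have hk : ∀ z p, z ∈ (H.kids p).filter (· ∉ L) ↔ z ∈ H.kids p ∧ z ∉ L := by
    intro z p
    simp only [List.mem_filter, decide_eq_true_eq]
  refine ⟨⟨?_, fun x => (h.forest.nodup_kids x).filter _, ?_, ?_, ?_, ?_⟩, h.live_lt, ?_⟩
  · change (L.reverse ++ H.roots.filter (· ∉ L)).Nodup
    rw [List.nodup_append]
    refine ⟨List.nodup_reverse.2 hL, h.forest.nodup_roots.filter _, ?_⟩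
    intro a ha b hb e
    subst e
    simp only [List.mem_filter, decide_eq_true_eq] at hb
    exact hb.2 (List.mem_reverse.1 ha)
  · intro x hx p hp
    rcases (hm x).1 hx with h1 | h1
    · exact ((hk x p).1 hp).2 h1
    · exact h.forest.root_notMem x h1 p ((hk x p).1 hp).1
  · intro x p q hp hq
    exact h.forest.parent_unique x p q ((hk x p).1 hp).1 ((hk x q).1 hq).1
  · intro x
    change x ∈ H.live ↔ x ∈ L.reverse ++ H.roots.filter (· ∉ L) ∨
      ∃ p, x ∈ (H.kids p).filter (· ∉ L)
    rw [hm]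
    simp only [hk]
    by_cases hx : x ∈ L
    · simp [hx, hlive x hx]
    · simp [hx, h.forest.mem_live]
  · intro x p hp
    exact h.forest.parent_live x p ((hk x p).1 hp).1
  · intro x z hz
    obtain ⟨h1, h2⟩ := (hk z x).1 hz
    change (if x ∈ L then nk x else H.key x) < (if z ∈ L then nk z else H.key z)
    rw [if_neg h2]
    split_ifs with hx
    · exact (hnk x hx).trans_lt (h.order x z h1)
    · exact h.order x z h1

theorem WF.kids_next {H : Heap K} (h : H.WF) : H.kids H.next = [] := by
  rw [List.eq_nil_iff_forall_not_mem]
  intro z hz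
  exact absurd (h.live_lt _ (h.forest.parent_live z _ hz)) (lt_irrefl _)

theorem WF.insertKey {H : Heap K} (h : H.WF) (k : K) : (H.insertKey k).WF := by
  have hk : ∀ z, (H.insertKey k).kids z = H.kids z := by
    intro z
    change Function.update H.kids H.next [] z = _
    by_cases hz : z = H.next
    · rw [hz, Function.update_self, h.kids_next]
    · rw [Function.update_of_ne hz]
  have hnr : H.next ∉ H.live := fun hn => lt_irrefl _ (h.live_lt _ hn)
  have hnk : ∀ p, H.next ∉ H.kids p := fun p hp => hnr (h.forest.kids_live hp)
  have hkey : ∀ z ∈ H.live, (H.insertKey k).key z = H.key z := by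
    intro z hz
    exact Function.update_of_ne (by rintro rfl; exact hnr hz) _ _
  refine ⟨⟨?_, ?_, ?_, ?_, ?_, ?_⟩, ?_, ?_⟩
  · change (H.next :: H.roots).Nodup
    exact List.nodup_cons.2 ⟨fun hn => hnr (h.forest.roots_live hn), h.forest.nodup_roots⟩
  · intro x
    rw [hk]
    exact h.forest.nodup_kids x
  · intro x hx p
    rw [hk]
    rcases List.mem_cons.1 hx with rfl | hx
    · exact hnk p
    · exact h.forest.root_notMem x hx p
  · intro x p q
    rw [hk, hk]
    exact h.forest.parent_unique x p q
  · intro x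
    change x ∈ insert H.next H.live ↔ x ∈ H.next :: H.roots ∨ ∃ p, _
    simp only [hk, Finset.mem_insert, List.mem_cons, h.forest.mem_live, or_assoc]
  · intro x p
    rw [hk]
    exact fun hx => Finset.mem_insert_of_mem (h.forest.parent_live x p hx)
  · intro x hx
    change x < H.next + 1
    rcases Finset.mem_insert.1 hx with rfl | hx
    · exact Nat.lt_succ_self _
    · exact (h.live_lt x hx).trans (Nat.lt_succ_self _)
  · intro x z
    rw [hk]
    intro hz
    rw [hkey _ (h.forest.parent_live z x hz), hkey _ (h.forest.kids_live hz)]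
    exact h.order x z hz

end Heap

/-- The heap never holds more than `n` items in the course of the history. -/
def Algorithm.SizeLE {ρ : ℕ} {K : Type*} [AddCommGroup K] [LinearOrder K] (A : Algorithm ρ K)
    (n : ℕ) (h : List (Op K)) : Prop :=
  ∀ h' H, h' <:+ h → A.run h' = some H → H.size ≤ n

/-! ### Executing the requests of the adversary, and the choice of keys -/

section Run

variable {ρ : ℕ} {K : Type*} [AddCommGroup K] [LinearOrder K] {A : Algorithm ρ K}

theorem Algorithm.SizeLE.cons {n : ℕ} {op : Op K} {h : List (Op K)} {H : Heap K}
    (hs : A.SizeLE n h) (hr : A.run (op :: h) = some H) (hH : H.size ≤ n) :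
    A.SizeLE n (op :: h) := by
  intro h' H' hsuf hr'
  rcases List.suffix_cons_iff.1 hsuf with rfl | hsuf
  · rw [hr] at hr'
    exact Option.some.inj hr' ▸ hH
  · exact hs h' H' hsuf hr'

theorem run_insert {h : List (Op K)} {H : Heap K} (hr : A.run h = some H) {k : K}
    (hk : ∀ y ∈ H.live, H.key y ≠ k) : A.run (.insert k :: h) = some (H.insertKey k) := by
  simp only [Algorithm.run, hr, Option.bind_some]
  rw [if_pos]
  exact hk

theorem run_extractMin {h : List (Op K)} {H : Heap K} (hr : A.run h = some H)
    (hne : H.live.Nonempty) : A.run (.extractMin :: h) = H.extractMin (A h) := by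
  simp only [Algorithm.run, hr, Option.bind_some]
  rw [if_pos]
  exact hne

variable [IsOrderedAddMonoid K]

/-- The requests that decrease the keys of the nodes `L` to `nk`. -/
def decreaseKeyOps (H : Heap K) (L : List ℕ) (nk : ℕ → K) : List (Op K) :=
  L.reverse.map fun x => .decreaseKey x (H.key x - nk x)

theorem run_decreaseKeys {h : List (Op K)} {H : Heap K} (hH : H.WF) (hr : A.run h = some H)
    {n : ℕ} (hs : A.SizeLE n h) (hn : H.size ≤ n)
    (nk : ℕ → K) (L : List ℕ) (hL : L.Nodup) (hlive : ∀ x ∈ L, x ∈ H.live)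
    (hnk : ∀ x ∈ L, nk x ≤ H.key x)
    (hne : ∀ x ∈ L, ∀ y ∈ H.live, y ≠ x → H.key y ≠ nk x ∧ nk y ≠ nk x) :
    A.run (decreaseKeyOps H L nk ++ h) = some (H.decreaseKeys L nk) ∧
      A.SizeLE n (decreaseKeyOps H L nk ++ h) ∧
      A.cost (decreaseKeyOps H L nk ++ h) = A.cost h + L.length ∧
      ∀ a b d : ℝ, charge a b d (decreaseKeyOps H L nk ++ h) =
        charge a b d h + L.length * d := by
  induction L using List.reverseRecOn with
  | nil =>
    refine ⟨by simpa [decreaseKeyOps, H.decreaseKeys_nil] using hr,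
      by simpa [decreaseKeyOps] using hs, by simp [decreaseKeyOps], by simp [decreaseKeyOps]⟩
  | append_singleton L x ih =>
    have hxL : x ∉ L := by
      intro hx
      rw [List.nodup_append] at hL
      exact hL.2.2 x hx x (by simp) rfl
    have hx : x ∈ L ++ [x] := by simp
    have hsub : ∀ {y}, y ∈ L → y ∈ L ++ [x] := fun hy => List.mem_append_left _ hy
    obtain ⟨h1, h2, h3, h4⟩ := ih (List.nodup_append.1 hL).1 (fun y hy => hlive y (hsub hy))
      (fun y hy => hnk y (hsub hy)) (fun y hy => hne y (hsub hy))
    have e : decreaseKeyOps H (L ++ [x]) nk ++ h =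
        .decreaseKey x (H.key x - nk x) :: (decreaseKeyOps H L nk ++ h) := by
      simp [decreaseKeyOps]
    rw [e]
    have hkx : (H.decreaseKeys L nk).key x = H.key x := by simp [Heap.decreaseKeys, hxL]
    have hrun : A.run (.decreaseKey x (H.key x - nk x) :: (decreaseKeyOps H L nk ++ h)) =
        some (H.decreaseKeys (L ++ [x]) nk) := by
      simp only [Algorithm.run, h1, Option.bind_some]
      rw [if_pos, Heap.decreaseKeys_append hH.forest.nodup_roots hH.forest.nodup_kids hxL]
      refine ⟨hlive x hx, sub_nonneg.2 (hnk x hx), ?_⟩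
      intro y hy hyx
      rw [hkx, sub_sub_cancel]
      change (if y ∈ L then nk y else H.key y) ≠ nk x
      split_ifs
      · exact (hne x hx y hy hyx).2
      · exact (hne x hx y hy hyx).1
    refine ⟨hrun, h2.cons hrun hn, ?_, ?_⟩
    · simp only [Algorithm.cost, h3, List.length_append, List.length_singleton]
      omega
    · intro a b d
      simp only [charge, h4, List.length_append, List.length_singleton]
      push_cast
      ring

end Run

/-- Among nodes with names less than `M`, keys by label, and then by name. -/
def nodeKey {K : Type*} [AddCommGroup K] (M : ℕ) (u : K) (a x : ℕ) : K := -((a * M + x) • u)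

section NodeKey

variable {K : Type*} [AddCommGroup K] [LinearOrder K] [IsOrderedAddMonoid K] {M : ℕ} {u : K}

theorem nodeKey_lt_iff (hu : 0 < u) {a b x y : ℕ} :
    nodeKey M u a x < nodeKey M u b y ↔ b * M + y < a * M + x := by
  unfold nodeKey
  rw [neg_lt_neg_iff]
  exact nsmul_lt_nsmul_iff_left hu

theorem nodeKey_le_of_le (hu : 0 < u) {a b x : ℕ} (h : a ≤ b) :
    nodeKey M u b x ≤ nodeKey M u a x := by
  unfold nodeKey
  rw [neg_le_neg_iff]
  exact nsmul_le_nsmul_left hu.le (by gcongr)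

/-- In base `M` the label is the leading digit and the name only breaks ties; the sign turns high
labels into small keys. -/
theorem label_le_of_nodeKey_lt (hu : 0 < u) {a b x y : ℕ} (hx : x < M)
    (h : nodeKey M u a x < nodeKey M u b y) : b ≤ a := by
  rw [nodeKey_lt_iff hu] at h
  by_contra! hab
  have : (a + 1) * M ≤ b * M := Nat.mul_le_mul_right M hab
  rw [add_mul, one_mul] at this
  omega

theorem nodeKey_ne (hu : 0 < u) {a b x y : ℕ} (hx : x < M) (hy : y < M) (hxy : x ≠ y) :
    nodeKey M u a x ≠ nodeKey M u b y := by
  intro e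
  have h1 : ¬ nodeKey M u a x < nodeKey M u b y := by rw [e]; exact lt_irrefl _
  have h2 : ¬ nodeKey M u b y < nodeKey M u a x := by rw [e]; exact lt_irrefl _
  rw [nodeKey_lt_iff hu] at h1 h2
  have h3 : a * M + x = b * M + y := by omega
  apply hxy
  have h4 := congrArg (· % M) h3
  simpa [Nat.add_mod, Nat.mod_eq_of_lt hx, Nat.mod_eq_of_lt hy] using h4

end NodeKey

/-- The requests that insert the nodes with names less than `n`. -/
def insertOps {K : Type*} [AddCommGroup K] (M : ℕ) (u : K) (n : ℕ) : List (Op K) :=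
  (List.range n).reverse.map fun x => .insert (nodeKey M u 0 x)

theorem run_inserts {ρ : ℕ} {K : Type*} [AddCommGroup K] [LinearOrder K] [IsOrderedAddMonoid K]
    {A : Algorithm ρ K} {M : ℕ} {u : K} (hu : 0 < u) (N n : ℕ) (hn : n ≤ N) (hM : n ≤ M) :
    ∃ H, A.run (insertOps M u n) = some H ∧ H.WF ∧ H.roots = (List.range n).reverse ∧
      (∀ x, H.kids x = []) ∧ (∀ x ∈ H.live, H.key x = nodeKey M u 0 x) ∧
      H.live = Finset.range n ∧ H.next = n ∧
      A.SizeLE N (insertOps M u n) ∧ A.cost (insertOps M u n) = n ∧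
      ∀ a b d : ℝ, charge a b d (insertOps M u n) = n * a := by
  induction n with
  | zero =>
    refine ⟨Heap.empty, by simp [insertOps, Algorithm.run], ⟨⟨?_, ?_, ?_, ?_, ?_, ?_⟩, ?_, ?_⟩,
      by simp [Heap.empty], by simp [Heap.empty], by simp [Heap.empty], by simp [Heap.empty],
      by simp [Heap.empty], ?_, by simp [insertOps, Algorithm.cost], by simp [insertOps, charge]⟩
      <;> try simp [Heap.empty]
    intro h' H hsuf hr
    have : h' = [] := by simpa [insertOps] using hsuf
    subst this
    simp only [Algorithm.run, Option.some.injEq] at hr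
    subst hr
    simp [Heap.size, Heap.empty]
  | succ n ih =>
    obtain ⟨H, h1, h2, h3, h4, h5, h6, h7, h8, h9, h10⟩ := ih (by omega) (by omega)
    have e : insertOps M u (n + 1) = .insert (nodeKey M u 0 n) :: insertOps M u n := by
      simp [insertOps, List.range_succ]
    have hr : A.run (insertOps M u (n + 1)) = some (H.insertKey (nodeKey M u 0 n)) := by
      rw [e]
      refine run_insert h1 ?_
      intro y hy
      rw [h5 y hy]
      have hyn : y < n := by rw [h6] at hy; exact Finset.mem_range.1 hy
      exact nodeKey_ne hu (by omega) (by omega) (by omega)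
    have hlive : (H.insertKey (nodeKey M u 0 n)).live = Finset.range (n + 1) := by
      change insert H.next H.live = _
      rw [h6, h7, Finset.range_add_one]
    refine ⟨_, hr, h2.insertKey _, ?_, ?_, ?_, hlive, ?_, ?_, ?_, ?_⟩
    · change H.next :: H.roots = _
      rw [h3, h7, List.range_succ]
      simp
    · intro x
      change Function.update H.kids H.next [] x = []
      by_cases hx : x = H.next
      · rw [hx, Function.update_self]
      · rw [Function.update_of_ne hx, h4]
    · intro x hx
      change Function.update H.key H.next _ x = _
      by_cases hxn : x = H.next
      · rw [hxn, Function.update_self, h7]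
      · rw [Function.update_of_ne hxn]
        refine h5 x ?_
        exact (Finset.mem_insert.1 hx).resolve_left hxn
    · change H.next + 1 = n + 1
      rw [h7]
    · rw [e] at hr ⊢
      refine h8.cons hr ?_
      rw [Heap.size, hlive, Finset.card_range]
      exact hn
    · rw [e, Algorithm.cost, h9]
    · intro a b d
      rw [e, charge, h10]
      push_cast
      ring

end PureHeap


/-! ### Sizes and labels -/

namespace PureHeap

namespace Heap.Linked

variable {K : Type*} [LinearOrder K] {H H' : Heap K} {m : ℕ} {nw : ℕ → List ℕ}

/-- Keys increase along new links, so the number of roots with a larger key decreases from parent to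
child. -/
theorem induction (h : H.Linked H' m nw) {P : ℕ → Prop} (hP : ∀ x, (∀ z ∈ nw x, P z) → P x)
    (x : ℕ) : P x := by
  classical
  suffices ∀ k x, (H.roots.toFinset.filter fun y => H.key x < H.key y).card ≤ k → P x from
    this _ x le_rfl
  intro k
  induction k with
  | zero =>
    intro x hx
    refine hP x fun z hz => ?_
    have : z ∈ H.roots.toFinset.filter fun y => H.key x < H.key y := by
      simp [h.child_mem x z hz, h.lt x z hz]
    rw [Nat.le_zero, Finset.card_eq_zero] at hx
    rw [hx] at this
    simp at this
  | succ k ih =>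
    intro x hx
    refine hP x fun z hz => ih z ?_
    have hlt : (H.roots.toFinset.filter fun y => H.key z < H.key y) ⊂
        H.roots.toFinset.filter fun y => H.key x < H.key y := by
      rw [Finset.ssubset_iff_of_subset]
      · exact ⟨z, by simp [h.child_mem x z hz, h.lt x z hz], by simp⟩
      · intro y
        simp only [Finset.mem_filter]
        exact fun hy => ⟨hy.1, (h.lt x z hz).trans hy.2⟩
    have := Finset.card_lt_card hlt
    omega

theorem exists_rec (h : H.Linked H' m nw) (a : ℕ → ℕ) (φ : ℕ → ℕ → ℕ) :
    ∃ g : ℕ → ℕ, ∀ x, g x = a x + ((nw x).map fun z => φ z (g z)).sum := by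
  have wf : WellFounded fun z x => z ∈ nw x :=
    ⟨fun x => h.induction (P := Acc fun z x => z ∈ nw x) (fun x hx => ⟨x, hx⟩) x⟩
  let F : ∀ x, (∀ z, z ∈ nw x → ℕ) → ℕ := fun x g =>
    a x + ((nw x).attach.map fun z => φ z.1 (g z.1 z.2)).sum
  refine ⟨wf.fix F, fun x => ?_⟩
  rw [wf.fix_eq]
  exact congrArg (fun l => a x + List.sum l)
    (List.attach_map_val (l := nw x) (f := fun z => φ z (wf.fix F z)))

theorem min_le (h : H.Linked H' m nw) {x : ℕ} (hx : x ∈ H.roots) : H.key m ≤ H.key x := by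
  obtain ⟨y, hy, hmin⟩ := Finset.exists_min_image H.roots.toFinset H.key ⟨x, by simpa⟩
  rw [List.mem_toFinset] at hy
  have hym : y = m := by
    by_contra hne
    obtain ⟨p, hp⟩ := h.cover y hy hne
    exact absurd (h.lt p y hp) (not_lt.2 (hmin p (by simpa using h.parent_mem p y hp)))
  exact hym ▸ hmin x (by simpa)

theorem sum_roots (h : H.Linked H' m nw) (hn : H.roots.Nodup) (g : ℕ → ℕ) :
    (H.roots.map fun x => ((nw x).map g).sum).sum = ((H.roots.filter (· ≠ m)).map g).sum := by
  have h1 : (H.roots.map fun x => ((nw x).map g).sum).sum = ((H.roots.flatMap nw).map g).sum := by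
    generalize H.roots = l
    induction l with
    | nil => rfl
    | cons a l ih => simp [ih]
  rw [h1]
  refine ((List.perm_ext_iff_of_nodup ?_ (hn.filter _)).2 ?_).map g |>.sum_eq
  · rw [List.nodup_flatMap]
    refine ⟨fun x _ => h.nodup x, ?_⟩
    refine List.Nodup.pairwise_of_forall_ne hn ?_
    intro x _ y _ hxy z hz hz'
    exact hxy (h.unique x y z hz hz')
  · intro z
    simp only [List.mem_flatMap, List.mem_filter, decide_eq_true_eq]
    constructor
    · rintro ⟨x, _, hz⟩
      exact ⟨h.child_mem x z hz, h.child_ne x z hz⟩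
    · rintro ⟨hz, hne⟩
      obtain ⟨x, hx⟩ := h.cover z hz hne
      exact ⟨x, h.parent_mem x z hx, hx⟩

end Heap.Linked

/-- The number of nodes at and below the children in `l` that were linked when the label of the
parent was at most `r`. -/
def sizeUpTo (mu plab : ℕ → ℕ) (l : List ℕ) (r : ℕ) : ℕ :=
  ((l.filter (plab · ≤ r)).map mu).sum

theorem sizeUpTo_append (mu plab : ℕ → ℕ) (l l' : List ℕ) (r : ℕ) :
    sizeUpTo mu plab (l ++ l') r = sizeUpTo mu plab l r + sizeUpTo mu plab l' r := by
  simp [sizeUpTo]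

theorem sizeUpTo_of_forall_le {mu plab : ℕ → ℕ} {l : List ℕ} {r : ℕ} (h : ∀ z ∈ l, plab z ≤ r) :
    sizeUpTo mu plab l r = (l.map mu).sum := by
  rw [sizeUpTo, List.filter_eq_self.2 (by simpa using h)]

theorem sizeUpTo_of_forall_lt {mu plab : ℕ → ℕ} {l : List ℕ} {r : ℕ} (h : ∀ z ∈ l, r < plab z) :
    sizeUpTo mu plab l r = 0 := by
  rw [sizeUpTo, List.filter_eq_nil_iff.2 (by simpa using h)]
  rfl

theorem sizeUpTo_congr {mu plab mu' plab' : ℕ → ℕ} {l : List ℕ} {r : ℕ}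
    (h : ∀ z ∈ l, mu' z = mu z ∧ plab' z = plab z) :
    sizeUpTo mu' plab' l r = sizeUpTo mu plab l r := by
  unfold sizeUpTo
  rw [List.filter_congr (q := fun z => decide (plab z ≤ r)) (fun z hz => by rw [(h z hz).2])]
  congr 1
  exact List.map_congr_left fun z hz => (h z (List.mem_of_mem_filter hz)).1

variable {K : Type*} [LinearOrder K]

/-- `c x` counts the start roots that are linked to `x` and charged to it, directly or not: start
roots `z` with `c z ≥ s` are cut off. `mu2 x` is the size of the tree of `x` after this. -/
structure Charged (s : ℕ) (nw : ℕ → List ℕ) (mu c mu2 : ℕ → ℕ) : Prop where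
  c_eq : ∀ x, c x = 1 + ((nw x).map fun z => if c z < s then c z else 0).sum
  mu2_eq : ∀ x, mu2 x = mu x + ((nw x).map fun z => if c z < s then mu2 z else 0).sum

theorem sum_map_ite_eq (p : ℕ → Prop) [DecidablePred p] (g : ℕ → ℕ) (l : List ℕ) :
    (l.map fun z => if p z then g z else 0).sum = ((l.filter p).map g).sum := by
  induction l with
  | nil => rfl
  | cons a l ih =>
    by_cases h : p a <;> simp [h, ih]

theorem sum_map_filter_add (p : ℕ → Prop) [DecidablePred p] (g : ℕ → ℕ) (l : List ℕ) :
    ((l.filter p).map g).sum + ((l.filter fun x => ¬ p x).map g).sum = (l.map g).sum := by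
  induction l with
  | nil => rfl
  | cons a l ih =>
    by_cases h : p a <;> simp [h] <;> simp at ih <;> omega

section Charged

variable {s : ℕ} {H H' : Heap K} {mu c mu2 : ℕ → ℕ} {m : ℕ}
  {nw : ℕ → List ℕ}

theorem Heap.Linked.exists_charged (hl : H.Linked H' m nw) (s : ℕ) (mu : ℕ → ℕ) :
    ∃ c mu2, Charged s nw mu c mu2 := by
  obtain ⟨c, hc⟩ := hl.exists_rec (fun _ => 1) fun _ k => if k < s then k else 0
  obtain ⟨mu2, hm⟩ := hl.exists_rec mu fun z k => if c z < s then k else 0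
  exact ⟨c, mu2, hc, hm⟩

theorem Charged.mu_le (hc : Charged s nw mu c mu2) (x : ℕ) : mu x ≤ mu2 x := by
  rw [hc.mu2_eq]; omega

theorem Charged.mu2_of_notMem (hc : Charged s nw mu c mu2) (hl : H.Linked H' m nw) {x : ℕ}
    (hx : x ∉ H.roots) : mu2 x = mu x := by
  rw [hc.mu2_eq]
  have : nw x = [] := by
    rw [List.eq_nil_iff_forall_not_mem]
    exact fun z hz => hx (hl.parent_mem x z hz)
  simp [this]

/-- Conservation of weight: a root that is not cut passes its weight to its parent, so the total
weight ends up at `m` and at the cut roots. It is applied to the numbers of roots and to the sizes.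
-/
theorem Heap.Linked.sum_charged (hl : H.Linked H' m nw)
    (hn : H.roots.Nodup) (a g : ℕ → ℕ)
    (hg : ∀ x, g x = a x + ((nw x).map fun z => if c z < s then g z else 0).sum) :
    g m + ((H.roots.filter fun z => z ≠ m ∧ ¬ c z < s).map g).sum = (H.roots.map a).sum := by
  have h1 := hl.sum_roots hn fun z => if c z < s then g z else 0
  have h2 : (H.roots.map g).sum = (H.roots.map a).sum +
      (H.roots.map fun x => ((nw x).map fun z => if c z < s then g z else 0).sum).sum := by
    rw [← List.sum_map_add]
    congr 1
    exact List.map_congr_left fun x _ => hg x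
  rw [h1, sum_map_ite_eq, List.filter_filter] at h2
  have h3 := sum_map_filter_add (· ≠ m) g H.roots
  have h4 := sum_map_filter_add (fun z => c z < s) g (H.roots.filter (· ≠ m))
  rw [List.filter_filter, List.filter_filter] at h4
  have h5 : H.roots.filter (fun x => ¬ (x ≠ m)) = [m] := by
    have h6 : H.roots.filter (fun x => ¬ (x ≠ m)) = H.roots.filter (fun x => x == m) := by
      congr 1; funext x; simp [beq_eq_decide]
    rw [h6, List.filter_beq, List.count_eq_one_of_mem hn hl.min_mem, List.replicate_one]
  rw [h5] at h3
  simp only [List.map_cons, List.map_nil, List.sum_cons, List.sum_nil] at h3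
  have h7 : ∀ p q : ℕ → Prop, ∀ [DecidablePred p] [DecidablePred q],
      H.roots.filter (fun a => decide (p a) && decide (q a)) =
        H.roots.filter (fun a => q a ∧ p a) := by
    intro p q _ _
    congr 1; funext x; simp [Bool.and_comm]
  simp only [h7] at h2 h4
  omega

/-- Every cut root has collected at least `s` of the start roots, and no start root is collected
twice. -/
theorem Charged.mul_length_le (hc : Charged s nw mu c mu2) (hl : H.Linked H' m nw)
    (hn : H.roots.Nodup) :
    s * (H.roots.filter fun z => z ≠ m ∧ ¬ c z < s).length ≤ H.roots.length := by
  have h1 := hl.sum_charged hn (fun _ => 1) c hc.c_eq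
  simp only [List.map_const', List.sum_replicate, smul_eq_mul, mul_one] at h1
  have h2 := List.card_nsmul_le_sum ((H.roots.filter fun z => z ≠ m ∧ ¬ c z < s).map c) s (by
    intro y hy
    obtain ⟨z, hz, rfl⟩ := List.mem_map.1 hy
    simp only [List.mem_filter, decide_eq_true_eq] at hz
    omega)
  rw [List.length_map, smul_eq_mul] at h2
  rw [mul_comm]
  omega

theorem Charged.c_le (hc : Charged s nw mu c mu2) (x : ℕ) :
    c x ≤ 1 + s * ((nw x).filter fun z => c z < s).length := by
  rw [hc.c_eq, sum_map_ite_eq]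
  have h2 := List.sum_le_card_nsmul (((nw x).filter fun z => c z < s).map c) s (by
    intro y hy
    obtain ⟨z, hz, rfl⟩ := List.mem_map.1 hy
    simp only [List.mem_filter, decide_eq_true_eq] at hz
    omega)
  rw [List.length_map, smul_eq_mul] at h2
  rw [mul_comm s]
  omega

end Charged

variable [AddCommGroup K]

/-- The invariant of the adversary. The nodes `x` have labels `lab x` that determine their keys;
`mu x` is the number of nodes charged to the tree of `x`, and `plab z` is the label that the parent
of `z` had when `z` was linked to it. -/
structure Sized (M : ℕ) (u : K) (s n : ℕ) (H : Heap K) (lab plab mu : ℕ → ℕ) : Prop where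
  wf : H.WF
  key_eq : ∀ x ∈ H.live, H.key x = nodeKey M u (lab x) x
  mu_eq : ∀ x ∈ H.live, mu x = 1 + ((H.kids x).map mu).sum
  pow_le : ∀ x ∈ H.live, s ^ lab x ≤ mu x
  root_lt : ∀ x ∈ H.roots, mu x < s ^ (lab x + 1)
  sum_roots : (H.roots.map mu).sum = n
  lab_le : ∀ x ∈ H.live, lab x ≤ Nat.log s n
  -- Established in the round that lifts the label of `x` past `r`: the label is set to the
  -- logarithm of the size, when all children have been linked at labels at most `r`. A surviving
  -- node does not lose old children.
  le_sizeUpTo : ∀ x ∈ H.live, ∀ r < lab x, s ^ (r + 1) ≤ 1 + sizeUpTo mu plab (H.kids x) r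
  -- A root of label `r` starts a round with size less than `s ^ (r + 1)`, and each child that it
  -- keeps brings fewer than `s` start trees of labels at most `r`.
  sizeUpTo_le : ∀ x z, z ∈ H.kids x → 1 + sizeUpTo mu plab (H.kids x) (plab z) ≤
    (1 + s * ((H.kids x).filter (plab · = plab z)).length) * s ^ (plab z + 1)
  -- This is the purpose of the cuts: an uncut tree has fewer than `s` start trees, each smaller
  -- than `s ^ (plab z + 1)`.
  mu_lt : ∀ x z, z ∈ H.kids x → mu z < s ^ (plab z + 2)
  plab_le : ∀ x z, z ∈ H.kids x → plab z ≤ lab x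
  sorted : ∀ x, (H.kids x).Pairwise fun z w => plab w ≤ plab z

section Sized

variable [IsOrderedAddMonoid K] {M : ℕ} {u : K} {s n : ℕ} {H H' : Heap K}
  {lab plab mu c mu2 : ℕ → ℕ} {m : ℕ} {nw : ℕ → List ℕ}

theorem Sized.lab_le_lab (h : Sized M u s n H lab plab mu) (hu : 0 < u) (hM : H.next ≤ M)
    {x y : ℕ} (hx : x ∈ H.live) (hy : y ∈ H.live) (hxy : H.key x ≤ H.key y) : lab y ≤ lab x := by
  rcases hxy.eq_or_lt with e | hlt
  · rw [h.key_eq x hx, h.key_eq y hy] at e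
    by_cases hne : x = y
    · rw [hne]
    · exact absurd e (nodeKey_ne hu ((h.wf.live_lt x hx).trans_le hM)
        ((h.wf.live_lt y hy).trans_le hM) hne)
  · rw [h.key_eq x hx, h.key_eq y hy] at hlt
    exact label_le_of_nodeKey_lt hu ((h.wf.live_lt x hx).trans_le hM) hlt

theorem Sized.lab_child_le (h : Sized M u s n H lab plab mu) (hu : 0 < u) (hM : H.next ≤ M)
    (hl : H.Linked H' m nw) {x z : ℕ} (hz : z ∈ nw x) : lab z ≤ lab x :=
  h.lab_le_lab hu hM (h.wf.forest.roots_live (hl.parent_mem x z hz))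
    (h.wf.forest.roots_live (hl.child_mem x z hz)) (hl.lt x z hz).le

/-- What remains of the tree of `x` after the cuts is made of `c x` start trees. Labels do not
increase downwards, so each has fewer than `s ^ (lab x + 1)` nodes. -/
theorem Sized.mu2_le (h : Sized M u s n H lab plab mu) (hu : 0 < u) (hM : H.next ≤ M)
    (hl : H.Linked H' m nw) (hc : Charged s nw mu c mu2) (x : ℕ) (hx : x ∈ H.roots) :
    mu2 x ≤ c x * s ^ (lab x + 1) := by
  revert hx
  refine hl.induction (P := fun x => x ∈ H.roots → mu2 x ≤ c x * s ^ (lab x + 1)) ?_ x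
  intro x ih hx
  rw [hc.mu2_eq, hc.c_eq, add_mul, one_mul, ← List.sum_map_mul_right]
  refine add_le_add (h.root_lt x hx).le (List.sum_le_sum ?_)
  intro z hz
  split_ifs with hcz
  · refine (ih z hz (hl.child_mem x z hz)).trans ?_
    have hs : 0 < s := by omega
    have := h.lab_child_le hu hM hl hz
    exact Nat.mul_le_mul_left _ (Nat.pow_le_pow_right hs (by omega))
  · simp

end Sized

end PureHeap


/-! ### One round of the adversary -/

namespace PureHeap

theorem Heap.Linked.wf {K : Type*} [LinearOrder K] {H H' : Heap K} {m : ℕ} {nw : ℕ → List ℕ}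
    (hl : H.Linked H' m nw) (h : H.WF) : H'.WF := by
  have fo := h.forest
  have kid_root : ∀ z p, z ∈ H.kids p → z ∉ H.roots := fun z p hz hr => fo.root_notMem z hr p hz
  have new_root : ∀ z p, z ∈ nw p → z ∈ H.roots := fun z p hz => hl.child_mem p z hz
  have hk : ∀ z p, z ∈ H'.kids p ↔ p ≠ m ∧ (z ∈ nw p ∨ z ∈ H.kids p) := by
    intro z p
    rw [hl.kids_eq]
    by_cases hp : p = m <;> simp [hp]
  have huniq : ∀ x p q, (x ∈ nw p ∨ x ∈ H.kids p) → (x ∈ nw q ∨ x ∈ H.kids q) → p = q := by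
    rintro x p q (h1 | h1) (h2 | h2)
    · exact hl.unique p q x h1 h2
    · exact absurd (new_root x p h1) (kid_root x q h2)
    · exact absurd (new_root x q h2) (kid_root x p h1)
    · exact fo.parent_unique x p q h1 h2
  have hnd : ∀ x, (nw x ++ H.kids x).Nodup := by
    intro x
    refine List.nodup_append.2 ⟨hl.nodup x, fo.nodup_kids x, ?_⟩
    intro a ha b hb e
    exact kid_root b x hb (e ▸ new_root a x ha)
  have hro : ∀ x, x ∈ H'.roots ↔ x ∈ nw m ∨ x ∈ H.kids m := by
    intro x; rw [hl.roots_eq, List.mem_append]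
  refine ⟨⟨by rw [hl.roots_eq]; exact hnd m, ?_, ?_, ?_, ?_, ?_⟩, ?_, ?_⟩
  · intro x
    rw [hl.kids_eq]
    split_ifs
    · exact List.nodup_nil
    · exact hnd x
  · intro x hx p hp
    rw [hk] at hp
    exact hp.1 (huniq x p m hp.2 ((hro x).1 hx))
  · intro x p q hp hq
    rw [hk] at hp hq
    exact huniq x p q hp.2 hq.2
  · intro x
    rw [hl.live_eq, Finset.mem_erase, fo.mem_live, hro]
    simp only [hk]
    constructor
    · rintro ⟨hxm, h1 | ⟨p, h1⟩⟩
      · obtain ⟨p, hp⟩ := hl.cover x h1 hxm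
        by_cases hpm : p = m
        · exact Or.inl (Or.inl (hpm ▸ hp))
        · exact Or.inr ⟨p, hpm, Or.inl hp⟩
      · by_cases hpm : p = m
        · exact Or.inl (Or.inr (hpm ▸ h1))
        · exact Or.inr ⟨p, hpm, Or.inr h1⟩
    · have h1 : ∀ p, x ∈ nw p ∨ x ∈ H.kids p → x ≠ m ∧ (x ∈ H.roots ∨ ∃ p, x ∈ H.kids p) := by
        rintro p (h1 | h1)
        · exact ⟨hl.child_ne p x h1, Or.inl (new_root x p h1)⟩
        · refine ⟨?_, Or.inr ⟨p, h1⟩⟩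
          rintro rfl
          exact kid_root x p h1 hl.min_mem
      rintro (h2 | ⟨p, -, h2⟩)
      · exact h1 m h2
      · exact h1 p h2
  · intro x p hp
    rw [hk] at hp
    rw [hl.live_eq, Finset.mem_erase]
    refine ⟨hp.1, ?_⟩
    rcases hp.2 with h1 | h1
    · exact fo.roots_live (hl.parent_mem p x h1)
    · exact fo.parent_live x p h1
  · intro x hx
    rw [hl.live_eq, Finset.mem_erase] at hx
    rw [hl.next_eq]
    exact h.live_lt x hx.2
  · intro x z hz
    rw [hk] at hz
    rw [hl.key_eq]
    rcases hz.2 with h1 | h1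
    · exact hl.lt x z h1
    · exact h.order x z h1

/-- The effect of a round of the adversary that links roots by `nw` and removes `m`, then decreases
the keys of `L`, and then inserts a new node. The list `L` consists of the start roots that satisfy
`cut`, of those new roots that satisfy `climb`, and of the children of `m` that satisfy `pd`. -/
structure Round {K : Type*} [AddCommGroup K] [LinearOrder K] (M : ℕ) (u : K) (s n : ℕ)
    (H H' : Heap K) (lab mu : ℕ → ℕ) (m : ℕ) (nw : ℕ → List ℕ) (cut climb : ℕ → Bool) (L : List ℕ)
    (lab' plab' mu' : ℕ → ℕ) (H3 : Heap K) : Prop where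
  heap_eq : H3 =
    (H'.decreaseKeys L fun x => nodeKey M u (lab' x) x).insertKey (nodeKey M u 0 H.next)
  nodup : L.Nodup
  mem_live : ∀ x ∈ L, x ∈ H.live ∧ x ≠ m
  lab_le : ∀ x ∈ H.live, lab x ≤ lab' x
  lab_lt : ∀ x ∈ (nw m ++ H.kids m).filter climb, lab x < lab' x
  lab_log : ∀ x ∈ L, lab' x = Nat.log s (mu' x)
  mu_old : ∀ z ∈ H.kids m, mu' z = mu z
  roots_eq : H3.roots = H.next :: (L.reverse ++ (nw m ++ H.kids m).filter (· ∉ L))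
  kids_eq : ∀ x, H3.kids x = if x = m then [] else (nw x).filter (fun z => !cut z) ++ H.kids x
  live_eq : H3.live = insert H.next (H.live.erase m)
  next_eq : H3.next = H.next + 1
  sized : Sized M u s n H3 lab' plab' mu'

variable {K : Type*} [AddCommGroup K] [LinearOrder K] [IsOrderedAddMonoid K]

/-- The size invariant survives whatever the algorithm does, with any choice of designated children
`pd` and any order `L2` of their Decrease-Keys. This freedom in the order will carry the
permutation, and so the new data do not depend on `L2`. -/
theorem Sized.exists_round {M : ℕ} {u : K} {s n : ℕ} {H H' : Heap K} {lab plab mu : ℕ → ℕ} {m : ℕ}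
    {nw : ℕ → List ℕ} (h : Sized M u s n H lab plab mu) (hu : 0 < u) (hM : H.next < M)
    (hs : 2 ≤ s) (hl : H.Linked H' m nw) (pd : ℕ → Bool) (hpd : ∀ x, pd x = true → x ∈ H.kids m) :
    ∃ (cut climb : ℕ → Bool) (lab' plab' mu' : ℕ → ℕ),
      s * (H.roots.filter cut).length ≤ H.roots.length ∧
      ∀ L2 : List ℕ, L2.Perm ((H.kids m).filter pd) →
        ∃ H3, Round M u s n H H' lab mu m nw cut climb
          (H.roots.filter cut ++ (nw m ++ H.kids m).filter climb ++ L2) lab' plab' mu' H3 := by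
  classical
  obtain ⟨c, mu2, hc⟩ := hl.exists_charged s mu
  have hs0 : 0 < s := by omega
  have fo := h.wf.forest
  have hparE : ∃ par : ℕ → ℕ, ∀ x z, z ∈ nw x → par z = x := by
    refine ⟨fun z => if hz : ∃ x, z ∈ nw x then hz.choose else 0, ?_⟩
    intro x z hz
    have hz' : ∃ x, z ∈ nw x := ⟨x, hz⟩
    simp only [dif_pos hz']
    exact hl.unique _ _ z hz'.choose_spec hz
  obtain ⟨par, hpar⟩ := hparE
  set cut : ℕ → Bool := fun z => decide (z ≠ m ∧ ¬ c z < s) with hcut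
  -- Cut and designated nodes are excluded since they get a new label anyway; the list of
  -- Decrease-Keys must have no repetitions.
  set climb : ℕ → Bool := fun x => decide (¬ (x ∈ H.roots ∧ ¬ c x < s) ∧
    lab x < Nat.log s (mu2 x) ∧ ¬ pd x = true) with hclimb
  set S : ℕ → Prop := fun x => (x ∈ H.roots ∧ x ≠ m ∧ ¬ c x < s) ∨
    (x ∈ nw m ++ H.kids m ∧ climb x = true) ∨ pd x = true with hS
  set mu' : ℕ → ℕ := fun x => if x = H.next then 1 else mu2 x with hmu'
  set lab' : ℕ → ℕ := fun x => if x = H.next then 0 else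
    if S x then Nat.log s (mu2 x) else lab x with hlab'
  -- A new child records the label that its parent had when the Extract-Min started, before any
  -- label is raised.
  set plab' : ℕ → ℕ := fun z => if z ∈ H.roots ∧ z ≠ m then lab (par z) else plab z with hplab'
  refine ⟨cut, climb, lab', plab', mu', hc.mul_length_le hl fo.nodup_roots, ?_⟩
  intro L2 hL2
  set L := H.roots.filter cut ++ (nw m ++ H.kids m).filter climb ++ L2 with hLdef
  have hL2mem : ∀ x, x ∈ L2 ↔ pd x = true := by
    intro x
    rw [hL2.mem_iff, List.mem_filter]
    exact ⟨fun hx => hx.2, fun hx => ⟨hpd x hx, hx⟩⟩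
  have hnext : H.next ∉ H.live := fun hn => lt_irrefl _ (h.wf.live_lt _ hn)
  have hm : m ∈ H.live := fo.roots_live hl.min_mem
  have kid_root : ∀ z p, z ∈ H.kids p → z ∉ H.roots := fun z p hz hr => fo.root_notMem z hr p hz
  have new_root : ∀ z p, z ∈ nw p → z ∈ H.roots := fun z p hz => hl.child_mem p z hz
  have hR : ∀ x ∈ nw m ++ H.kids m, x ∈ H.live ∧ x ≠ m := by
    intro x hx
    rcases List.mem_append.1 hx with hx | hx
    · exact ⟨fo.roots_live (new_root x m hx), hl.child_ne m x hx⟩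
    · refine ⟨fo.kids_live hx, ?_⟩
      rintro rfl
      exact lt_irrefl _ (h.wf.order x x hx)
  have hLmem : ∀ x, x ∈ L ↔ S x := by
    intro x
    simp only [hLdef, hS, List.mem_append, List.mem_filter, hL2mem, hcut, decide_eq_true_eq,
      or_assoc]
  have hSlive : ∀ x, S x → x ∈ H.live ∧ x ≠ m := by
    rintro x (⟨h1, h2, -⟩ | ⟨h1, -⟩ | h1)
    · exact ⟨fo.roots_live h1, h2⟩
    · exact hR x h1
    · exact hR x (List.mem_append_right _ (hpd x h1))
  have hmu2kid : ∀ z p, z ∈ H.kids p → mu2 z = mu z := fun z p hz =>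
    hc.mu2_of_notMem hl (kid_root z p hz)
  have hmu2pos : ∀ x ∈ H.live, 0 < mu2 x := by
    intro x hx
    have h1 := hc.mu_le x
    have h2 := h.mu_eq x hx
    omega
  have hlablog : ∀ x ∈ H.live, lab x ≤ Nat.log s (mu2 x) := by
    intro x hx
    exact Nat.le_log_of_pow_le (by omega) ((h.pow_le x hx).trans (hc.mu_le x))
  have hmu'live : ∀ x ∈ H.live, mu' x = mu2 x := by
    intro x hx
    simp only [hmu']
    rw [if_neg]
    rintro rfl; exact hnext hx
  have hlab'live : ∀ x ∈ H.live, lab' x = if S x then Nat.log s (mu2 x) else lab x := by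
    intro x hx
    simp only [hlab']
    rw [if_neg]
    rintro rfl; exact hnext hx
  have hlable : ∀ x ∈ H.live, lab x ≤ lab' x := by
    intro x hx
    rw [hlab'live x hx]
    split_ifs
    · exact hlablog x hx
    · exact le_rfl
  have hlab'le : ∀ x ∈ H.live, lab' x ≤ Nat.log s (mu2 x) := by
    intro x hx
    rw [hlab'live x hx]
    split_ifs
    · exact le_rfl
    · exact hlablog x hx
  have hfil : ∀ x, x ≠ m → (nw x ++ H.kids x).filter (· ∉ L) =
      (nw x).filter (fun z => !cut z) ++ H.kids x := by
    intro x hx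
    rw [List.filter_append]
    congr 1
    · refine List.filter_congr fun z hz => ?_
      have hzr := new_root z x hz
      have hzm := hl.child_ne x z hz
      have h1 : S z ↔ ¬ c z < s := by
        simp only [hS]
        constructor
        · rintro (h1 | ⟨h1, -⟩ | h1)
          · exact h1.2.2
          · rcases List.mem_append.1 h1 with h1 | h1
            · exact absurd (hl.unique _ _ z hz h1) hx
            · exact absurd hzr (kid_root z m h1)
          · exact absurd hzr (kid_root z m (hpd z h1))
        · exact fun h1 => Or.inl ⟨hzr, hzm, h1⟩
      rw [Bool.eq_iff_iff]
      simp [hLmem, h1, hcut, hzm]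
    · rw [List.filter_eq_self]
      intro z hz
      rw [decide_eq_true_eq, hLmem]
      rintro (h1 | ⟨h1, -⟩ | h1)
      · exact kid_root z x hz h1.1
      · rcases List.mem_append.1 h1 with h1 | h1
        · exact kid_root z x hz (new_root z m h1)
        · exact hx (fo.parent_unique z x m hz h1)
      · exact hx (fo.parent_unique z x m hz (hpd z h1))
  have hLnodup : L.Nodup := by
    rw [hLdef, List.nodup_append, List.nodup_append]
    refine ⟨⟨fo.nodup_roots.filter _, ?_, ?_⟩, hL2.nodup_iff.2 ((fo.nodup_kids m).filter _), ?_⟩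
    · refine List.Nodup.filter _ (List.nodup_append.2 ⟨hl.nodup m, fo.nodup_kids m, ?_⟩)
      intro a ha b hb e
      exact kid_root b m hb (e ▸ new_root a m ha)
    · intro a ha b hb e
      subst e
      simp only [List.mem_filter, hcut, hclimb, decide_eq_true_eq] at ha hb
      exact hb.2.1 ⟨ha.1, ha.2.2⟩
    · intro a ha b hb e
      subst e
      rw [hL2mem] at hb
      rcases List.mem_append.1 ha with ha | ha
      · exact kid_root a m (hpd a hb) (List.mem_filter.1 ha).1
      · simp only [List.mem_filter, hclimb, decide_eq_true_eq] at ha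
        exact ha.2.2.2 hb
  set H3 := (H'.decreaseKeys L fun x => nodeKey M u (lab' x) x).insertKey (nodeKey M u 0 H.next)
    with hH3
  have hroots : H3.roots = H.next :: (L.reverse ++ (nw m ++ H.kids m).filter (· ∉ L)) := by
    change H'.next :: (L.reverse ++ H'.roots.filter (· ∉ L)) = _
    rw [hl.next_eq, hl.roots_eq]
  have hkids : ∀ x, H3.kids x =
      if x = m then [] else (nw x).filter (fun z => !cut z) ++ H.kids x := by
    intro x
    change Function.update (fun z => (H'.kids z).filter (· ∉ L)) H'.next [] x = _
    rw [hl.next_eq]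
    by_cases hx : x = H.next
    · have h1 : nw x = [] := by
        rw [List.eq_nil_iff_forall_not_mem]
        intro z hz
        exact hnext (hx ▸ fo.roots_live (hl.parent_mem x z hz))
      have h2 : H.kids x = [] := hx ▸ h.wf.kids_next
      rw [← hx, Function.update_self, h1, h2]
      simp
    · rw [Function.update_of_ne hx, hl.kids_eq]
      split_ifs with hxm
      · rfl
      · exact hfil x hxm
  have hlive : H3.live = insert H.next (H.live.erase m) := by
    change insert H'.next H'.live = _
    rw [hl.next_eq, hl.live_eq]
  have hwf' : H'.WF := hl.wf h.wf
  have hLlive' : ∀ x ∈ L, x ∈ H'.live := by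
    intro x hx
    obtain ⟨h1, h2⟩ := hSlive x ((hLmem x).1 hx)
    rw [hl.live_eq]
    exact Finset.mem_erase.2 ⟨h2, h1⟩
  have hwf3 : H3.WF := by
    refine (hwf'.decreaseKeys hLnodup hLlive' ?_).insertKey _
    intro x hx
    have h1 := (hSlive x ((hLmem x).1 hx)).1
    rw [hl.key_eq, h.key_eq x h1]
    exact nodeKey_le_of_le hu (hlable x h1)
  have hlive3 : ∀ x ∈ H3.live, x = H.next ∨ (x ≠ H.next ∧ x ≠ m ∧ x ∈ H.live) := by
    intro x hx
    rw [hlive, Finset.mem_insert, Finset.mem_erase] at hx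
    rcases hx with hx | hx
    · exact Or.inl hx
    · refine Or.inr ⟨?_, hx⟩
      rintro rfl
      exact hnext hx.2
  have hkeep : ∀ x, (nw x).filter (fun z => !cut z) = (nw x).filter fun z => c z < s := by
    intro x
    refine List.filter_congr fun z hz => ?_
    have := hl.child_ne x z hz
    rw [Bool.eq_iff_iff]
    simp [hcut, this]
  have hsum2 : ∀ x, mu2 x = mu x + (((nw x).filter fun z => c z < s).map mu2).sum := by
    intro x
    rw [hc.mu2_eq x, sum_map_ite_eq]
  have hkid3 : ∀ x z, z ∈ H3.kids x → x ≠ m ∧ x ∈ H.live ∧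
      ((z ∈ nw x ∧ c z < s) ∨ z ∈ H.kids x) := by
    intro x z hz
    rw [hkids, hkeep] at hz
    split_ifs at hz with hx
    · simp at hz
    · rw [List.mem_append, List.mem_filter, decide_eq_true_eq] at hz
      refine ⟨hx, ?_, hz⟩
      rcases hz with hz | hz
      · exact fo.roots_live (hl.parent_mem x z hz.1)
      · exact fo.parent_live z x hz
  have hkl : ∀ x, x ≠ m → H3.kids x = ((nw x).filter fun z => c z < s) ++ H.kids x := by
    intro x hx
    rw [hkids, if_neg hx, hkeep]
  have hplabnew : ∀ x z, z ∈ nw x → plab' z = lab x := by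
    intro x z hz
    simp only [hplab']
    rw [if_pos ⟨new_root z x hz, hl.child_ne x z hz⟩, hpar x z hz]
  have hplabold : ∀ x z, z ∈ H.kids x → plab' z = plab z := by
    intro x z hz
    simp only [hplab']
    rw [if_neg fun h1 => kid_root z x hz h1.1]
  have hmu'kid : ∀ x z, z ∈ H.kids x → mu' z = mu z := by
    intro x z hz
    rw [hmu'live z (fo.kids_live hz), hmu2kid z x hz]
  have hmu'new : ∀ x z, z ∈ nw x → mu' z = mu2 z := by
    intro x z hz
    exact hmu'live z (fo.roots_live (new_root z x hz))
  have hplable : ∀ x z, z ∈ H3.kids x → plab' z ≤ lab x := by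
    intro x z hz
    obtain ⟨-, -, h1 | h1⟩ := hkid3 x z hz
    · exact (hplabnew x z h1.1).le
    · rw [hplabold x z h1]
      exact h.plab_le x z h1
  have hsumkids : ∀ x, x ≠ m → x ∈ H.live → 1 + ((H3.kids x).map mu').sum = mu2 x := by
    intro x hx hxl
    rw [hkl x hx, List.map_append, List.sum_append, hsum2 x, h.mu_eq x hxl]
    have e1 : (H.kids x).map mu' = (H.kids x).map mu :=
      List.map_congr_left fun z hz => hmu'kid x z hz
    have e2 : ((nw x).filter fun z => c z < s).map mu' =
        ((nw x).filter fun z => c z < s).map mu2 :=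
      List.map_congr_left fun z hz => hmu'new x z (List.mem_of_mem_filter hz)
    rw [e1, e2]
    ring
  have hupall : ∀ x r, x ≠ m → x ∈ H.live → lab x ≤ r →
      1 + sizeUpTo mu' plab' (H3.kids x) r = mu2 x := by
    intro x r hx hxl hr
    rw [sizeUpTo_of_forall_le fun z hz => (hplable x z hz).trans hr, hsumkids x hx hxl]
  have hupold : ∀ x r, sizeUpTo mu' plab' (H.kids x) r = sizeUpTo mu plab (H.kids x) r := by
    intro x r
    exact sizeUpTo_congr fun z hz => ⟨hmu'kid x z hz, hplabold x z hz⟩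
  have hmu2n : ∀ x ∈ H3.roots, x ≠ H.next → x ∈ H.live := by
    intro x hx hxn
    rw [hroots] at hx
    rcases List.mem_cons.1 hx with hx | hx
    · exact absurd hx hxn
    rcases List.mem_append.1 hx with hx | hx
    · exact (hSlive x ((hLmem x).1 (List.mem_reverse.1 hx))).1
    · exact (hR x (List.mem_of_mem_filter hx)).1
  -- Apart from the inserted node, the new roots are, up to order, the cut roots, the uncut links of
  -- `m` and the old children of `m`. By conservation of weight their trees hold all nodes except
  -- `m`, for which the inserted node makes up.
  have hsum : (H3.roots.map mu').sum = n := by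
    have h1 : (H3.roots.map mu').sum =
        1 + ((L ++ (nw m ++ H.kids m).filter (· ∉ L)).map mu2).sum := by
      rw [hroots, List.map_cons, List.sum_cons]
      congr 1
      · simp [hmu']
      · have h2 : (L.reverse ++ (nw m ++ H.kids m).filter (· ∉ L)).map mu' =
            (L.reverse ++ (nw m ++ H.kids m).filter (· ∉ L)).map mu2 := by
          refine List.map_congr_left fun x hx => hmu'live x ?_
          rcases List.mem_append.1 hx with hx | hx
          · exact (hSlive x ((hLmem x).1 (List.mem_reverse.1 hx))).1
          · exact (hR x (List.mem_of_mem_filter hx)).1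
        rw [h2]
        simp
    have h3 : (L ++ (nw m ++ H.kids m).filter (· ∉ L)).Perm
        (H.roots.filter (fun z => z ≠ m ∧ ¬ c z < s) ++
          (((nw m).filter fun z => c z < s) ++ H.kids m)) := by
      refine (List.perm_ext_iff_of_nodup ?_ ?_).2 ?_
      · refine List.nodup_append.2 ⟨hLnodup, List.Nodup.filter _ ?_, ?_⟩
        · refine List.nodup_append.2 ⟨hl.nodup m, fo.nodup_kids m, ?_⟩
          intro a ha b hb e
          exact kid_root b m hb (e ▸ new_root a m ha)
        · intro a ha b hb e
          subst e
          have := List.mem_filter.1 hb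
          simp only [decide_eq_true_eq] at this
          exact this.2 ha
      · refine List.nodup_append.2 ⟨fo.nodup_roots.filter _,
          List.nodup_append.2 ⟨(hl.nodup m).filter _, fo.nodup_kids m, ?_⟩, ?_⟩
        · intro a ha b hb e
          exact kid_root b m hb (e ▸ new_root a m (List.mem_of_mem_filter ha))
        · intro a ha b hb e
          subst e
          simp only [List.mem_filter, decide_eq_true_eq, List.mem_append] at ha hb
          rcases hb with hb | hb
          · exact ha.2.2 hb.2
          · exact kid_root a m hb ha.1
      · intro x
        simp only [List.mem_append, List.mem_filter, decide_eq_true_eq, hLmem]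
        by_cases hSx : S x
        · simp only [hSx, not_true, and_false, or_false, true_iff]
          rcases hSx with h4 | ⟨h4, h5⟩ | h4
          · exact Or.inl h4
          · rcases List.mem_append.1 h4 with h6 | h6
            · by_cases h7 : c x < s
              · exact Or.inr (Or.inl ⟨h6, h7⟩)
              · exact Or.inl ⟨new_root x m h6, hl.child_ne m x h6, h7⟩
            · exact Or.inr (Or.inr h6)
          · exact Or.inr (Or.inr (hpd x h4))
        · simp only [hSx, false_or, not_false_iff, and_true]
          constructor
          · rintro (h4 | h4)
            · refine Or.inr (Or.inl ⟨h4, ?_⟩)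
              by_contra h7
              exact hSx (Or.inl ⟨new_root x m h4, hl.child_ne m x h4, h7⟩)
            · exact Or.inr (Or.inr h4)
          · rintro (h4 | h4 | h4)
            · exact absurd (Or.inl h4) hSx
            · exact Or.inl h4.1
            · exact Or.inr h4
    have h4 := hl.sum_charged (s := s) (c := c) fo.nodup_roots mu mu2 hc.mu2_eq
    rw [h.sum_roots, hsum2 m, h.mu_eq m hm] at h4
    rw [h1, (h3.map mu2).sum_eq, List.map_append, List.sum_append, List.map_append,
      List.sum_append]
    have e1 : (H.kids m).map mu2 = (H.kids m).map mu :=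
      List.map_congr_left fun z hz => hmu2kid z m hz
    rw [e1]
    omega
  have hmu'root : ∀ x ∈ H3.roots, mu' x ≤ n := by
    intro x hx
    rw [← hsum]
    exact List.single_le_sum (by simp) _ (List.mem_map_of_mem hx)
  have hSroot : ∀ x, S x → x ∈ H3.roots := by
    intro x hx
    rw [hroots]
    simp [(hLmem x).2 hx]
  have hs1 : 1 < s := by omega
  refine ⟨H3, hH3, hLnodup, fun x hx => hSlive x ((hLmem x).1 hx), hlable, ?_, ?_,
    hmu'kid m, hroots, hkids, hlive, ?_, hwf3, ?_, ?_, ?_, ?_, hsum, ?_, ?_, ?_, ?_, ?_, ?_⟩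
  · intro x hx
    have h1 := List.mem_filter.1 hx
    have h2 : S x := Or.inr (Or.inl h1)
    rw [hlab'live x (hR x h1.1).1, if_pos h2]
    have := h1.2
    simp only [hclimb, decide_eq_true_eq] at this
    exact this.2.1
  · intro x hx
    have h1 := (hLmem x).1 hx
    have h2 := (hSlive x h1).1
    rw [hlab'live x h2, if_pos h1, hmu'live x h2]
  · change H'.next + 1 = H.next + 1
    rw [hl.next_eq]
  · intro x hx
    change Function.update (fun z => if z ∈ L then nodeKey M u (lab' z) z else H'.key z) H'.next
      (nodeKey M u 0 H.next) x = _
    rw [hl.next_eq, hl.key_eq]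
    rcases hlive3 x hx with rfl | ⟨h1, h2, h3⟩
    · rw [Function.update_self]
      simp [hlab']
    · rw [Function.update_of_ne h1]
      split_ifs with h4
      · rfl
      · rw [h.key_eq x h3, hlab'live x h3, if_neg fun h1 => h4 ((hLmem x).2 h1)]
  · -- sizes
    intro x hx
    rcases hlive3 x hx with rfl | ⟨h1, h2, h3⟩
    · have h1 : H.next ≠ m := by rintro e; exact hnext (e ▸ hm)
      have h2 : nw H.next = [] := by
        rw [List.eq_nil_iff_forall_not_mem]
        intro z hz
        exact hnext (fo.roots_live (hl.parent_mem _ z hz))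
      rw [hkl _ h1, h2, h.wf.kids_next]
      simp [hmu']
    · rw [hsumkids x h2 h3, hmu'live x h3]
  · intro x hx
    rcases hlive3 x hx with rfl | ⟨h1, h2, h3⟩
    · simp [hlab', hmu']
    · rw [hmu'live x h3]
      exact (Nat.pow_le_pow_right hs0 (hlab'le x h3)).trans
        (Nat.pow_log_le_self s (hmu2pos x h3).ne')
  · intro x hx
    by_cases hxn : x = H.next
    · simp only [hlab', hmu', hxn]
      simpa using hs1
    have h3 := hmu2n x hx hxn
    rw [hmu'live x h3]
    have h4 : lab' x = Nat.log s (mu2 x) := by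
      rw [hlab'live x h3]
      split_ifs with h5
      · rfl
      -- A new root that is not in the list has the right label already, as it would have to climb
      -- otherwise.
      · refine le_antisymm (hlablog x h3) ?_
        by_contra h6
        apply h5
        rw [hroots] at hx
        rcases List.mem_cons.1 hx with hx | hx
        · exact absurd hx hxn
        rcases List.mem_append.1 hx with hx | hx
        · exact (hLmem x).1 (List.mem_reverse.1 hx)
        · have h7 := List.mem_of_mem_filter hx
          by_cases h8 : x ∈ H.roots ∧ ¬ c x < s
          · exact Or.inl ⟨h8.1, (hR x h7).2, h8.2⟩
          · by_cases h9 : pd x = true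
            · exact Or.inr (Or.inr h9)
            · refine Or.inr (Or.inl ⟨h7, ?_⟩)
              simp only [hclimb, decide_eq_true_eq]
              exact ⟨h8, by omega, h9⟩
    rw [h4]
    exact Nat.lt_pow_succ_log_self hs1 _
  · intro x hx
    rcases hlive3 x hx with rfl | ⟨h1, h2, h3⟩
    · simp [hlab']
    · rw [hlab'live x h3]
      split_ifs with h5
      · refine Nat.log_mono_right ?_
        rw [← hmu'live x h3]
        exact hmu'root x (hSroot x h5)
      · exact h.lab_le x h3
  · intro x hx r hr
    rcases hlive3 x hx with rfl | ⟨h1, h2, h3⟩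
    · simp [hlab'] at hr
    -- Below the old label the old children suffice. From the old label up to the new one all
    -- children count, and their sizes add up to the size that determined the new label.
    · by_cases hrl : r < lab x
      · refine (h.le_sizeUpTo x h3 r hrl).trans ?_
        rw [hkl x h2, sizeUpTo_append, hupold]
        omega
      · rw [hupall x r h2 h3 (by omega)]
        refine (Nat.pow_le_pow_right hs0 ?_).trans (Nat.pow_log_le_self s (hmu2pos x h3).ne')
        exact hr.trans_le (hlab'le x h3)
  · intro x z hz
    obtain ⟨h1, h2, h3⟩ := hkid3 x z hz
    -- New children of `x` are recorded at `lab x`. Below this label everything is as before; at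
    -- this label the sum is the whole size of `x`, and `Sized.mu2_le` bounds it if `x` was a root.
    by_cases hlt : plab' z < lab x
    · have hzo : z ∈ H.kids x := by
        rcases h3 with h3 | h3
        · exact absurd (hplabnew x z h3.1) hlt.ne
        · exact h3
      have h4 := h.sizeUpTo_le x z hzo
      rw [hkl x h1, sizeUpTo_append, hupold, sizeUpTo_of_forall_lt, zero_add, List.filter_append,
        List.length_append]
      · rw [hplabold x z hzo]
        refine h4.trans (Nat.mul_le_mul_right _ (Nat.add_le_add_left (Nat.mul_le_mul_left _ ?_) _))
        have h5 : (H.kids x).filter (fun w => plab w = plab z) =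
            (H.kids x).filter (fun w => plab' w = plab z) :=
          List.filter_congr fun w hw => by rw [hplabold x w hw]
        rw [h5]
        exact Nat.le_add_left _ _
      · intro w hw
        rw [hplabnew x w (List.mem_of_mem_filter hw)]
        exact hlt
    · have heq : plab' z = lab x := le_antisymm (hplable x z hz) (not_lt.1 hlt)
      rw [heq, hupall x _ h1 h2 le_rfl]
      by_cases hxr : x ∈ H.roots
      · refine (h.mu2_le hu hM.le hl hc x hxr).trans (Nat.mul_le_mul_right _ ?_)
        refine (hc.c_le x).trans (Nat.add_le_add_left (Nat.mul_le_mul_left _ ?_) _)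
        rw [hkl x h1, List.filter_append, List.length_append]
        refine le_trans (le_of_eq ?_) (Nat.le_add_right _ _)
        congr 1
        symm
        rw [List.filter_eq_self]
        intro w hw
        rw [decide_eq_true_eq]
        exact hplabnew x w (List.mem_of_mem_filter hw)
      · have hzo : z ∈ H.kids x := by
          rcases h3 with h3 | h3
          · exact absurd (hl.parent_mem x z h3.1) hxr
          · exact h3
        have hnil : nw x = [] := by
          rw [List.eq_nil_iff_forall_not_mem]
          exact fun w hw => hxr (hl.parent_mem x w hw)
        have h4 := h.sizeUpTo_le x z hzo
        have h5 := hupall x (lab x) h1 h2 le_rfl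
        rw [hkl x h1, hnil, List.filter_nil, List.nil_append, hupold] at h5
        rw [← hplabold x z hzo, heq, h5] at h4
        refine h4.trans (Nat.mul_le_mul_right _ (Nat.add_le_add_left (Nat.mul_le_mul_left _ ?_) _))
        rw [hkl x h1, hnil, List.filter_nil, List.nil_append]
        have h6 : (H.kids x).filter (fun w => plab w = lab x) =
            (H.kids x).filter (fun w => plab' w = lab x) :=
          List.filter_congr fun w hw => by rw [hplabold x w hw]
        rw [h6]
  · intro x z hz
    obtain ⟨h1, h2, h3 | h3⟩ := hkid3 x z hz
    · rw [hplabnew x z h3.1, hmu'new x z h3.1]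
      have h4 := h.mu2_le hu hM.le hl hc z (new_root z x h3.1)
      have h5 := h.lab_child_le hu hM.le hl h3.1
      calc mu2 z ≤ c z * s ^ (lab z + 1) := h4
        _ ≤ c z * s ^ (lab x + 1) := Nat.mul_le_mul_left _ (Nat.pow_le_pow_right hs0 (by omega))
        _ < s * s ^ (lab x + 1) := Nat.mul_lt_mul_of_pos_right h3.2 (Nat.pow_pos hs0)
        _ = s ^ (lab x + 2) := by ring
    · rw [hplabold x z h3, hmu'kid x z h3]
      exact h.mu_lt x z h3
  · intro x z hz
    obtain ⟨h1, h2, -⟩ := hkid3 x z hz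
    exact (hplable x z hz).trans (hlable x h2)
  · intro x
    by_cases hx : x = m
    · rw [hkids, if_pos hx]
      exact List.Pairwise.nil
    · rw [hkl x hx, List.pairwise_append]
      refine ⟨?_, ?_, ?_⟩
      · refine List.Pairwise.filter _ (List.pairwise_of_forall_mem_list ?_)
        intro z hz w hw
        rw [hplabnew x z hz, hplabnew x w hw]
      · refine List.Pairwise.imp_of_mem ?_ (h.sorted x)
        intro z w hz hw h1
        rwa [hplabold x z hz, hplabold x w hw]
      · intro z hz w hw
        rw [hplabnew x z (List.mem_of_mem_filter hz), hplabold x w hw]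
        exact h.plab_le x w hw

end PureHeap


/-! ### Children of different sizes -/

namespace PureHeap

variable {K : Type*} [AddCommGroup K] [LinearOrder K] {M : ℕ} {u : K}
  {s n : ℕ} {H H' : Heap K} {lab plab mu : ℕ → ℕ} {m : ℕ} {nw : ℕ → List ℕ}

/-- The children linked up to label `r + 4` have nearly `s ^ (r + 5)` nodes, and those linked up to
`r` less than a quarter of `s ^ (r + 5)` or just that. The at most `Δ` children in between hold the
rest, so one of them has the stated share; `s ^ J` absorbs both `Δ` and the factor 2. -/
theorem Sized.exists_mem_window_of_sizeUpTo_le (h : Sized M u s n H lab plab mu) (hs : 2 ≤ s)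
    (hm : m ∈ H.live) {Δ J : ℕ} (hdeg : (H.kids m).length ≤ Δ) (hJ : 2 * Δ ≤ s ^ J) {r : ℕ}
    (hr : r + 4 < lab m) (hW : 1 + sizeUpTo mu plab (H.kids m) r ≤ s ^ (r + 3)) :
    ∃ z ∈ H.kids m, r < plab z ∧ plab z ≤ r + 4 ∧ s ^ (r + 5) ≤ s ^ J * mu z := by
  by_contra! hno
  set k := H.kids m
  have h1 := h.le_sizeUpTo m hm (r + 4) hr
  have h2 : sizeUpTo mu plab k (r + 4) =
      sizeUpTo mu plab k r + ((k.filter fun z => r < plab z ∧ plab z ≤ r + 4).map mu).sum := by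
    unfold sizeUpTo
    have e := sum_map_filter_add (fun z => plab z ≤ r) mu (k.filter (plab · ≤ r + 4))
    rw [List.filter_filter, List.filter_filter] at e
    rw [← e]
    congr 3
    · refine List.filter_congr fun z _ => ?_
      rw [Bool.eq_iff_iff]
      simp
      omega
    · refine List.filter_congr fun z _ => ?_
      rw [Bool.eq_iff_iff]
      simp
  have h3 : s ^ J * ((k.filter fun z => r < plab z ∧ plab z ≤ r + 4).map mu).sum ≤
      Δ * s ^ (r + 5) := by
    rw [← List.sum_map_mul_left]
    refine (List.sum_le_card_nsmul _ (s ^ (r + 5)) ?_).trans ?_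
    · intro y hy
      obtain ⟨z, hz, rfl⟩ := List.mem_map.1 hy
      simp only [List.mem_filter, decide_eq_true_eq] at hz
      exact (hno z hz.1 hz.2.1 hz.2.2).le
    · rw [List.length_map, smul_eq_mul]
      exact Nat.mul_le_mul_right _ ((List.length_filter_le _ _).trans hdeg)
  have h4 : 0 < s ^ J := Nat.pow_pos (by omega)
  have h5 : 0 < s ^ (r + 3) := Nat.pow_pos (by omega)
  have h6 : s ^ (r + 5) = s ^ (r + 3) * (s * s) := by ring
  have h7 : 4 ≤ s * s := Nat.mul_le_mul hs hs
  rw [h2] at h1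
  have h8 : s ^ J * s ^ (r + 5) ≤ s ^ J * s ^ (r + 3) + Δ * s ^ (r + 5) := by
    calc s ^ J * s ^ (r + 5) ≤ s ^ J * (s ^ (r + 3) +
          ((k.filter fun z => r < plab z ∧ plab z ≤ r + 4).map mu).sum) :=
          Nat.mul_le_mul_left _ (by rw [show r + 5 = r + 4 + 1 from rfl]; omega)
      _ ≤ _ := by rw [mul_add]; omega
  have h9 : 2 * Δ * s ^ (r + 5) ≤ s ^ J * s ^ (r + 5) := Nat.mul_le_mul_right _ hJ
  have h10 : s ^ J * s ^ (r + 5) ≤ 2 * (s ^ J * s ^ (r + 3)) := by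
    rw [mul_assoc] at h9
    omega
  rw [h6] at h10
  have h11 : s ^ J * (s ^ (r + 3) * (s * s)) = (s ^ J * s ^ (r + 3)) * (s * s) := by ring
  rw [h11] at h10
  have h12 : 0 < s ^ J * s ^ (r + 3) := Nat.mul_pos h4 h5
  nlinarith

/-- Take the highest label `r0 ≤ r` at which a child was linked. By `sizeUpTo_le`, an excessive size
needs at least `s` children linked at `r0`. As there are at most `Δ` of them, `r0` cannot be much
below `r` either. -/
theorem Sized.exists_crowded_of_lt_sizeUpTo (h : Sized M u s n H lab plab mu) (hs : 2 ≤ s)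
    {Δ J : ℕ} (hdeg : (H.kids m).length ≤ Δ) (hJ : 2 * Δ ≤ s ^ J) {r : ℕ}
    (hW : s ^ (r + 3) < 1 + sizeUpTo mu plab (H.kids m) r) :
    ∃ r0, s ≤ ((H.kids m).filter (plab · = r0)).length ∧ r0 ≤ r ∧ r < r0 + (J + 1) := by
  set k := H.kids m with hk
  have hs0 : 0 < s := by omega
  have hne : (k.toFinset.filter fun z => plab z ≤ r).Nonempty := by
    by_contra hne
    rw [Finset.not_nonempty_iff_eq_empty, Finset.filter_eq_empty_iff] at hne
    rw [sizeUpTo_of_forall_lt fun z hz => not_le.1 (hne (List.mem_toFinset.2 hz))] at hW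
    exact absurd (Nat.one_le_pow (r + 3) s hs0) (by omega)
  obtain ⟨z, hz, hmax⟩ := Finset.exists_max_image _ plab hne
  simp only [Finset.mem_filter, List.mem_toFinset] at hz hmax
  have h1 : sizeUpTo mu plab k r = sizeUpTo mu plab k (plab z) := by
    unfold sizeUpTo
    congr 2
    refine List.filter_congr fun w hw => ?_
    rw [Bool.eq_iff_iff, decide_eq_true_eq, decide_eq_true_eq]
    exact ⟨fun h1 => hmax w ⟨hw, h1⟩, fun h1 => h1.trans hz.2⟩
  have h2 := h.sizeUpTo_le m z hz.1
  rw [← hk, ← h1] at h2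
  set q := (k.filter (plab · = plab z)).length with hq
  have h3 := hW.trans_le h2
  have hqs : s ≤ q := by
    by_contra! hlt
    have h4 : 1 + s * q ≤ s * s := by nlinarith
    have h5 : (1 + s * q) * s ^ (plab z + 1) ≤ s ^ (r + 3) := by
      calc (1 + s * q) * s ^ (plab z + 1) ≤ s * s * s ^ (plab z + 1) := Nat.mul_le_mul_right _ h4
        _ = s ^ (plab z + 3) := by ring
        _ ≤ s ^ (r + 3) := Nat.pow_le_pow_right hs0 (by omega)
    omega
  refine ⟨plab z, hqs, hz.2, ?_⟩
  by_contra! hle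
  have hqd : q ≤ Δ := (List.length_filter_le _ _).trans hdeg
  have h4 : 1 + s * q ≤ s * s ^ J := by nlinarith
  have h5 : (1 + s * q) * s ^ (plab z + 1) ≤ s ^ (r + 3) := by
    calc (1 + s * q) * s ^ (plab z + 1) ≤ s * s ^ J * s ^ (plab z + 1) :=
          Nat.mul_le_mul_right _ h4
      _ = s ^ (plab z + J + 2) := by ring
      _ ≤ s ^ (r + 3) := Nat.pow_le_pow_right hs0 (by omega)
  omega

theorem card_crowded_mul_le {k : List ℕ} (hk : k.Nodup) (plab : ℕ → ℕ) (s : ℕ) (P : Finset ℕ)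
    (hP : ∀ r ∈ P, s ≤ (k.filter (plab · = r)).length) : P.card * s ≤ k.length := by
  have h1 : ∀ r, (k.filter (plab · = r)).length = (k.toFinset.filter (plab · = r)).card := by
    intro r
    rw [← List.toFinset_card_of_nodup (hk.filter _), List.toFinset_filter]
    congr 1
    ext; simp
  rw [← List.toFinset_card_of_nodup hk]
  calc P.card * s = P.card • s := (smul_eq_mul _ _).symm
    _ ≤ ∑ r ∈ P, (k.toFinset.filter (plab · = r)).card :=
        Finset.card_nsmul_le_sum _ _ _ fun r hr => (h1 r) ▸ hP r hr
    _ = (P.biUnion fun r => k.toFinset.filter (plab · = r)).card := by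
        rw [Finset.card_biUnion]
        intro a _ b _ hab
        refine Finset.disjoint_left.2 fun z hz hz' => hab ?_
        rw [← (Finset.mem_filter.1 hz).2, ← (Finset.mem_filter.1 hz').2]
    _ ≤ k.toFinset.card := Finset.card_le_card (by
        intro z hz
        obtain ⟨r, -, hr⟩ := Finset.mem_biUnion.1 hz
        exact (Finset.mem_filter.1 hr).1)

variable [IsOrderedAddMonoid K]

/-- The minimum has the highest label among the roots. At most `Δ` trees contain all `n` nodes, so
this label is close to `log_s n`. -/
theorem Sized.log_le_lab (h : Sized M u s n H lab plab mu) (hu : 0 < u) (hM : H.next ≤ M)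
    (hs : 2 ≤ s) (hl : H.Linked H' m nw) {Δ J : ℕ} (hD : H.roots.length ≤ Δ) (hJ : 2 * Δ ≤ s ^ J) :
    Nat.log s n ≤ lab m + (J + 1) := by
  have h1 : n ≤ s ^ (lab m + (J + 1)) := by
    calc n = (H.roots.map mu).sum := h.sum_roots.symm
      _ ≤ (H.roots.map mu).length • s ^ (lab m + 1) := by
          refine List.sum_le_card_nsmul _ _ ?_
          intro y hy
          obtain ⟨x, hx, rfl⟩ := List.mem_map.1 hy
          refine (h.root_lt x hx).le.trans (Nat.pow_le_pow_right (by omega) ?_)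
          have := h.lab_le_lab hu hM (h.wf.forest.roots_live hl.min_mem)
            (h.wf.forest.roots_live hx) (hl.min_le hx)
          omega
      _ ≤ s ^ J * s ^ (lab m + 1) := by
          rw [List.length_map, smul_eq_mul]
          exact Nat.mul_le_mul_right _ (by omega)
      _ = s ^ (lab m + (J + 1)) := by ring
  refine (Nat.log_mono_right h1).trans ?_
  rw [Nat.log_pow (by omega)]

/-- If the minimum has few children, there are children of it of many different sizes. -/
theorem Sized.exists_designated (h : Sized M u s n H lab plab mu) (hu : 0 < u) (hM : H.next ≤ M)
    (hs : 2 ≤ s) (hl : H.Linked H' m nw) {Δ J κ : ℕ} (hD : H.roots.length ≤ Δ)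
    (hdeg : (H.kids m).length ≤ Δ) (hJ : 2 * Δ ≤ s ^ J)
    (hκ : κ + Δ / s * (J + 1) ≤ (Nat.log s n - (J + 1)) / 5) :
    ∃ (pd : ℕ → Bool) (win : ℕ → ℕ), (∀ x, pd x = true → x ∈ H.kids m) ∧
      ((H.kids m).filter pd).length = κ ∧
      ((H.kids m).filter pd).Pairwise (fun z w => win w < win z) ∧
      ∀ z, pd z = true → win z < Nat.log s n ∧ Nat.log s (mu z) ≤ 5 * win z + 5 ∧
        5 * win z + 5 ≤ J + Nat.log s (mu z) := by
  classical
  have hs0 : 0 < s := by omega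
  have hm := h.wf.forest.roots_live hl.min_mem
  have hΛ := h.log_le_lab hu hM hs hl hD hJ
  have hnd := h.wf.forest.nodup_kids m
  set k := H.kids m with hk
  -- Window `v` consists of the labels from `5 * v + 1` to `5 * v + 4`. The last condition bounds
  -- the size from below; `mu_lt` bounds it from above.
  set good : ℕ → ℕ → Prop := fun v z => z ∈ k ∧ 5 * v < plab z ∧ plab z ≤ 5 * v + 4 ∧
    s ^ (5 * v + 5) ≤ s ^ J * mu z with hgood
  set G := (Finset.range (lab m / 5)).filter fun v => ∃ z, good v z with hG
  set B := (Finset.range (lab m / 5)).filter fun v => ¬ ∃ z, good v z with hB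
  set P := (k.toFinset.image plab).filter fun r => s ≤ (k.filter (plab · = r)).length with hP
  have hcrowd : ∀ v ∈ B, ∃ r ∈ P, r ≤ 5 * v ∧ 5 * v < r + (J + 1) := by
    intro v hv
    obtain ⟨hv1, hv2⟩ := Finset.mem_filter.1 hv
    rw [Finset.mem_range] at hv1
    rcases le_or_gt (1 + sizeUpTo mu plab k (5 * v)) (s ^ (5 * v + 3)) with hW | hW
    · obtain ⟨z, hz, h1, h2, h3⟩ :=
        h.exists_mem_window_of_sizeUpTo_le hs hm hdeg hJ (by omega) hW
      exact absurd ⟨z, hz, h1, h2, h3⟩ hv2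
    · obtain ⟨r, h1, h2⟩ := h.exists_crowded_of_lt_sizeUpTo hs hdeg hJ hW
      refine ⟨r, Finset.mem_filter.2 ⟨?_, h1⟩, h2⟩
      obtain ⟨z, hz⟩ := List.exists_mem_of_length_pos (hs0.trans_le h1)
      simp only [List.mem_filter, decide_eq_true_eq] at hz
      exact Finset.mem_image.2 ⟨z, List.mem_toFinset.2 hz.1, hz.2⟩
  choose! r0 hr0 using hcrowd
  have hBcard : B.card ≤ Δ / s * (J + 1) := by
    have h1 : P.card * s ≤ Δ := (card_crowded_mul_le hnd plab s P fun r hr =>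
      (Finset.mem_filter.1 hr).2).trans hdeg
    have h2 : P.card ≤ Δ / s := (Nat.le_div_iff_mul_le hs0).2 h1
    have h3 : B.card ≤ (P ×ˢ Finset.range (J + 1)).card := by
      -- A window without a good child is recovered from its crowded label and its distance from it,
      -- which is at most `J`. There are at most `Δ / s` crowded labels.
      refine Finset.card_le_card_of_injOn (fun v => (r0 v, 5 * v - r0 v)) ?_ ?_
      · intro v hv
        have := hr0 v hv
        rw [Finset.mem_coe, Finset.mem_product, Finset.mem_range]
        exact ⟨this.1, by simp only; omega⟩
      · intro v hv w hw e
        have h4 := hr0 v hv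
        have h5 := hr0 w hw
        simp only [Prod.mk.injEq] at e
        omega
    rw [Finset.card_product, Finset.card_range] at h3
    exact h3.trans (Nat.mul_le_mul_right _ h2)
  have hGB : G.card + B.card = lab m / 5 := by
    rw [hG, hB, Finset.card_filter_add_card_filter_not, Finset.card_range]
  obtain ⟨U, hUG, hUcard⟩ := Finset.exists_subset_card_eq (s := G) (n := κ) (by omega)
  have hUgood : ∀ v ∈ U, ∃ z, good v z := fun v hv => (Finset.mem_filter.1 (hUG hv)).2
  choose! zz hzz using hUgood
  set win : ℕ → ℕ := fun z => (plab z - 1) / 5 with hwin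
  have hwz : ∀ v ∈ U, win (zz v) = v := by
    intro v hv
    have := hzz v hv
    simp only [hgood] at this
    simp only [hwin]
    omega
  refine ⟨fun z => decide (z ∈ U.image zz), win, ?_, ?_, ?_, ?_⟩
  · intro z hz
    obtain ⟨v, hv, rfl⟩ := Finset.mem_image.1 (of_decide_eq_true hz)
    exact (hzz v hv).1
  · rw [← List.toFinset_card_of_nodup (hnd.filter _), List.toFinset_filter]
    have : (k.toFinset.filter fun z => decide (z ∈ U.image zz) = true) = U.image zz := by
      ext z
      simp only [Finset.mem_filter, decide_eq_true_eq, List.mem_toFinset, and_iff_right_iff_imp]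
      intro hz
      obtain ⟨v, hv, rfl⟩ := Finset.mem_image.1 hz
      exact (hzz v hv).1
    rw [this, Finset.card_image_of_injOn, hUcard]
    intro v hv w hw e
    rw [← hwz v hv, ← hwz w hw, e]
  · refine List.Pairwise.imp_of_mem ?_ ((h.sorted m).filter _ |>.and (hnd.filter _))
    intro z w hz hw h1
    obtain ⟨v, hv, rfl⟩ := Finset.mem_image.1 (of_decide_eq_true (List.mem_filter.1 hz).2)
    obtain ⟨v', hv', rfl⟩ := Finset.mem_image.1 (of_decide_eq_true (List.mem_filter.1 hw).2)
    have h2 : win (zz v') ≤ win (zz v) := Nat.div_le_div_right (by omega)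
    refine lt_of_le_of_ne h2 fun e => h1.2 ?_
    rw [hwz v hv, hwz v' hv'] at e
    rw [e]
  · intro z hz
    obtain ⟨v, hv, rfl⟩ := Finset.mem_image.1 (of_decide_eq_true hz)
    obtain ⟨h1, h2, h3, h4⟩ := hzz v hv
    rw [hwz v hv]
    have hv1 := Finset.mem_range.1 (Finset.mem_filter.1 (hUG hv)).1
    have hpos : mu (zz v) ≠ 0 := by
      intro e
      rw [e, mul_zero] at h4
      exact absurd (Nat.pow_pos hs0) (not_lt.2 h4)
    refine ⟨?_, ?_, ?_⟩
    · have := h.lab_le m hm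
      omega
    · have h5 : mu (zz v) < s ^ (5 * v + 6) := by
        refine (h.mu_lt m _ h1).trans_le (Nat.pow_le_pow_right hs0 (by omega))
      have := Nat.log_lt_of_lt_pow hpos h5
      omega
    · have h5 : s ^ (5 * v + 5) < s ^ (J + (Nat.log s (mu (zz v)) + 1)) := by
        refine h4.trans_lt ?_
        rw [pow_add s J]
        exact Nat.mul_lt_mul_of_pos_left (Nat.lt_pow_succ_log_self (by omega) _)
          (Nat.pow_pos hs0)
      have := (Nat.pow_lt_pow_iff_right (by omega : 1 < s)).1 h5
      omega

end PureHeap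


/-! ### Reconstruction of the forest from the positions -/

namespace PureHeap

/-- The elements of a list selected by a mask. -/
def sel {α : Type*} : List Bool → List α → List α
  | b :: bs, x :: xs => if b then x :: sel bs xs else sel bs xs
  | _, _ => []

theorem sel_map {α β : Type*} (P : α → Bool) (f : α → β) (l : List α) :
    sel (l.map P) (l.map f) = (l.filter P).map f := by
  induction l with
  | nil => rfl
  | cons a l ih =>
    simp only [List.map_cons, sel, ih]
    cases h : P a <;> simp [h]

/-- The numbers selected by a mask, in decreasing order. -/
def decreasingOf (mask : List Bool) : List ℕ := (sel mask (List.range mask.length)).reverse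

theorem decreasingOf_mask {l : List ℕ} {b : ℕ} (hl : l.Pairwise fun x y => y < x)
    (hb : ∀ x ∈ l, x < b) :
    decreasingOf ((List.range b).map fun x => decide (x ∈ l)) = l := by
  have h1 := sel_map (fun x => decide (x ∈ l)) id (List.range b)
  rw [List.map_id, List.map_id] at h1
  rw [decreasingOf, List.length_map, List.length_range, h1]
  refine List.Pairwise.eq_of_mem_iff (r := fun x y => y < x) ?_ hl ?_
  · rw [List.pairwise_reverse]
    exact List.pairwise_lt_range.filter _
  · intro x
    simp only [List.mem_reverse, List.mem_filter, List.mem_range, decide_eq_true_eq]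
    exact ⟨fun h => h.2, fun h => ⟨hb x h, h⟩⟩

/-- A node between two decreases of its key as a designated node: `fresh x` is the node `x` before
the first of them, and `batch t i` is the node whose key is decreased by the `i`-th of them in
round `t`. -/
inductive Life where
  | fresh (x : ℕ)
  | batch (t i : ℕ)
  deriving DecidableEq

/-- A description of a round of the adversary in terms of positions. -/
structure Sym (ρ κ : ℕ) where
  ops : List (SubOp ρ × Bool)
  minId : ℕ
  cutMask : List Bool
  climbMask : List Bool
  desMask : List Bool
  winMask : List Bool
  diffs : List ℤ
  perm : Option (Equiv.Perm (Fin κ))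

/-- The forest in terms of lives. The children that a life `l` has are those gained in this
life, `gain l`, and those that it had when it began. If it began in round `j` as the designated
node with window `v`, the latter are `base j v`. -/
structure Abs (κ : ℕ) where
  time : ℕ
  next : ℕ
  roots : List Life
  gain : Life → List Life
  base : ℕ → ℕ → List Life
  wins : ℕ → List ℕ
  perms : ℕ → Option (Equiv.Perm (Fin κ))
  rev : Life → Option ℕ

namespace Abs

variable {ρ κ : ℕ}

/-- The start with `n` roots. -/
def start (κ n : ℕ) : Abs κ where
  time := 0
  next := n
  roots := (List.range n).reverse.map .fresh
  gain := fun _ => []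
  base := fun _ _ => []
  wins := fun _ => []
  perms := fun _ => none
  rev := fun _ => none

/-- The children that a life has since its beginning, if it belongs to the window `v`. -/
def baseOf (a : Abs κ) (l : Life) (v : ℕ) : List Life :=
  match l with
  | .fresh _ => []
  | .batch j _ => a.base j v

/-- The start roots linked below a life in a round. -/
def links (a : Abs κ) (ops : List (SubOp ρ × Bool)) (l : Life) : List Life :=
  if l ∈ a.roots then
    (((SymConf.start ρ a.roots.length).exec ops).heap.kids (a.roots.idxOf l)).map
      fun p => a.roots.getD p (.fresh 0)
  else []

/-- The life of the removed root. -/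
def minLife (a : Abs κ) (ops : List (SubOp ρ × Bool)) : Life :=
  a.roots.getD (((SymConf.start ρ a.roots.length).exec ops).heap.roots.headD 0) (.fresh 0)

/-- The forest after the removal of the minimum. -/
def newRoots (a : Abs κ) (y : Sym ρ κ) : List Life :=
  a.links y.ops (a.minLife y.ops) ++
    (a.gain (a.minLife y.ops) ++ a.baseOf (a.minLife y.ops) y.minId)

/-- The round described by `y`. -/
def step (a : Abs κ) (y : Sym ρ κ) : Abs κ where
  time := a.time + 1
  next := a.next + 1
  roots := .fresh a.next ::
    -- The value `none` means that the round has `κ` designated nodes. They appear as anonymous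
    -- lives, in the order of their Decrease-Keys, without a hint as to which children of the
    -- minimum they were.
    ((((List.range (if y.perm = none then κ else 0)).map fun i => Life.batch a.time i).reverse ++
      (sel y.cutMask a.roots ++ sel y.climbMask (a.newRoots y)).reverse) ++
      (a.newRoots y).filter (· ∉ sel y.cutMask a.roots ++ sel y.climbMask (a.newRoots y) ++
        sel y.desMask (a.newRoots y)))
  gain := fun l => (a.links y.ops l).filter (· ∉ sel y.cutMask a.roots) ++ a.gain l
  -- The set of windows and the left-to-right order of the designated children tell which of them
  -- has window `v`. Its previous window is `v` minus the stated change, and this selects the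
  -- children with which its previous life began.
  base := fun j v =>
    if j = a.time then
      let k := (decreasingOf y.winMask).idxOf v
      let l := (sel y.desMask (a.newRoots y)).getD k (.fresh 0)
      a.gain l ++ a.baseOf l ((v : ℤ) - y.diffs.getD k 0).toNat
    else a.base j v
  wins := fun j => if j = a.time then decreasingOf y.winMask else a.wins j
  perms := fun j => if j = a.time then y.perm else a.perms j
  -- The window of a life becomes known when the life ends, by removal of the node or by its next
  -- designation.
  rev := fun l =>
    if l = a.minLife y.ops then some y.minId
    else if l ∈ sel y.desMask (a.newRoots y) then
      let k := (sel y.desMask (a.newRoots y)).idxOf l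
      some ((((decreasingOf y.winMask).getD k 0 : ℕ) : ℤ) - y.diffs.getD k 0).toNat
    else a.rev l

/-- The life began before. -/
def Born (a : Abs κ) : Life → Prop
  | .fresh x => x < a.next
  | .batch j _ => j < a.time

end Abs

/-- The forest `a` is the heap `H` in terms of lives; `cur x` is the life of the node `x`, and
`idu l` is the window of the life `l`. -/
structure Sim {K : Type*} {κ : ℕ} (H : Heap K) (cur : ℕ → Life) (idu : Life → ℕ) (a : Abs κ) :
    Prop where
  inj : ∀ x ∈ H.live, ∀ y ∈ H.live, cur x = cur y → x = y
  next_eq : a.next = H.next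
  roots_eq : a.roots = H.roots.map cur
  kids_eq : ∀ x ∈ H.live,
    (H.kids x).map cur = a.gain (cur x) ++ a.baseOf (cur x) (idu (cur x))
  gain_unborn : ∀ l, ¬ a.Born l → a.gain l = []
  cur_born : ∀ x ∈ H.live, a.Born (cur x)
  rev_eq : ∀ l v, a.rev l = some v → v = idu l
  rev_born : ∀ l, a.rev l ≠ none → a.Born l
  -- Windows that are never revealed belong to lives that still go on, so there are at most as many
  -- as nodes in the heap.
  known : ∀ j < a.time, a.perms j = none → ∀ i < κ,
    a.rev (.batch j i) ≠ none ∨ ∃ x ∈ H.live, cur x = .batch j i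

namespace Sim

variable {K : Type*} {ρ κ M : ℕ} {u : K} {s n : ℕ} {H H' H3 : Heap K}
  {lab mu lab' plab' mu' : ℕ → ℕ} {m p : ℕ}
  {cut climb pd : ℕ → Bool} {L2 : List ℕ} {cur : ℕ → Life} {idu idu' : Life → ℕ} {a : Abs κ}
  {y : Sym ρ κ} {win : ℕ → ℕ}

theorem getD_roots (h : Sim H cur idu a) {q : ℕ} (hq : q < H.roots.length) :
    a.roots.getD q (.fresh 0) = cur (H.rootAt q) := by
  rw [h.roots_eq, List.getD_eq_getElem?_getD, List.getElem?_map, List.getElem?_eq_getElem hq,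
    Heap.rootAt, dif_pos hq]
  rfl

theorem cur_mem_iff (h : Sim H cur idu a) {l : List ℕ} (hl : ∀ x ∈ l, x ∈ H.live) {x : ℕ}
    (hx : x ∈ H.live) : cur x ∈ l.map cur ↔ x ∈ l := by
  rw [List.mem_map]
  constructor
  · rintro ⟨z, hz, e⟩
    rwa [← h.inj z (hl z hz) x hx e]
  · exact fun h1 => ⟨x, h1, rfl⟩

theorem idxOf_map_cur (h : Sim H cur idu a) {l : List ℕ} (hl : ∀ x ∈ l, x ∈ H.live) {x : ℕ}
    (hx : x ∈ H.live) : (l.map cur).idxOf (cur x) = l.idxOf x := by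
  induction l with
  | nil => rfl
  | cons z l ih =>
    rw [List.map_cons]
    by_cases e : z = x
    · rw [List.idxOf_cons_eq _ e, List.idxOf_cons_eq _ (by rw [e])]
    · have : cur z ≠ cur x := fun e' => e (h.inj z (hl z (by simp)) x hx e')
      rw [List.idxOf_cons_ne _ e, List.idxOf_cons_ne _ this, ih fun w hw => hl w (by simp [hw])]

variable [LinearOrder K]

theorem links_eq (h : Sim H cur idu a) (hwf : H.WF) (w : List (SubOp ρ × Bool))
    (hlt : ∀ q p', p' ∈ ((SymConf.start ρ H.roots.length).exec w).heap.kids q →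
      p' < H.roots.length ∧ q < H.roots.length) {x : ℕ} (hx : x ∈ H.live) :
    a.links w (cur x) = (H.linksOf w x).map cur := by
  have hlen : a.roots.length = H.roots.length := by rw [h.roots_eq, List.length_map]
  have hrl : ∀ z ∈ H.roots, z ∈ H.live := fun z hz => hwf.forest.roots_live hz
  have hmem : cur x ∈ a.roots ↔ x ∈ H.roots := by rw [h.roots_eq, h.cur_mem_iff hrl hx]
  unfold Abs.links Heap.linksOf
  by_cases hxr : x ∈ H.roots
  · rw [if_pos (hmem.2 hxr), if_pos hxr, hlen, List.map_map]
    have : a.roots.idxOf (cur x) = H.roots.idxOf x := by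
      rw [h.roots_eq, h.idxOf_map_cur hrl hx]
    rw [this]
    exact List.map_congr_left fun q hq => h.getD_roots (hlt _ q hq).1
  · rw [if_neg (fun e => hxr (hmem.1 e)), if_neg hxr, List.map_nil]

variable [AddCommGroup K]

/-- The core of the decoding: the order of `L2` enters `cur` and `idu`, but `a.step y` depends on
`L2` at most through its length. The new roots can be named because the only node whose children
surface is `m`, and `y.minId` states the window that selects them. A designated node starts a new
life with `base` evaluated at its own window, whichever that is. -/
theorem step (h : Sim H cur idu a) (hwf : H.WF) {w : List (SubOp ρ × Bool)}
    (hp : p < H.roots.length)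
    (hpw : ((SymConf.start ρ H.roots.length).exec w).heap.roots = [p])
    (hlt : ∀ q p', p' ∈ ((SymConf.start ρ H.roots.length).exec w).heap.kids q →
      p' < H.roots.length ∧ q < H.roots.length)
    (hl : H.Linked H' (H.rootAt p) (H.linksOf w))
    (hpd : ∀ x, pd x = true → x ∈ H.kids (H.rootAt p))
    (hL2 : L2.Perm ((H.kids (H.rootAt p)).filter pd))
    (hr : Round M u s n H H' lab mu (H.rootAt p) (H.linksOf w) cut climb
      (H.roots.filter cut ++ (H.linksOf w (H.rootAt p) ++ H.kids (H.rootAt p)).filter climb ++ L2)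
      lab' plab' mu' H3)
    (hops : y.ops = w) (hid : y.minId = idu (cur (H.rootAt p)))
    (hcut : y.cutMask = H.roots.map cut)
    (hclimb : y.climbMask = (H.linksOf w (H.rootAt p) ++ H.kids (H.rootAt p)).map climb)
    (hdes : y.desMask = (H.linksOf w (H.rootAt p) ++ H.kids (H.rootAt p)).map pd)
    (hwin : decreasingOf y.winMask = ((H.kids (H.rootAt p)).filter pd).map win)
    (hinj : ∀ z z', pd z = true → pd z' = true → win z = win z' → z = z')
    (hdiff : y.diffs = ((H.kids (H.rootAt p)).filter pd).map
      fun z => (win z : ℤ) - (idu (cur z) : ℤ))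
    (hlen : L2.length = if y.perm = none then κ else 0)
    (hidu : ∀ l, a.Born l → idu' l = idu l)
    (hidu2 : ∀ z ∈ L2, idu' (.batch a.time (L2.idxOf z)) = win z) :
    Sim H3 (fun x => if x = H.next then .fresh H.next else
      if x ∈ L2 then .batch a.time (L2.idxOf x) else cur x) idu' (a.step y) := by
  set m := H.rootAt p with hm
  set nw := H.linksOf w with hnw
  set R := nw m ++ H.kids m with hR
  set dn := (H.kids m).filter pd with hdn
  set cur' : ℕ → Life := fun x => if x = H.next then .fresh H.next else
      if x ∈ L2 then .batch a.time (L2.idxOf x) else cur x with hcur'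
  have fo := hwf.forest
  have hmlive : m ∈ H.live := fo.roots_live hl.min_mem
  have hnext : H.next ∉ H.live := fun hn => lt_irrefl _ (hwf.live_lt _ hn)
  have kid_root : ∀ z q, z ∈ H.kids q → z ∉ H.roots := fun z q hz hr => fo.root_notMem z hr q hz
  have new_root : ∀ z q, z ∈ nw q → z ∈ H.roots := fun z q hz => hl.child_mem q z hz
  have hRlive : ∀ x ∈ R, x ∈ H.live := by
    intro x hx
    rcases List.mem_append.1 hx with hx | hx
    · exact fo.roots_live (new_root x m hx)
    · exact fo.kids_live hx
  have hDlive : ∀ x ∈ H.roots, x ∈ H.live := fun x hx => fo.roots_live hx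
  have hdnR : R.filter pd = dn := by
    rw [hR, List.filter_append, List.filter_eq_nil_iff.2, List.nil_append]
    intro z hz hz'
    exact kid_root z m (hpd z hz') (new_root z m hz)
  have hdnlive : ∀ x ∈ dn, x ∈ H.live := fun x hx => fo.kids_live (List.mem_of_mem_filter hx)
  have hL2dn : ∀ x, x ∈ L2 ↔ x ∈ dn := fun x => hL2.mem_iff
  have hL2live : ∀ x ∈ L2, x ∈ H.live := fun x hx => hdnlive x ((hL2dn x).1 hx)
  have hL2kid : ∀ x ∈ L2, x ∈ H.kids m := fun x hx =>
    List.mem_of_mem_filter ((hL2dn x).1 hx)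
  have hlenr : a.roots.length = H.roots.length := by rw [h.roots_eq, List.length_map]
  have hmin : a.minLife y.ops = cur m := by
    rw [Abs.minLife, hlenr, hops, hpw]
    exact h.getD_roots hp
  have hnewroots : a.newRoots y = R.map cur := by
    rw [Abs.newRoots, hmin, hops, h.links_eq hwf w hlt hmlive, hid, ← h.kids_eq m hmlive, hR,
      List.map_append]
  have hcuts : sel y.cutMask a.roots = (H.roots.filter cut).map cur := by
    rw [hcut, h.roots_eq, sel_map]
  have hclimbs : sel y.climbMask (a.newRoots y) = (R.filter climb).map cur := by
    rw [hclimb, hnewroots, sel_map]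
  have hdess : sel y.desMask (a.newRoots y) = dn.map cur := by
    rw [hdes, hnewroots, sel_map, hdnR]
  have hnodup := hr.nodup
  have hL2nodup : L2.Nodup := (List.nodup_append.1 hnodup).2.1
  have hL1 : ∀ x ∈ H.roots.filter cut ++ R.filter climb, x ∈ H.live ∧ x ∉ L2 := by
    intro x hx
    refine ⟨(hr.mem_live x (List.mem_append_left _ hx)).1, fun hx2 => ?_⟩
    exact (List.nodup_append.1 hnodup).2.2 x hx x hx2 rfl
  have hcur'eq : ∀ x ∈ H.live, x ∉ L2 → cur' x = cur x := by
    intro x hx hx2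
    have : x ≠ H.next := by rintro rfl; exact hnext hx
    simp only [hcur', if_neg this, if_neg hx2]
  have hcur'L2 : ∀ x ∈ L2, cur' x = .batch a.time (L2.idxOf x) := by
    intro x hx
    have : x ≠ H.next := by rintro rfl; exact hnext (hL2live _ hx)
    simp only [hcur', if_neg this, if_pos hx]
  have hcur'next : cur' H.next = .fresh H.next := by simp [hcur']
  have hbornstep : ∀ l, a.Born l → (a.step y).Born l := by
    rintro (x | ⟨j, i⟩) hb
    · exact Nat.lt_succ_of_lt hb
    · exact Nat.lt_succ_of_lt hb
  have hlinks0 : ∀ l, ¬ a.Born l → a.links y.ops l = [] := by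
    intro l hb
    rw [Abs.links, if_neg]
    intro hmem
    rw [h.roots_eq, List.mem_map] at hmem
    obtain ⟨x, hx, rfl⟩ := hmem
    exact hb (h.cur_born x (hDlive x hx))
  have hgain0 : ∀ l, ¬ a.Born l → (a.step y).gain l = [] := by
    intro l hb
    change (a.links y.ops l).filter _ ++ a.gain l = []
    rw [hlinks0 l hb, h.gain_unborn l hb]
    rfl
  have hnb1 : ¬ a.Born (.fresh H.next) := by
    change ¬ H.next < a.next
    rw [h.next_eq]
    exact lt_irrefl _
  have hnb2 : ∀ i, ¬ a.Born (.batch a.time i) := fun i => lt_irrefl a.time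
  have hlive3 : ∀ x ∈ H3.live, x = H.next ∨ (x ≠ m ∧ x ∈ H.live) := by
    intro x hx
    rw [hr.live_eq, Finset.mem_insert, Finset.mem_erase] at hx
    exact hx
  have hkidsnotL2 : ∀ x, x ≠ m → ∀ z ∈ H.kids x, z ∈ H.live ∧ z ∉ L2 := by
    intro x hx z hz
    exact ⟨fo.kids_live hz, fun h2 => hx (fo.parent_unique z x m hz (hL2kid z h2))⟩
  have hgetwin : ∀ z ∈ dn, (decreasingOf y.winMask).idxOf (win z) = dn.idxOf z := by
    intro z hz
    rw [hwin]
    clear hdess hL2dn hL2 hwin hdiff hr hdnR hdnlive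
    have hpdz : pd z = true := (List.mem_filter.1 hz).2
    have : ∀ l : List ℕ, (∀ x ∈ l, pd x = true) → (l.map win).idxOf (win z) = l.idxOf z := by
      intro l hl
      induction l with
      | nil => rfl
      | cons b l ih =>
        rw [List.map_cons]
        by_cases e : b = z
        · rw [List.idxOf_cons_eq _ e, List.idxOf_cons_eq _ (by rw [e])]
        · have : win b ≠ win z := fun e' => e (hinj b z (hl b (by simp)) hpdz e')
          rw [List.idxOf_cons_ne _ e, List.idxOf_cons_ne _ this,
            ih fun w hw => hl w (by simp [hw])]
    exact this dn fun x hx => (List.mem_filter.1 hx).2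
  have hgetdiff : ∀ z ∈ dn, y.diffs.getD (dn.idxOf z) 0 = (win z : ℤ) - (idu (cur z) : ℤ) := by
    intro z hz
    have h1 : dn.idxOf z < dn.length := List.idxOf_lt_length_of_mem hz
    rw [hdiff, List.getD_eq_getElem?_getD, List.getElem?_map, List.getElem?_eq_getElem h1]
    simp
  have hidx : ∀ z ∈ dn, dn.idxOf z < dn.length := fun z hz => List.idxOf_lt_length_of_mem hz
  clear_value R
  refine ⟨?_, ?_, ?_, ?_, ?_, ?_, ?_, ?_, ?_⟩
  · -- injectivity
    have hborn : ∀ x ∈ H3.live, x ≠ H.next → x ∉ L2 → a.Born (cur' x) ∧ cur' x = cur x ∧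
        x ∈ H.live := by
      intro x hx h1 h2
      have h3 := ((hlive3 x hx).resolve_left h1).2
      have := hcur'eq x h3 h2
      exact ⟨this ▸ h.cur_born x h3, this, h3⟩
    intro x hx z hz e
    by_cases x1 : x = H.next
    · by_cases z1 : z = H.next
      · rw [x1, z1]
      · rw [x1, hcur'next] at e
        by_cases z2 : z ∈ L2
        · rw [hcur'L2 z z2] at e
          exact absurd e (by simp)
        · exact absurd (e ▸ (hborn z hz z1 z2).1) hnb1
    · by_cases z1 : z = H.next
      · rw [z1, hcur'next] at e
        by_cases x2 : x ∈ L2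
        · rw [hcur'L2 x x2] at e
          exact absurd e (by simp)
        · exact absurd (e ▸ (hborn x hx x1 x2).1) hnb1
      · by_cases x2 : x ∈ L2
        · rw [hcur'L2 x x2] at e
          by_cases z2 : z ∈ L2
          · rw [hcur'L2 z z2] at e
            simp only [Life.batch.injEq, true_and] at e
            exact (List.idxOf_inj x2).1 e
          · exact absurd (e ▸ (hborn z hz z1 z2).1) (hnb2 _)
        · by_cases z2 : z ∈ L2
          · rw [hcur'L2 z z2] at e
            exact absurd (e ▸ (hborn x hx x1 x2).1) (hnb2 _)
          · obtain ⟨-, h1, h2⟩ := hborn x hx x1 x2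
            obtain ⟨-, h3, h4⟩ := hborn z hz z1 z2
            rw [h1, h3] at e
            exact h.inj x h2 z h4 e
  · change a.next + 1 = H3.next
    rw [hr.next_eq, h.next_eq]
  · -- roots
    change Life.fresh a.next :: _ = _
    have e1 : L2.map cur' = (List.range L2.length).map fun i => Life.batch a.time i := by
      apply List.ext_getElem
      · simp
      · intro i h1 h2
        rw [List.length_map] at h1
        rw [List.getElem_map, List.getElem_map, List.getElem_range,
          hcur'L2 _ (List.getElem_mem h1), hL2nodup.idxOf_getElem]
    have e2 : (H.roots.filter cut ++ R.filter climb).map cur' =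
        (H.roots.filter cut).map cur ++ (R.filter climb).map cur := by
      rw [← List.map_append]
      refine List.map_congr_left fun x hx => ?_
      have := hL1 x hx
      exact hcur'eq x this.1 this.2
    rw [hr.roots_eq, ← hR, List.map_cons, hcur'next, h.next_eq, hcuts, hclimbs, hdess, hnewroots,
      ← hlen, List.map_append (l₂ := R.filter _), List.map_reverse, List.map_append (l₂ := L2), e1,
      e2,
      List.reverse_append (as := _ ++ _)]
    congr 2
    · rw [List.filter_map, ← List.map_append, ← List.map_append]
      have e : R.filter ((fun l => decide (l ∉ (H.roots.filter cut ++ R.filter climb ++ dn).map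
          cur)) ∘ cur) =
          R.filter (· ∉ H.roots.filter cut ++ R.filter climb ++ L2) := by
        refine List.filter_congr fun x hx => ?_
        rw [Function.comp, decide_eq_decide, h.cur_mem_iff ?_ (hRlive x hx)]
        · simp only [List.mem_append, hL2dn]
        · intro z hz
          rcases List.mem_append.1 hz with hz | hz
          · exact (hL1 z hz).1
          · exact hdnlive z hz
      rw [e]
      refine List.map_congr_left fun x hx => ?_
      have h1 := List.mem_filter.1 hx
      refine (hcur'eq x (hRlive x h1.1) fun h2 => ?_).symm
      have h3 := of_decide_eq_true h1.2
      exact h3 (List.mem_append_right _ h2)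
  · -- children
    intro x hx
    rw [hr.kids_eq]
    rcases hlive3 x hx with rfl | ⟨hxm, hxl⟩
    · have h1 : H.next ≠ m := fun e => hnext (e ▸ hmlive)
      have h2 : nw H.next = [] := by
        rw [List.eq_nil_iff_forall_not_mem]
        intro z hz
        exact hnext (hDlive _ (hl.parent_mem _ z hz))
      rw [if_neg h1, h2, hwf.kids_next, hcur'next, hgain0 _ hnb1]
      rfl
    · rw [if_neg hxm]
      by_cases hx2 : x ∈ L2
      · have hxk := hL2kid x hx2
        have h2 : nw x = [] := by
          rw [List.eq_nil_iff_forall_not_mem]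
          intro z hz
          exact kid_root x m hxk (hl.parent_mem _ z hz)
        have hxdn := (hL2dn x).1 hx2
        rw [h2, hcur'L2 x hx2, hgain0 _ (hnb2 _), hidu2 x hx2]
        change (H.kids x).map cur' = if a.time = a.time then _ else _
        rw [if_pos rfl, hgetwin x hxdn, hdess, hgetdiff x hxdn, List.getD_eq_getElem?_getD,
          List.getElem?_map, List.getElem?_eq_getElem (hidx x hxdn), List.getElem_idxOf,
          Option.map_some,
          Option.getD_some, sub_sub_cancel, Int.toNat_natCast, ← h.kids_eq x hxl]
        refine List.map_congr_left fun z hz => ?_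
        have := hkidsnotL2 x hxm z hz
        exact hcur'eq z this.1 this.2
      · rw [hcur'eq x hxl hx2]
        have hb := h.cur_born x hxl
        have e1 : (a.step y).baseOf (cur x) (idu' (cur x)) = a.baseOf (cur x) (idu (cur x)) := by
          rw [hidu _ hb]
          cases hc : cur x with
          | fresh z => rfl
          | batch j i =>
            rw [hc] at hb
            change (if j = a.time then _ else a.base j _) = a.base j _
            rw [if_neg (ne_of_lt hb)]
        have e2 : (a.step y).gain (cur x) =
            ((nw x).filter fun z => !cut z).map cur ++ a.gain (cur x) := by
          change (a.links y.ops (cur x)).filter (· ∉ sel y.cutMask a.roots) ++ a.gain (cur x) = _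
          rw [hops, h.links_eq hwf w hlt hxl, hcuts, List.filter_map]
          congr 2
          refine List.filter_congr fun z hz => ?_
          have hzr := new_root z x hz
          rw [Function.comp, Bool.eq_iff_iff, decide_eq_true_eq,
            h.cur_mem_iff (fun v hv => hDlive v (List.mem_of_mem_filter hv)) (hDlive z hzr)]
          simp [hzr]
        rw [e1, e2, List.map_append, List.append_assoc, ← h.kids_eq x hxl]
        congr 1
        · refine List.map_congr_left fun z hz => ?_
          have hz1 := new_root z x (List.mem_of_mem_filter hz)
          exact hcur'eq z (hDlive z hz1) fun h2 => kid_root z m (hL2kid z h2) hz1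
        · refine List.map_congr_left fun z hz => ?_
          have := hkidsnotL2 x hxm z hz
          exact hcur'eq z this.1 this.2
  · intro l hb
    exact hgain0 l fun hb' => hb (hbornstep l hb')
  · intro x hx
    rcases hlive3 x hx with rfl | ⟨hxm, hxl⟩
    · rw [hcur'next]
      change H.next < a.next + 1
      rw [h.next_eq]
      exact Nat.lt_succ_self _
    · by_cases hx2 : x ∈ L2
      · rw [hcur'L2 x hx2]
        exact Nat.lt_succ_self a.time
      · rw [hcur'eq x hxl hx2]
        exact hbornstep _ (h.cur_born x hxl)
  · intro l v hv
    change (if l = a.minLife y.ops then some y.minId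
      else if l ∈ sel y.desMask (a.newRoots y) then _ else a.rev l) = some v at hv
    split_ifs at hv with h1 h2
    · rw [h1, hmin, hidu _ (h.cur_born m hmlive), ← hid]
      exact (Option.some.inj hv).symm
    · rw [hdess, List.mem_map] at h2
      obtain ⟨z, hz, rfl⟩ := h2
      simp only [Option.some.injEq] at hv
      rw [hidu _ (h.cur_born z (hdnlive z hz)), ← hv, hdess, h.idxOf_map_cur hdnlive (hdnlive z hz),
        hgetdiff z hz, hwin, List.getD_eq_getElem?_getD, List.getElem?_map,
        List.getElem?_eq_getElem (hidx z hz)]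
      simp
    · rw [hidu l (h.rev_born l (by rw [hv]; simp))]
      exact h.rev_eq l v hv
  · intro l hv
    change (if l = a.minLife y.ops then some y.minId
      else if l ∈ sel y.desMask (a.newRoots y) then _ else a.rev l) ≠ none at hv
    split_ifs at hv with h1 h2
    · rw [h1, hmin]
      exact hbornstep _ (h.cur_born m hmlive)
    · rw [hdess, List.mem_map] at h2
      obtain ⟨z, hz, rfl⟩ := h2
      exact hbornstep _ (h.cur_born z (hdnlive z hz))
    · exact hbornstep _ (h.rev_born l hv)
  · intro j hj hperm i hi
    change (if j = a.time then y.perm else a.perms j) = none at hperm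
    change (if Life.batch j i = a.minLife y.ops then some y.minId
      else if Life.batch j i ∈ sel y.desMask (a.newRoots y) then _ else a.rev _) ≠ none ∨ _
    split_ifs at hperm with hjt
    · right
      rw [if_pos hperm] at hlen
      refine ⟨L2[i]'(by omega), ?_, ?_⟩
      · rw [hr.live_eq, Finset.mem_insert, Finset.mem_erase]
        have := hr.mem_live _ (List.mem_append_right _
          (List.getElem_mem (by omega : i < L2.length)))
        exact Or.inr ⟨this.2, this.1⟩
      · rw [hcur'L2 _ (List.getElem_mem _), hL2nodup.idxOf_getElem, hjt]
    · split_ifs with h1 h2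
      · exact Or.inl (by simp)
      · exact Or.inl (by simp)
      · have hj' : j < a.time := lt_of_le_of_ne (Nat.lt_succ_iff.1 hj) hjt
        rcases h.known j hj' hperm i hi with h3 | ⟨x, hx, h3⟩
        · exact Or.inl h3
        · right
          refine ⟨x, ?_, ?_⟩
          · rw [hr.live_eq, Finset.mem_insert, Finset.mem_erase]
            refine Or.inr ⟨?_, hx⟩
            rintro rfl
            exact h1 (by rw [hmin, h3])
          · rw [hcur'eq x hx, h3]
            intro hx2
            apply h2
            rw [hdess, ← h3]
            exact List.mem_map_of_mem ((hL2dn x).1 hx2)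

end Sim

end PureHeap


/-! ### The adversary -/

namespace PureHeap

namespace Sym

variable {ρ κ : ℕ}

/-- The length of the code of a list of booleans, in addition to that of the end mark. -/
def maskBits (l : List Bool) : ℕ := (l.map fun _ => 1 + 1).sum + 1

theorem maskBits_eq (l : List Bool) : maskBits l = 2 * l.length + 1 := by
  simp [maskBits, mul_comm]

/-- The length of the code of the description of a round, if `k` bits are used for a
permutation. -/
def bits (k : ℕ) (y : Sym ρ κ) : ℕ :=
  ((y.ops.map fun p => p.1.bits + 1 + 1).sum + 1) + ((y.minId + 1) + (maskBits y.cutMask +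
    (maskBits y.climbMask + (maskBits y.desMask + (maskBits y.winMask +
      (((y.diffs.map fun e => 1 + (e.natAbs + 1) + 1).sum + 1) +
        y.perm.elim 1 fun _ => k + 1))))))

theorem kraft_bits {k : ℕ} (hk : κ.factorial ≤ 2 ^ k) : Kraft (bits (ρ := ρ) (κ := κ) k) := by
  have hmask : Kraft maskBits := Kraft.bool.list
  have hperm : Kraft (fun o : Option (Equiv.Perm (Fin κ)) => o.elim 1 fun _ => k + 1) :=
    Kraft.option (Kraft.const_of_card_le (by rwa [Fintype.card_perm, Fintype.card_fin]))
  refine (((SubOp.kraft_bits (ρ := ρ)).prod Kraft.bool).list.prod (Kraft.nat.prod (hmask.prod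
    (hmask.prod (hmask.prod (hmask.prod (Kraft.int.list.prod hperm))))))).comp
    (f := fun y : Sym ρ κ => (y.ops, y.minId, y.cutMask, y.climbMask, y.desMask, y.winMask,
      y.diffs, y.perm)) ?_
  rintro ⟨⟩ ⟨⟩ h
  simpa using h

theorem sum_ops_le (w : List (SubOp ρ × Bool)) :
    (w.map fun p => p.1.bits + 1 + 1).sum ≤ (2 * ρ + 18) * w.length := by
  have h := List.sum_le_card_nsmul (w.map fun p => p.1.bits + 1 + 1) (2 * ρ + 18) (by
    intro x hx
    obtain ⟨p, -, rfl⟩ := List.mem_map.1 hx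
    have := p.1.bits_le
    omega)
  rwa [List.length_map, smul_eq_mul, mul_comm] at h

end Sym

/-- The forest after the rounds `syms` (most recent first), starting from `n` roots. -/
def Abs.after {ρ κ : ℕ} (n : ℕ) (syms : List (Sym ρ κ)) : Abs κ :=
  syms.foldr (fun y a => a.step y) (Abs.start κ n)

/-- The history of the adversary, with the data that it maintains, and the numbers of suboperations,
`Decrease-Key`s, cuts, rounds without designated nodes, and children of removed nodes. -/
structure Stage (K : Type*) (ρ κ : ℕ) where
  hist : List (Op K)
  heap : Heap K
  lab : ℕ → ℕ
  plab : ℕ → ℕ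
  mu : ℕ → ℕ
  cur : ℕ → Life
  idu : Life → ℕ
  birth : ℕ → ℕ
  syms : List (Sym ρ κ)
  ops : ℕ
  decs : ℕ
  cuts : ℕ
  idle : ℕ
  degs : ℕ
  moves : ℕ

variable {K : Type*} [AddCommGroup K] [LinearOrder K] {ρ κ : ℕ}

/-- The invariant of the adversary after `t` of `N` rounds, with the permutations `π`. -/
structure Stage.Inv (A : Algorithm ρ K) (u : K) (s n N Δ J k : ℕ) (π : ℕ → Equiv.Perm (Fin κ))
    (t : ℕ) (st : Stage K ρ κ) : Prop where
  run_eq : A.run st.hist = some st.heap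
  sizeLE : A.SizeLE n st.hist
  cost_eq : A.cost st.hist = st.ops + (n + t) + st.decs
  charge_eq : ∀ a b d : ℝ, charge a b d st.hist = (n + t) * a + t * b + st.decs * d
  next_eq : st.heap.next = n + t
  card_eq : st.heap.live.card = n
  sized : Sized (n + N + 1) u s n st.heap st.lab st.plab st.mu
  sim : Sim st.heap st.cur st.idu (Abs.after n st.syms)
  time_eq : (Abs.after n st.syms).time = t
  birth_le : ∀ x ∈ st.heap.live, st.birth x ≤ st.lab x
  -- `birth x` is the label with which the current life of `x` began. It agrees with five times the
  -- window up to `J` in one direction and 5 in the other, so changes of windows can be charged to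
  -- growing labels.
  idu_birth : ∀ x ∈ st.heap.live,
    5 * st.idu (st.cur x) ≤ st.birth x + J ∧ st.birth x ≤ 5 * st.idu (st.cur x) + 5
  idu_fresh : ∀ x, st.idu (.fresh x) = 0
  idu_le : ∀ l, st.idu l ≤ Nat.log s n
  -- A round designates at most `κ` nodes. Each climb raises the sum of the labels, and a removal
  -- lowers this sum by at most `log_s n`.
  decs_le : st.decs ≤ κ * t + ∑ x ∈ st.heap.live, st.lab x + t * Nat.log s n + st.cuts
  cuts_le : s * st.cuts ≤ st.ops
  -- The children of the removed node become roots, and the next Extract-Min pays for all roots; the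
  -- current roots are those not yet paid for.
  degs_le : st.degs ≤ st.ops + st.heap.roots.length
  -- An idle round starts or ends with at least `Δ` roots, and each count of roots is used for at
  -- most two rounds.
  idle_le : Δ * st.idle ≤ 2 * st.ops + st.heap.roots.length
  -- The changes of windows telescope: a rise is paid by the rise of `birth`, and a removed node
  -- loses at most `log_s n`.
  moves_le : st.moves ≤ κ * J * t + t * Nat.log s n + ∑ x ∈ st.heap.live, st.birth x
  bits_le : (st.syms.map fun y => y.bits k + 1).sum ≤ (2 * ρ + 24) * st.ops + 4 * st.degs +
    st.moves + k * st.idle + (3 * Nat.log s n + 3 * κ + 16) * t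
  known : ∀ j < t, (Abs.after n st.syms).perms j = some (π j) ∨
    ((Abs.after n st.syms).perms j = none ∧ ((Abs.after n st.syms).wins j).Nodup ∧
      ((Abs.after n st.syms).wins j).length = κ ∧
      ∀ i : Fin κ, st.idu (.batch j i) = ((Abs.after n st.syms).wins j).getD (π j i) 0)

theorem sum_add_sum_map_le {E : Finset ℕ} {l : List ℕ} (hl : l.Nodup) (hlE : ∀ x ∈ l, x ∈ E)
    {f g d : ℕ → ℕ} (hfg : ∀ x ∈ E, f x ≤ g x) (hd : ∀ x ∈ l, f x + d x ≤ g x) :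
    ∑ x ∈ E, f x + (l.map d).sum ≤ ∑ x ∈ E, g x := by
  classical
  have h1 : (l.map d).sum = ∑ x ∈ E, if x ∈ l then d x else 0 := by
    rw [← List.sum_toFinset d hl, ← Finset.sum_filter]
    congr 1
    ext x
    simp only [List.mem_toFinset, Finset.mem_filter]
    exact ⟨fun hx => ⟨hlE x hx, hx⟩, fun hx => hx.2⟩
  rw [h1, ← Finset.sum_add_distrib]
  refine Finset.sum_le_sum fun x hx => ?_
  split_ifs with hxl
  · exact hd x hxl
  · exact hfg x hx

variable [IsOrderedAddMonoid K]

/-- With few roots and few children, the `i`-th designated Decrease-Key goes to the child with the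
`π i`-th window from the left. Otherwise nothing is designated and `π` itself goes into the
description. -/
theorem exists_batch {M : ℕ} {u : K} {s n : ℕ} {H H' : Heap K} {lab plab mu : ℕ → ℕ} {m : ℕ}
    {nw : ℕ → List ℕ} (h : Sized M u s n H lab plab mu) (hu : 0 < u) (hM : H.next ≤ M)
    (hs : 2 ≤ s) (hl : H.Linked H' m nw) {Δ J : ℕ} (hJ : 2 * Δ ≤ s ^ J)
    (hκ : κ + Δ / s * (J + 1) ≤ (Nat.log s n - (J + 1)) / 5) (π : Equiv.Perm (Fin κ)) :
    ∃ (pd : ℕ → Bool) (win : ℕ → ℕ) (L2 : List ℕ) (q : Option (Equiv.Perm (Fin κ))),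
      (∀ x, pd x = true → x ∈ H.kids m) ∧ L2.Perm ((H.kids m).filter pd) ∧
      ((H.kids m).filter pd).Pairwise (fun z w => win w < win z) ∧
      (∀ z, pd z = true → win z < Nat.log s n ∧ Nat.log s (mu z) ≤ 5 * win z + 5 ∧
        5 * win z + 5 ≤ J + Nat.log s (mu z)) ∧
      L2.length = (if q = none then κ else 0) ∧
      ((q = none ∧ ∀ i : Fin κ, (L2.map win).getD i 0 =
          (((H.kids m).filter pd).map win).getD (π i) 0) ∨
        (q = some π ∧ (Δ ≤ H.roots.length ∨ Δ ≤ (H.kids m).length))) := by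
  by_cases hg : H.roots.length ≤ Δ ∧ (H.kids m).length ≤ Δ
  · obtain ⟨pd, win, h1, h2, h3, h4⟩ := h.exists_designated hu hM hs hl hg.1 hg.2 hJ hκ
    set dn := (H.kids m).filter pd with hdn
    have hnd : dn.Nodup := (h.wf.forest.nodup_kids m).filter _
    have hlt : ∀ i : Fin κ, (i : ℕ) < dn.length := fun i => by rw [h2]; exact i.2
    set L2 := (List.finRange κ).map fun i => dn[(π i : ℕ)]'(hlt _) with hL2
    have hlen : L2.length = κ := by simp [hL2]
    have hL2nd : L2.Nodup := by
      refine (List.nodup_finRange κ).map ?_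
      intro i j e
      have := (hnd.getElem_inj_iff).1 e
      exact π.injective (Fin.ext this)
    refine ⟨pd, win, L2, none, h1, ?_, h3, h4, by simp [hlen], Or.inl ⟨rfl, fun i => ?_⟩⟩
    · refine (List.perm_of_nodup_nodup_toFinset_eq hL2nd hnd ?_)
      refine Finset.eq_of_subset_of_card_le ?_ ?_
      · intro x hx
        rw [List.mem_toFinset] at hx ⊢
        obtain ⟨i, -, rfl⟩ := List.mem_map.1 hx
        exact List.getElem_mem _
      · rw [List.toFinset_card_of_nodup hL2nd, List.toFinset_card_of_nodup hnd, hlen, h2]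
    · rw [← hdn, List.getD_eq_getElem?_getD, List.getD_eq_getElem?_getD,
        List.getElem?_map (l := L2), List.getElem?_map (l := dn),
        List.getElem?_eq_getElem (hlt (π i)),
        List.getElem?_eq_getElem (l := L2) (by rw [hlen]; exact i.2)]
      simp [hL2]
  · refine ⟨fun _ => false, fun _ => 0, [], some π, by simp, by simp, by simp, by simp, by simp,
      Or.inr ⟨rfl, ?_⟩⟩
    by_contra! hno
    exact hg ⟨hno.1.le, hno.2.le⟩

end PureHeap


/-! ### The invariant of the adversary through its rounds -/

namespace PureHeap

variable {K : Type*} [AddCommGroup K] [LinearOrder K] [IsOrderedAddMonoid K] {ρ κ : ℕ}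
  {A : Algorithm ρ K} {u : K} {s n N Δ J k : ℕ} {π : ℕ → Equiv.Perm (Fin κ)}

theorem Stage.exists_inv_zero (A : Algorithm ρ K) (hu : 0 < u) (hs : 2 ≤ s) (N Δ J k : ℕ)
    (π : ℕ → Equiv.Perm (Fin κ)) : ∃ st : Stage K ρ κ, st.Inv A u s n N Δ J k π 0 := by
  obtain ⟨H, h1, h2, h3, h4, h5, h6, h7, h8, h9, h10⟩ :=
    run_inserts (A := A) (M := n + N + 1) hu n n le_rfl (by omega)
  refine ⟨⟨insertOps (n + N + 1) u n, H, fun _ => 0, fun _ => 0, fun _ => 1, .fresh, fun _ => 0,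
    fun _ => 0, [], 0, 0, 0, 0, 0, 0⟩, ?_⟩
  constructor
  case run_eq => exact h1
  case sizeLE => exact h8
  case cost_eq => simp [h9]
  case charge_eq => intro a b d; rw [h10]; simp
  case next_eq => exact h7
  case card_eq => simp [h6]
  case sized =>
    constructor
    case wf => exact h2
    case key_eq => exact h5
    all_goals simp [h4, h3]
    · omega
  case sim =>
    constructor
    case inj => simp
    case next_eq => exact h7.symm
    case roots_eq => simp [Abs.after, Abs.start, h3]
    case kids_eq => intro x hx; simp [Abs.after, Abs.start, h4, Abs.baseOf]
    case gain_unborn => simp [Abs.after, Abs.start]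
    case cur_born =>
      intro x hx
      rw [h6] at hx
      exact Finset.mem_range.1 hx
    case rev_eq => simp [Abs.after, Abs.start]
    case rev_born => simp [Abs.after, Abs.start]
    case known => simp [Abs.after, Abs.start]
  case time_eq => rfl
  all_goals simp

/-- One round: the Extract-Min, the Decrease-Keys of cut, climbing and designated nodes, and an
Insert that restores the size `n`. The designated ones come last and thus become leftmost before the
Insert. -/
theorem Stage.Inv.succ (hA : A.IsValid) (hu : 0 < u) (hs : 2 ≤ s) (hn : 1 ≤ n) (hJ1 : 1 ≤ J)
    (hJ : 2 * Δ ≤ s ^ J) (hκ : κ + Δ / s * (J + 1) ≤ (Nat.log s n - (J + 1)) / 5) {t : ℕ}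
    (ht : t < N) {st : Stage K ρ κ} (h : st.Inv A u s n N Δ J k π t) :
    ∃ st' : Stage K ρ κ, st'.Inv A u s n N Δ J k π (t + 1) := by
  classical
  set H := st.heap with hH
  have wf := h.sized.wf
  have fo := wf.forest
  have hM : H.next < n + N + 1 := by rw [h.next_eq]; omega
  have hne : H.live.Nonempty := by
    rw [← Finset.card_pos, h.card_eq]; omega
  obtain ⟨H', hH'⟩ := Option.isSome_iff_exists.1 (hA _ _ h.run_eq hne)
  obtain ⟨w, p, hw, hp, hpw, hlt, hl, hDlen⟩ := Heap.exists_linked wf hH'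
  set m := H.rootAt p with hm
  set nw := H.linksOf w with hnw
  obtain ⟨pd, win, L2, q, hpd, hL2, hwin, hpdwin, hL2len, hq⟩ :=
    exists_batch h.sized hu hM.le hs hl hJ hκ (π t)
  obtain ⟨cut, climb, lab', plab', mu', hcutlen, hround⟩ :=
    h.sized.exists_round hu hM hs hl pd hpd
  obtain ⟨H3, hr⟩ := hround L2 hL2
  set R := nw m ++ H.kids m with hR
  set dn := (H.kids m).filter pd with hdn
  set L := H.roots.filter cut ++ R.filter climb ++ L2 with hL
  set a := Abs.after n st.syms with ha
  have hat : a.time = t := h.time_eq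
  have hmlive : m ∈ H.live := fo.roots_live hl.min_mem
  have hnext : H.next ∉ H.live := fun hn => lt_irrefl _ (wf.live_lt _ hn)
  have hdnlive : ∀ x ∈ dn, x ∈ H.live := fun x hx => fo.kids_live (List.mem_of_mem_filter hx)
  have hL2dn : ∀ x, x ∈ L2 ↔ x ∈ dn := fun x => hL2.mem_iff
  have hL2L : ∀ x ∈ L2, x ∈ L := fun x hx => List.mem_append_right _ hx
  have hL2nodup : L2.Nodup := (List.nodup_append.1 hr.nodup).2.1
  have hdnnodup : dn.Nodup := hL2.nodup_iff.1 hL2nodup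
  -- the requests
  set nk : ℕ → K := fun x => nodeKey (n + N + 1) u (lab' x) x with hnk
  have hlive' : ∀ x ∈ H'.live, x ∈ H.live := fun x hx => by
    rw [hl.live_eq] at hx
    exact Finset.mem_of_mem_erase hx
  have hkey' : ∀ x ∈ H'.live, H'.key x = nodeKey (n + N + 1) u (st.lab x) x := fun x hx => by
    rw [hl.key_eq, h.sized.key_eq x (hlive' x hx)]
  have hltM : ∀ x ∈ H.live, x < n + N + 1 := fun x hx => (wf.live_lt x hx).trans hM
  have hcard' : H'.live.card + 1 = n := by
    rw [hl.live_eq, Finset.card_erase_add_one hmlive, h.card_eq]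
  have hrun1 : A.run (.extractMin :: st.hist) = some H' := by
    rw [run_extractMin h.run_eq hne, hH']
  have hsize1 : A.SizeLE n (.extractMin :: st.hist) :=
    h.sizeLE.cons hrun1 (by rw [Heap.size]; omega)
  obtain ⟨hrun2, hsize2, hcost2, hcharge2⟩ := run_decreaseKeys (hl.wf wf) hrun1 hsize1
    (by rw [Heap.size]; omega) nk L hr.nodup
    (fun x hx => by
      rw [hl.live_eq]
      exact Finset.mem_erase.2 ⟨(hr.mem_live x hx).2, (hr.mem_live x hx).1⟩)
    (fun x hx => by
      have h1 := (hr.mem_live x hx).1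
      rw [hl.key_eq, h.sized.key_eq x h1]
      exact nodeKey_le_of_le hu (hr.lab_le x h1))
    (fun x hx z hz hzx => by
      have h1 := hltM x (hr.mem_live x hx).1
      have h2 := hltM z (hlive' z hz)
      rw [hkey' z hz]
      exact ⟨nodeKey_ne hu h2 h1 hzx, nodeKey_ne hu h2 h1 hzx⟩)
  set hist2 := decreaseKeyOps H' L nk ++ .extractMin :: st.hist with hhist2
  have hrun3 : A.run (.insert (nodeKey (n + N + 1) u 0 H.next) :: hist2) = some H3 := by
    rw [hr.heap_eq]
    refine run_insert hrun2 ?_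
    intro z hz
    have h1 := hlive' z hz
    have h2 : z ≠ H.next := by rintro rfl; exact hnext h1
    change (if z ∈ L then nk z else H'.key z) ≠ _
    rw [hkey' z hz]
    split_ifs <;> exact nodeKey_ne hu (hltM z h1) hM h2
  have hnextE : H.next ∉ H.live.erase m := fun hx => hnext (Finset.mem_of_mem_erase hx)
  have hcard3 : H3.live.card = n := by
    rw [hr.live_eq, Finset.card_insert_of_notMem hnextE, Finset.card_erase_add_one hmlive,
      h.card_eq]
  have hsize3 : A.SizeLE n (.insert (nodeKey (n + N + 1) u 0 H.next) :: hist2) :=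
    hsize2.cons hrun3 hcard3.le
  -- the description of the round
  set y : Sym ρ κ := ⟨w, st.idu (st.cur m), H.roots.map cut, R.map climb, R.map pd,
    (List.range (Nat.log s n)).map fun x => decide (x ∈ dn.map win),
    dn.map fun z => (win z : ℤ) - (st.idu (st.cur z) : ℤ), q⟩ with hy
  have hwins : decreasingOf y.winMask = dn.map win := by
    refine decreasingOf_mask (List.pairwise_map.2 hwin) ?_
    intro x hx
    obtain ⟨z, hz, rfl⟩ := List.mem_map.1 hx
    exact (hpdwin z (List.mem_filter.1 hz).2).1
  have hinj : ∀ z z', pd z = true → pd z' = true → win z = win z' → z = z' := by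
    intro z z' hz hz' e
    have hzd : z ∈ dn := List.mem_filter.2 ⟨hpd z hz, hz⟩
    have hzd' : z' ∈ dn := List.mem_filter.2 ⟨hpd z' hz', hz'⟩
    have hnd : (dn.map win).Nodup := by
      refine (List.pairwise_map.2 hwin : (dn.map win).Pairwise fun x y => y < x).imp ?_
      intro x y hxy
      exact hxy.ne'
    exact List.inj_on_of_nodup_map hnd hzd hzd' e
  set idu' : Life → ℕ := fun l => match l with
    | .fresh x => st.idu (.fresh x)
    | .batch j i => if j = t then (L2.map win).getD i 0 else st.idu (.batch j i) with hidu'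
  set cur' : ℕ → Life := fun x => if x = H.next then .fresh H.next else
      if x ∈ L2 then .batch a.time (L2.idxOf x) else st.cur x with hcur'
  have hiduborn : ∀ l, a.Born l → idu' l = st.idu l := by
    rintro (x | ⟨j, i⟩) hb
    · rfl
    · have : j ≠ t := by rw [← hat]; exact ne_of_lt hb
      simp only [hidu', if_neg this]
  have hidunew : ∀ z ∈ L2, idu' (.batch a.time (L2.idxOf z)) = win z := by
    intro z hz
    have h1 := List.idxOf_lt_length_of_mem hz
    simp only [hidu', hat, if_true]
    rw [List.getD_eq_getElem?_getD, List.getElem?_map, List.getElem?_eq_getElem h1]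
    simp
  have hsim := h.sim.step (y := y) wf hp hpw hlt hl hpd hL2 hr rfl rfl rfl rfl rfl hwins hinj rfl
    hL2len hiduborn hidunew
  have hafter : Abs.after n (y :: st.syms) = a.step y := rfl
  have hcur'eq : ∀ x ∈ H.live, x ∉ L2 → cur' x = st.cur x := by
    intro x hx hx2
    have : x ≠ H.next := by rintro rfl; exact hnext hx
    simp only [hcur', if_neg this, if_neg hx2]
  have hcur'L2 : ∀ x ∈ L2, cur' x = .batch a.time (L2.idxOf x) := by
    intro x hx
    have : x ≠ H.next := by rintro rfl; exact hnext (hr.mem_live _ (hL2L _ hx)).1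
    simp only [hcur', if_neg this, if_pos hx]
  set birth' : ℕ → ℕ := fun x => if x = H.next then 0 else
    if x ∈ L2 then lab' x else st.birth x with hbirth'
  have hbirth'eq : ∀ x ∈ H.live, x ∉ L2 → birth' x = st.birth x := by
    intro x hx hx2
    have : x ≠ H.next := by rintro rfl; exact hnext hx
    simp only [hbirth', if_neg this, if_neg hx2]
  have hbirth'L2 : ∀ x ∈ L2, birth' x = lab' x := by
    intro x hx
    have : x ≠ H.next := by rintro rfl; exact hnext (hr.mem_live _ (hL2L _ hx)).1
    simp only [hbirth', if_neg this, if_pos hx]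
  have hlive3 : ∀ x ∈ H3.live, x = H.next ∨ x ∈ H.live := by
    intro x hx
    rw [hr.live_eq, Finset.mem_insert] at hx
    exact hx.imp id Finset.mem_of_mem_erase
  have hL2win : ∀ x ∈ L2, win x < Nat.log s n ∧ lab' x ≤ 5 * win x + 5 ∧
      5 * win x + 5 ≤ J + lab' x := by
    intro x hx
    have h1 := (hL2dn x).1 hx
    have h2 := hpdwin x (List.mem_filter.1 h1).2
    rw [hr.lab_log x (hL2L x hx), hr.mu_old x (List.mem_of_mem_filter h1)]
    exact h2
  -- counting
  have hDw : H.roots.length ≤ w.length := by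
    rw [← hw, List.length_map] at hDlen
    exact hDlen
  have hwA : (A st.hist).length = w.length := by rw [← hw, List.length_map]
  have hnwD : (nw m).length ≤ H.roots.length :=
    (List.subperm_of_subset (hl.nodup m) fun z hz => hl.child_mem m z hz).length_le
  have hRlen : R.length ≤ w.length + (H.kids m).length := by
    rw [hR, List.length_append]; omega
  have hdeg3 : (H.kids m).length ≤ H3.roots.length := by
    refine (List.subperm_of_subset (fo.nodup_kids m) fun z hz => ?_).length_le
    rw [hr.roots_eq, List.mem_cons, List.mem_append, List.mem_reverse, List.mem_filter]
    by_cases hzL : z ∈ L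
    · exact Or.inr (Or.inl hzL)
    · exact Or.inr (Or.inr ⟨List.mem_append_right _ hz, by simpa using hzL⟩)
  have hlabm : st.lab m ≤ Nat.log s n := h.sized.lab_le m hmlive
  -- Each climbing node gains at least one label; the removed node takes at most `log_s n` away.
  have hsumlab : ∑ x ∈ H.live, st.lab x + (R.filter climb).length ≤
      ∑ x ∈ H3.live, lab' x + Nat.log s n := by
    have h1 := sum_add_sum_map_le (E := H.live.erase m) (l := R.filter climb) (f := st.lab)
      (g := lab') (d := fun _ => 1)
      (List.nodup_append.1 (List.nodup_append.1 hr.nodup).1).2.1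
      (fun x hx => by
        have := hr.mem_live x (List.mem_append_left _ (List.mem_append_right _ hx))
        exact Finset.mem_erase.2 ⟨this.2, this.1⟩)
      (fun x hx => hr.lab_le x (Finset.mem_of_mem_erase hx)) (fun x hx => hr.lab_lt x hx)
    rw [List.map_const', List.sum_replicate, smul_eq_mul, mul_one] at h1
    rw [hr.live_eq, Finset.sum_insert hnextE, ← Finset.add_sum_erase _ _ hmlive]
    omega
  -- Labels never decrease, so a window can drop only within the tolerance of `idu_birth`, and a
  -- rise beyond `J` is bounded by the growth of the label since the life began.
  have hdiffs : (dn.map fun z => ((win z : ℤ) - (st.idu (st.cur z) : ℤ)).natAbs).sum ≤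
      κ * J + (dn.map fun z => lab' z - st.birth z).sum := by
    have h1 : ∀ z ∈ dn, ((win z : ℤ) - (st.idu (st.cur z) : ℤ)).natAbs ≤
        J + (lab' z - st.birth z) := by
      intro z hz
      have h2 := hL2win z ((hL2dn z).2 hz)
      have h3 := h.idu_birth z (hdnlive z hz)
      have h4 := h.birth_le z (hdnlive z hz)
      have h5 := hr.lab_le z (hdnlive z hz)
      omega
    refine (List.sum_le_sum h1).trans ?_
    rw [List.sum_map_add, List.map_const', List.sum_replicate, smul_eq_mul]
    refine Nat.add_le_add_right (Nat.mul_le_mul_right _ ?_) _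
    rw [← hL2.length_eq, hL2len]
    split_ifs <;> omega
  have hsumbirth : ∑ x ∈ H.live, st.birth x + (dn.map fun z => lab' z - st.birth z).sum ≤
      ∑ x ∈ H3.live, birth' x + Nat.log s n := by
    have h1 := sum_add_sum_map_le (E := H.live.erase m) (l := dn) (f := st.birth)
      (g := birth') (d := fun z => lab' z - st.birth z) hdnnodup
      (fun x hx => by
        have := hr.mem_live x (hL2L x ((hL2dn x).2 hx))
        exact Finset.mem_erase.2 ⟨this.2, this.1⟩)
      (fun x hx => by
        have hx' := Finset.mem_of_mem_erase hx
        by_cases hx2 : x ∈ L2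
        · rw [hbirth'L2 x hx2]
          exact (h.birth_le x hx').trans (hr.lab_le x hx')
        · rw [hbirth'eq x hx' hx2])
      (fun x hx => by
        have hx' := hdnlive x hx
        rw [hbirth'L2 x ((hL2dn x).2 hx)]
        have := (h.birth_le x hx').trans (hr.lab_le x hx')
        omega)
    have h2 := h.birth_le m hmlive
    rw [hr.live_eq, Finset.sum_insert hnextE, ← Finset.add_sum_erase _ _ hmlive]
    omega
  -- A suboperation with its flag and list bit takes at most `2 * ρ + 18` bits. The mask of the
  -- roots and the two masks of the new roots take two bits per entry, which adds 6 per suboperation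
  -- and 4 per child of `m`.
  have hbits : y.bits k + 1 ≤ (2 * ρ + 24) * w.length + 4 * (H.kids m).length +
      (dn.map fun z => ((win z : ℤ) - (st.idu (st.cur z) : ℤ)).natAbs).sum +
      k * (if q = none then 0 else 1) + (3 * Nat.log s n + 3 * κ + 16) := by
    have h1 := Sym.sum_ops_le w
    have h2 : ((dn.map fun z => (win z : ℤ) - (st.idu (st.cur z) : ℤ)).map
        fun e => 1 + (e.natAbs + 1) + 1).sum =
        (dn.map fun z => ((win z : ℤ) - (st.idu (st.cur z) : ℤ)).natAbs).sum + 3 * dn.length := by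
      rw [List.map_map]
      have : ((fun e : ℤ => 1 + (e.natAbs + 1) + 1) ∘
          fun z => (win z : ℤ) - (st.idu (st.cur z) : ℤ)) =
          fun z => ((win z : ℤ) - (st.idu (st.cur z) : ℤ)).natAbs + 3 := by
        funext z
        simp only [Function.comp]
        omega
      rw [this, List.sum_map_add, List.map_const', List.sum_replicate, smul_eq_mul, mul_comm 3]
    have h3 : dn.length ≤ κ := by
      rw [← hL2.length_eq, hL2len]
      split_ifs <;> omega
    have h4 : (q.elim 1 fun _ => k + 1) ≤ k * (if q = none then 0 else 1) + 1 := by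
      cases q <;> simp
    have h5 := h.idu_le (st.cur m)
    have h6 : (2 * ρ + 24) * w.length = (2 * ρ + 18) * w.length + 6 * w.length := by ring
    simp only [hy, Sym.bits, Sym.maskBits_eq, List.length_map, List.length_range, h2]
    omega
  have hidle : Δ * (if q = none then 0 else 1) ≤ H.roots.length + H3.roots.length := by
    rcases hq with ⟨hq1, -⟩ | ⟨hq1, hq2⟩
    · simp [hq1]
    · rw [hq1, if_neg (by simp), mul_one]
      rcases hq2 with hq2 | hq2
      · exact hq2.trans (Nat.le_add_right _ _)
      · exact hq2.trans (hdeg3.trans (Nat.le_add_left _ _))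
  have hLlen : L.length ≤ (H.roots.filter cut).length + (R.filter climb).length + κ := by
    rw [hL, List.length_append, List.length_append, hL2len]
    split_ifs <;> omega
  refine ⟨⟨.insert (nodeKey (n + N + 1) u 0 H.next) :: hist2, H3, lab', plab', mu', cur', idu',
    birth', y :: st.syms, st.ops + w.length, st.decs + L.length,
    st.cuts + (H.roots.filter cut).length, st.idle + (if q = none then 0 else 1),
    st.degs + (H.kids m).length,
    st.moves + (dn.map fun z => ((win z : ℤ) - (st.idu (st.cur z) : ℤ)).natAbs).sum⟩, ?_⟩
  constructor
  case run_eq => exact hrun3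
  case sizeLE => exact hsize3
  case cost_eq =>
    simp only [Algorithm.cost]
    rw [hcost2, Algorithm.cost, h.cost_eq, hwA]
    omega
  case charge_eq =>
    intro b c d
    simp only [charge]
    rw [hcharge2, charge, h.charge_eq]
    push_cast
    ring
  case next_eq =>
    change H3.next = _
    rw [hr.next_eq, h.next_eq, add_assoc]
  case card_eq => exact hcard3
  case sized => exact hr.sized
  case sim => exact hsim
  case time_eq =>
    change a.time + 1 = t + 1
    rw [hat]
  case birth_le =>
    intro x hx
    change birth' x ≤ lab' x
    rcases hlive3 x hx with rfl | hxl
    · simp [hbirth']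
    · by_cases hx2 : x ∈ L2
      · rw [hbirth'L2 x hx2]
      · rw [hbirth'eq x hxl hx2]
        exact (h.birth_le x hxl).trans (hr.lab_le x hxl)
  case idu_birth =>
    intro x hx
    change 5 * idu' (cur' x) ≤ birth' x + J ∧ birth' x ≤ 5 * idu' (cur' x) + 5
    rcases hlive3 x hx with rfl | hxl
    · have h1 : birth' H.next = 0 := by simp [hbirth']
      have h2 : cur' H.next = .fresh H.next := by simp [hcur']
      have h3 : idu' (.fresh H.next) = st.idu (.fresh H.next) := rfl
      rw [h1, h2, h3, h.idu_fresh]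
      omega
    · by_cases hx2 : x ∈ L2
      · rw [hbirth'L2 x hx2, hcur'L2 x hx2, hidunew x hx2]
        have := hL2win x hx2
        omega
      · rw [hbirth'eq x hxl hx2, hcur'eq x hxl hx2, hiduborn _ (h.sim.cur_born x hxl)]
        exact h.idu_birth x hxl
  case idu_fresh => exact fun x => h.idu_fresh x
  case idu_le =>
    rintro (x | ⟨j, i⟩)
    · exact h.idu_le _
    · change (if j = t then (L2.map win).getD i 0 else st.idu (.batch j i)) ≤ _
      split_ifs
      · rw [List.getD_eq_getElem?_getD, List.getElem?_map]
        cases e : L2[i]? with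
        | none => exact Nat.zero_le _
        | some z => exact (hL2win z (List.mem_of_getElem? e)).1.le
      · exact h.idu_le _
  case decs_le =>
    change st.decs + L.length ≤ κ * (t + 1) + ∑ x ∈ H3.live, lab' x + (t + 1) * Nat.log s n +
      (st.cuts + (H.roots.filter cut).length)
    have : st.decs ≤ κ * t + ∑ x ∈ H.live, st.lab x + t * Nat.log s n + st.cuts := h.decs_le
    rw [mul_add, add_mul]
    omega
  case cuts_le =>
    change s * (st.cuts + (H.roots.filter cut).length) ≤ st.ops + w.length
    have := h.cuts_le
    have h2 : s * (H.roots.filter cut).length ≤ H.roots.length := hcutlen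
    rw [mul_add]
    omega
  case degs_le =>
    change st.degs + (H.kids m).length ≤ st.ops + w.length + H3.roots.length
    have : st.degs ≤ st.ops + H.roots.length := h.degs_le
    omega
  case idle_le =>
    change Δ * (st.idle + (if q = none then 0 else 1)) ≤
      2 * (st.ops + w.length) + H3.roots.length
    have : Δ * st.idle ≤ 2 * st.ops + H.roots.length := h.idle_le
    rw [mul_add]
    omega
  case moves_le =>
    change st.moves + _ ≤ κ * J * (t + 1) + (t + 1) * Nat.log s n + ∑ x ∈ H3.live, birth' x
    have : st.moves ≤ κ * J * t + t * Nat.log s n + ∑ x ∈ H.live, st.birth x := h.moves_le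
    rw [mul_add, add_mul]
    omega
  case bits_le =>
    change ((y :: st.syms).map fun y => y.bits k + 1).sum ≤ (2 * ρ + 24) * (st.ops + w.length) +
      4 * (st.degs + (H.kids m).length) + (st.moves + _) +
      k * (st.idle + (if q = none then 0 else 1)) + (3 * Nat.log s n + 3 * κ + 16) * (t + 1)
    have := h.bits_le
    rw [List.map_cons, List.sum_cons, mul_add (2 * ρ + 24), mul_add 4, mul_add k,
      mul_add (3 * Nat.log s n + 3 * κ + 16)]
    omega
  case known =>
    intro j hj
    change (a.step y).perms j = some (π j) ∨ ((a.step y).perms j = none ∧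
      ((a.step y).wins j).Nodup ∧ ((a.step y).wins j).length = κ ∧
      ∀ i : Fin κ, idu' (.batch j i) = ((a.step y).wins j).getD (π j i) 0)
    have e1 : (a.step y).perms j = if j = a.time then q else a.perms j := rfl
    have e2 : (a.step y).wins j = if j = a.time then decreasingOf y.winMask else a.wins j := rfl
    rw [e1, e2, hat, hwins]
    by_cases hjt : j = t
    · subst hjt
      simp only [if_true]
      rcases hq with ⟨hq1, hq2⟩ | ⟨hq1, -⟩
      · right
        refine ⟨hq1, ?_, ?_, ?_⟩
        · refine (List.pairwise_map.2 hwin : (dn.map win).Pairwise fun x y => y < x).imp ?_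
          intro x y hxy
          exact hxy.ne'
        · rw [List.length_map, ← hL2.length_eq, hL2len, if_pos hq1]
        · intro i
          simp only [hidu', if_true]
          exact hq2 i
      · exact Or.inl hq1
    · simp only [if_neg hjt, hidu']
      exact h.known j (by omega)

end PureHeap


/-! ### Counting -/

namespace PureHeap

/-- The lives of designated nodes whose windows the description of the rounds does not reveal. -/
def Abs.hidden {κ : ℕ} (a : Abs κ) : List (ℕ × ℕ) :=
  (List.product (List.range a.time) (List.range κ)).filter fun p =>
    (a.perms p.1).isNone && (a.rev (.batch p.1 p.2)).isNone

theorem Abs.mem_hidden {κ : ℕ} {a : Abs κ} {p : ℕ × ℕ} : p ∈ a.hidden ↔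
    (p.1 < a.time ∧ p.2 < κ) ∧ a.perms p.1 = none ∧ a.rev (.batch p.1 p.2) = none := by
  obtain ⟨j, i⟩ := p
  simp [Abs.hidden]

/-- By `known`, hidden lives are current lives of nodes in the heap. -/
theorem Sim.length_hidden_le {K : Type*} {κ : ℕ} {H : Heap K} {cur : ℕ → Life} {idu : Life → ℕ}
    {a : Abs κ} (h : Sim H cur idu a) : a.hidden.length ≤ H.live.card := by
  have h1 : (a.hidden.map fun p => Life.batch p.1 p.2).Nodup := by
    refine List.Nodup.map ?_ (((List.nodup_range).product List.nodup_range).filter _)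
    rintro ⟨j, i⟩ ⟨j', i'⟩ e
    injection e with e1 e2
    exact Prod.ext e1 e2
  have h2 : (a.hidden.map fun p => Life.batch p.1 p.2) ⊆ H.live.toList.map cur := by
    intro l hl
    obtain ⟨p, hp, rfl⟩ := List.mem_map.1 hl
    obtain ⟨⟨h3, h4⟩, h5, h6⟩ := Abs.mem_hidden.1 hp
    rcases h.known _ h3 h5 _ h4 with h7 | ⟨x, hx, e⟩
    · exact absurd h6 h7
    · exact List.mem_map.2 ⟨x, Finset.mem_toList.2 hx, e⟩
  simpa using (List.subperm_of_subset h1 h2).length_le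

variable {K : Type*} [AddCommGroup K] [LinearOrder K] {ρ κ : ℕ}
  {A : Algorithm ρ K} {u : K} {s n N Δ J k : ℕ} {π : ℕ → Equiv.Perm (Fin κ)}

/-- A code for the permutations of the adversary. -/
def Stage.code (n : ℕ) (st : Stage K ρ κ) : List (Sym ρ κ) × List ℕ :=
  (st.syms, (Abs.after n st.syms).hidden.map fun p => st.idu (.batch p.1 p.2))

/-- The length of the code. -/
def codeBits (k : ℕ) (c : List (Sym ρ κ) × List ℕ) : ℕ :=
  ((c.1.map fun y => y.bits k + 1).sum + 1) + ((c.2.map fun v => v + 1 + 1).sum + 1)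

theorem kraft_codeBits (hk : κ.factorial ≤ 2 ^ k) : Kraft (codeBits (ρ := ρ) (κ := κ) k) :=
  (Sym.kraft_bits hk).list.prod Kraft.nat.list

namespace Stage.Inv

/-- The descriptions determine the abstract forest and with it the revealed windows; the second part
of the code lists the hidden ones. Since the windows of a batch are distinct, the window of its
`i`-th life gives the value of the permutation at `i`. -/
theorem eq_of_code_eq {π' : ℕ → Equiv.Perm (Fin κ)} {t : ℕ} {st st' : Stage K ρ κ}
    (h : st.Inv A u s n N Δ J k π t) (h' : st'.Inv A u s n N Δ J k π' t)
    (e : st.code n = st'.code n) {j : ℕ} (hj : j < t) : π j = π' j := by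
  simp only [Stage.code, Prod.mk.injEq] at e
  obtain ⟨e1, e2⟩ := e
  have k1 := h.known j hj
  have k2 := h'.known j hj
  have hsim' := h'.sim
  rw [← e1] at e2 k2 hsim'
  set a := Abs.after n st.syms with ha
  rcases k1 with k1 | ⟨k1, hnd, hlen, k3⟩
  · rcases k2 with k2 | ⟨k2, -⟩
    · exact Option.some.inj (k1.symm.trans k2)
    · rw [k1] at k2
      cases k2
  · rcases k2 with k2 | ⟨-, -, -, k4⟩
    · rw [k1] at k2
      cases k2
    · refine Equiv.ext fun i => ?_
      have h1 : st.idu (.batch j i) = st'.idu (.batch j i) := by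
        cases hr : a.rev (.batch j i) with
        | some v => rw [← h.sim.rev_eq _ _ hr, ← hsim'.rev_eq _ _ hr]
        | none =>
          exact List.map_inj_left.1 e2 (j, i)
            (Abs.mem_hidden.2 ⟨⟨by rw [ha, h.time_eq]; exact hj, i.2⟩, k1, hr⟩)
      rw [k3, k4, List.getD_eq_getElem _ _ (by rw [hlen]; exact (π j i).2),
        List.getD_eq_getElem _ _ (by rw [hlen]; exact (π' j i).2)] at h1
      exact Fin.ext ((hnd.getElem_inj_iff).1 h1)

theorem codeBits_le {t : ℕ} {st : Stage K ρ κ} (h : st.Inv A u s n N Δ J k π t) :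
    codeBits k (st.code n) ≤ (2 * ρ + 24) * st.ops + 4 * st.degs + st.moves + k * st.idle +
      (3 * Nat.log s n + 3 * κ + 16) * t + n * (Nat.log s n + 2) + 2 := by
  have h1 := h.bits_le
  have h2 : (((Abs.after n st.syms).hidden.map fun p => st.idu (.batch p.1 p.2)).map
      fun v => v + 1 + 1).sum ≤ n * (Nat.log s n + 2) := by
    have h3 := List.sum_le_card_nsmul (((Abs.after n st.syms).hidden.map
      fun p => st.idu (.batch p.1 p.2)).map fun v => v + 1 + 1) (Nat.log s n + 2) (by
        intro x hx
        obtain ⟨v, hv, rfl⟩ := List.mem_map.1 hx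
        obtain ⟨p, -, rfl⟩ := List.mem_map.1 hv
        exact Nat.add_le_add_right (h.idu_le _) 2)
    rw [List.length_map, List.length_map, smul_eq_mul] at h3
    refine h3.trans (Nat.mul_le_mul_right _ ?_)
    exact h.sim.length_hidden_le.trans_eq h.card_eq
  simp only [codeBits, Stage.code]
  omega

end Stage.Inv

variable [IsOrderedAddMonoid K]

theorem Stage.exists_inv (hA : A.IsValid) (hu : 0 < u) (hs : 2 ≤ s) (hn : 1 ≤ n) (hJ1 : 1 ≤ J)
    (hJ : 2 * Δ ≤ s ^ J) (hκ : κ + Δ / s * (J + 1) ≤ (Nat.log s n - (J + 1)) / 5)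
    (π : ℕ → Equiv.Perm (Fin κ)) {t : ℕ} (ht : t ≤ N) :
    ∃ st : Stage K ρ κ, st.Inv A u s n N Δ J k π t := by
  induction t with
  | zero => exact Stage.exists_inv_zero A hu hs N Δ J k π
  | succ t ih =>
    obtain ⟨st, h⟩ := ih (by omega)
    exact h.succ hA hu hs hn hJ1 hJ hκ (by omega)

/-- All `κ! ^ N` sequences of permutations have different codes, so by the Kraft inequality one of
the codes is long. That sequence is the one the adversary uses. -/
theorem Stage.exists_inv_of_factorial_le (hA : A.IsValid) (hu : 0 < u) (hs : 2 ≤ s) (hn : 1 ≤ n)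
    (hJ1 : 1 ≤ J) (hJ : 2 * Δ ≤ s ^ J)
    (hκ : κ + Δ / s * (J + 1) ≤ (Nat.log s n - (J + 1)) / 5) (hk : κ.factorial ≤ 2 ^ k) (N : ℕ) :
    ∃ (π : ℕ → Equiv.Perm (Fin κ)) (st : Stage K ρ κ), st.Inv A u s n N Δ J k π N ∧
      κ.factorial ^ N ≤ 2 ^ codeBits k (st.code n) := by
  have h : ∀ ω : Fin N → Equiv.Perm (Fin κ), ∃ st : Stage K ρ κ,
      st.Inv A u s n N Δ J k (fun j => if h : j < N then ω ⟨j, h⟩ else 1) N := fun ω =>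
    Stage.exists_inv hA hu hs hn hJ1 hJ hκ _ le_rfl
  choose st hst using h
  have hinj : Function.Injective fun ω => (st ω).code n := by
    intro ω ω' e
    funext j
    have := (hst ω).eq_of_code_eq (hst ω') e j.2
    simpa using this
  obtain ⟨ω, hω⟩ := (kraft_codeBits (ρ := ρ) hk).exists_card_le hinj
  refine ⟨_, st ω, hst ω, ?_⟩
  simpa [Fintype.card_perm] using hω

/-- An execution of `n + N` `Insert`s, `N` `Extract-Min`s with `T` suboperations, and `D`
`Decrease-Key`s, of which `C` are cuts, with `B` idle rounds. -/
theorem exists_execution (hA : A.IsValid) (hu : 0 < u) (hs : 2 ≤ s) (hn : 1 ≤ n)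
    (hJ1 : 1 ≤ J) (hJ : 2 * Δ ≤ s ^ J)
    (hκ : κ + Δ / s * (J + 1) ≤ (Nat.log s n - (J + 1)) / 5) (hk : κ.factorial ≤ 2 ^ k) (N : ℕ) :
    ∃ (hist : List (Op K)) (T D C B : ℕ), (A.run hist).isSome ∧ A.SizeLE n hist ∧
      A.cost hist = T + (n + N) + D ∧
      (∀ a b d : ℝ, charge a b d hist = (n + N) * a + N * b + D * d) ∧
      D ≤ κ * N + (n + N) * Nat.log s n + C ∧ s * C ≤ T ∧ Δ * B ≤ 2 * T + n ∧
      κ.factorial ^ N ≤ 2 ^ ((2 * ρ + 28) * T + k * B +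
        ((3 + J) * κ + 4 * Nat.log s n + 16) * N + (2 * Nat.log s n + 6) * n + 2) := by
  obtain ⟨π, st, h, hc⟩ := Stage.exists_inv_of_factorial_le (ρ := ρ) hA hu hs hn hJ1 hJ hκ hk N
  have hroots : st.heap.roots.length ≤ n := by
    have := (List.subperm_of_subset h.sized.wf.forest.nodup_roots
      (l₂ := st.heap.live.toList) fun x hx =>
        Finset.mem_toList.2 (h.sized.wf.forest.roots_live hx)).length_le
    rwa [Finset.length_toList, h.card_eq] at this
  have hlab : ∑ x ∈ st.heap.live, st.lab x ≤ n * Nat.log s n := by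
    have := Finset.sum_le_card_nsmul st.heap.live st.lab _ h.sized.lab_le
    rwa [h.card_eq, smul_eq_mul] at this
  have hbirth : ∑ x ∈ st.heap.live, st.birth x ≤ n * Nat.log s n :=
    (Finset.sum_le_sum h.birth_le).trans hlab
  refine ⟨st.hist, st.ops, st.decs, st.cuts, st.idle, by rw [h.run_eq]; rfl, h.sizeLE, h.cost_eq,
    h.charge_eq, ?_, h.cuts_le, h.idle_le.trans (Nat.add_le_add_left hroots _),
    hc.trans (Nat.pow_le_pow_right two_pos (h.codeBits_le.trans ?_))⟩
  · have := h.decs_le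
    rw [add_mul]
    omega
  -- At the end at most `n` roots are unpaid, and all labels are at most `log_s n`. The bound on
  -- `degs` turns `2 * ρ + 24` into `2 * ρ + 28`.
  · have h1 := h.degs_le
    have h2 := h.moves_le
    nlinarith

end PureHeap


/-! ### Choice of the parameters -/

namespace PureHeap

/-- From `m ^ m / m! ≤ e ^ m`, a term of the exponential series. -/
theorem mul_log_sub_le_log_factorial {m : ℕ} (hm : 0 < m) :
    (m : ℝ) * (Real.log m - 1) ≤ Real.log m.factorial := by
  have hm' : (0 : ℝ) < m := by exact_mod_cast hm
  have hf : (0 : ℝ) < m.factorial := by exact_mod_cast m.factorial_pos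
  have h := Real.log_le_log (by positivity) (Real.pow_div_factorial_le_exp (m : ℝ) hm'.le m)
  rw [Real.log_exp, Real.log_div (by positivity) hf.ne', Real.log_pow] at h
  linarith

theorem factorial_le_two_pow (m : ℕ) : m.factorial ≤ 2 ^ (m * Nat.clog 2 m) := by
  rw [mul_comm, pow_mul]
  exact m.factorial_le_pow.trans (Nat.pow_le_pow_left (Nat.le_pow_clog one_lt_two m) m)

set_option maxHeartbeats 400000 in
/-- The parameters of the adversary. -/
theorem exists_parameters {q n : ℕ} (hq : 2 ≤ q) (hn : 1 ≤ n) {x ℓ l M : ℝ} (hℓ : ℓ = Real.log n)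
    (hx : x ^ q = ℓ) (hl : l = Real.log ℓ) (hM : M = 240 + q * (q + 10) + 40 * (q + 2) * 2 ^ q)
    (hMl : M ≤ l) (hlx : M * l ≤ x) :
    ∃ s Δ J κ k : ℕ, 2 ≤ s ∧ 1 ≤ J ∧ 2 * Δ ≤ s ^ J ∧
      κ + Δ / s * (J + 1) ≤ (Nat.log s n - (J + 1)) / 5 ∧ κ.factorial ≤ 2 ^ k ∧
      2 * l ≤ s ∧ q * ℓ / 160 ≤ Real.log κ.factorial ∧ 2 * l * Nat.log s n ≤ q * ℓ ∧
      κ ≤ Nat.log s n ∧ 2 * k ≤ Δ ∧ ((3 + J) * κ + 6 * Nat.log s n + 24 : ℝ) ≤ ℓ := by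
  have hq' : (2 : ℝ) ≤ q := by exact_mod_cast hq
  have h2q : (1 : ℝ) ≤ 2 ^ q := one_le_pow₀ one_le_two
  have hM1 : (240 : ℝ) ≤ M := by rw [hM]; nlinarith
  have hM2 : (q : ℝ) * (q + 10) ≤ M := by rw [hM]; nlinarith
  have hM3 : (40 : ℝ) * (q + 2) * 2 ^ q ≤ M := by rw [hM]; nlinarith
  have hM4 : (8 : ℝ) * (q + 3) ≤ M := by nlinarith
  have hl0 : 240 ≤ l := hM1.trans hMl
  have hl' : 0 < l := by linarith
  have hxl : 240 * l ≤ x := (mul_le_mul_of_nonneg_right hM1 (by linarith)).trans hlx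
  have hx0 : 0 < x := by linarith
  have hx1 : 1 ≤ x := by linarith
  have hxx : x * x ≤ ℓ := by
    rw [← hx, ← sq]
    exact pow_le_pow_right₀ hx1 hq
  have hxℓ : x ≤ ℓ := (le_mul_of_one_le_left hx0.le hx1).trans hxx
  have hℓ0 : 0 < ℓ := by linarith
  have hql : (q : ℝ) ≤ l := by
    have : (q : ℝ) * 1 ≤ q * (q + 10) := by gcongr; linarith
    linarith
  have hlogx : q * Real.log x = l := by rw [hl, ← hx, Real.log_pow]
  -- The integer `r` is about the `q`-th root of `log n`, so `log r` lies between `l / q` and `2 * l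
  -- / q`.
  set r := ⌈x⌉₊ with hr
  have hr1 : x ≤ r := Nat.le_ceil x
  have hr2 : (r : ℝ) ≤ 2 * x := by
    have := Nat.ceil_lt_add_one hx0.le
    linarith
  have hr0 : (0 : ℝ) < r := by linarith
  have hr3 : 2 ≤ r := by
    have : (2 : ℝ) ≤ r := by linarith
    exact_mod_cast this
  have hlogr1 : l ≤ q * Real.log r := by
    rw [← hlogx]
    exact mul_le_mul_of_nonneg_left (Real.log_le_log hx0 hr1) (by linarith)
  have hlogr2 : q * Real.log r ≤ 2 * l := by
    have h1 := Real.log_le_log hr0 hr2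
    rw [Real.log_mul two_ne_zero hx0.ne'] at h1
    have h2 : q * Real.log 2 ≤ l := by
      refine le_trans ?_ hql
      exact mul_le_of_le_one_right (by linarith) (by linarith [Real.log_two_lt_d9])
    have h3 := mul_le_mul_of_nonneg_left h1 (Nat.cast_nonneg (α := ℝ) q)
    linarith
  -- With `Δ = r ^ (q + 1)`, one factor `r` makes `Δ` larger than the length of a written
  -- permutation, of order `ℓ`. The other makes `Δ / s` so small that few windows are spoiled.
  set s := r ^ 2 with hs
  set L := Nat.log s n with hL
  have hrs : r ≤ s := Nat.le_self_pow two_ne_zero r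
  have hs2 : 2 ≤ s := hr3.trans hrs
  have hlogs : Real.log s = 2 * Real.log r := by
    rw [hs]; push_cast; rw [Real.log_pow]; norm_num
  have hn0 : (0 : ℝ) < n := by exact_mod_cast hn
  have hL1 : L * Real.log s ≤ ℓ := by
    rw [hℓ, ← Real.log_pow]
    refine Real.log_le_log (by positivity) ?_
    exact_mod_cast Nat.pow_log_le_self s (by omega)
  have hL2 : ℓ ≤ (L + 1) * Real.log s := by
    rw [hℓ]
    have h1 : (n : ℝ) ≤ (s : ℝ) ^ (L + 1) := by
      exact_mod_cast (Nat.lt_pow_succ_log_self (by omega) n).le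
    have h2 := Real.log_le_log hn0 h1
    rwa [Real.log_pow, Nat.cast_add, Nat.cast_one] at h2
  have hL0 : (0 : ℝ) ≤ L := Nat.cast_nonneg _
  have hL3 : 2 * l * L ≤ q * ℓ := by
    rw [hlogs] at hL1
    have h1 := mul_le_mul_of_nonneg_left hlogr1 hL0
    have h2 := mul_le_mul_of_nonneg_left hL1 (Nat.cast_nonneg (α := ℝ) q)
    linarith
  have hL4 : q * ℓ ≤ 4 * l * (L + 1) := by
    rw [hlogs] at hL2
    have h1 := mul_le_mul_of_nonneg_left hlogr2 (by linarith : (0 : ℝ) ≤ L + 1)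
    have h2 := mul_le_mul_of_nonneg_left hL2 (Nat.cast_nonneg (α := ℝ) q)
    linarith
  -- Half of the `L / 5` windows; the other half makes up for spoiled windows and rounding.
  set κ := L / 10 with hκ
  have hκ1 : (10 : ℝ) * κ ≤ L := by
    have : 10 * κ ≤ L := by omega
    exact_mod_cast this
  have hκ2 : (L : ℝ) + 1 ≤ 10 * κ + 10 := by
    have : L + 1 ≤ 10 * κ + 10 := by omega
    exact_mod_cast this
  have hκ3 : q * ℓ ≤ 80 * l * κ := by
    have h1 : 4 * l * (L + 1) ≤ 4 * l * (10 * κ + 10) := by gcongr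
    have h2 : 2 * ℓ ≤ q * ℓ := by gcongr
    linarith
  have hsq : 240 * l ≤ Real.sqrt ℓ := hxl.trans (Real.le_sqrt_of_sq_le (by rwa [sq]))
  have hκ4 : 3 * Real.sqrt ℓ ≤ κ := by
    have h1 := Real.mul_self_sqrt hℓ0.le
    have h2 := mul_le_mul_of_nonneg_right hsq (Real.sqrt_nonneg ℓ)
    have h3 : 1 * ℓ ≤ q * ℓ := by gcongr; linarith
    refine le_of_mul_le_mul_left (a := 80 * l) ?_ (by linarith)
    linarith
  have hκ5 : 1 < κ := by
    have : (1 : ℝ) < κ := by linarith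
    exact_mod_cast this
  have hκ0 : (0 : ℝ) < κ := by linarith
  have hlogκ : 1 + l / 2 ≤ Real.log κ := by
    have h1 := Real.log_le_log (by positivity) hκ4
    rw [Real.log_mul (by norm_num) (Real.sqrt_pos.2 hℓ0).ne', Real.log_sqrt hℓ0.le, ← hl] at h1
    have h2 : 1 ≤ Real.log 3 := by
      rw [Real.le_log_iff_exp_le (by norm_num)]
      exact Real.exp_one_lt_three.le
    linarith
  have hκℓ : (κ : ℝ) ≤ ℓ := by
    have h1 : (q : ℝ) * κ ≤ l * κ := by gcongr
    have h2 := mul_le_mul_of_nonneg_left hκ1 hl'.le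
    have h3 := mul_nonneg hl'.le hκ0.le
    refine le_of_mul_le_mul_left (a := (q : ℝ)) ?_ (by linarith)
    linarith
  set e := Nat.clog 2 κ with he
  have he1 : (e : ℝ) ≤ 3 * l := by
    have h1 := Nat.pow_pred_clog_lt_self one_lt_two hκ5
    have h2 : (2 : ℝ) ^ (e - 1) ≤ ℓ := by
      refine le_trans ?_ hκℓ
      exact_mod_cast h1.le
    have h3 := Real.log_le_log (by positivity) h2
    rw [Real.log_pow, ← hl] at h3
    have h4 : (e : ℝ) ≤ ((e - 1 : ℕ) : ℝ) + 1 := by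
      have : e ≤ e - 1 + 1 := by omega
      exact_mod_cast this
    have h5 := Real.log_two_gt_d9
    have h6 : ((e - 1 : ℕ) : ℝ) * (1 / 2) ≤ ((e - 1 : ℕ) : ℝ) * Real.log 2 := by
      gcongr
      linarith
    linarith
  have hrq : r ^ (q + 1) = s * r ^ (q - 1) := by
    rw [hs, ← pow_add]
    congr 1
    omega
  have hP : ((r ^ (q - 1) : ℕ) : ℝ) * x ≤ 2 ^ q * ℓ := by
    push_cast
    calc (r : ℝ) ^ (q - 1) * x ≤ (2 * x) ^ (q - 1) * (2 * x) := by gcongr; linarith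
      _ = 2 ^ q * ℓ := by
        rw [← pow_succ, Nat.sub_add_cancel (by omega), mul_pow, hx]
  -- `J = q + 1` gives `s ^ J = r ^ (2 * q + 2)`, which exceeds `Δ` by far more than the factor 2.
  refine ⟨s, r ^ (q + 1), q + 1, κ, κ * e, hs2, by omega, ?_, ?_, factorial_le_two_pow κ, ?_, ?_,
    hL3, by omega, ?_, ?_⟩
  · calc 2 * r ^ (q + 1) ≤ r ^ (q + 1) * r := by rw [mul_comm]; gcongr
      _ = r ^ (q + 2) := rfl
      _ ≤ r ^ (2 * (q + 1)) := Nat.pow_le_pow_right (by omega) (by omega)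
      _ = s ^ (q + 1) := by rw [hs, pow_mul]
  · rw [hrq, Nat.mul_div_cancel_left _ (by omega)]
    set P := r ^ (q - 1) with hPdef
    have h0 : (0 : ℝ) ≤ P := Nat.cast_nonneg _
    have h1 : (5 : ℝ) * κ + 5 * (P * (q + 2)) + (q + 2) ≤ L := by
      have h2 : 40 * (q + 2) * (l * P) ≤ ℓ := by
        have h3 : M * l * P ≤ 2 ^ q * ℓ := by
          have := mul_le_mul_of_nonneg_right hlx h0
          linarith
        have h4 : 40 * (q + 2) * 2 ^ q * (l * P) ≤ 2 ^ q * ℓ := by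
          have := mul_le_mul_of_nonneg_right hM3 (mul_nonneg hl'.le h0)
          linarith
        have h5 : (0 : ℝ) < 2 ^ q := by positivity
        refine le_of_mul_le_mul_left ?_ h5
        linarith
      have h6 : 8 * (q + 3) * l ≤ ℓ :=
        (mul_le_mul_of_nonneg_right hM4 hl'.le).trans (hlx.trans hxℓ)
      have h7 : l * (8 * (5 * (P * (q + 2)) + (q + 3))) ≤ l * (4 * (L + 1)) := by
        have : 2 * ℓ ≤ q * ℓ := by gcongr
        linarith
      have h8 := le_of_mul_le_mul_left h7 (by linarith)
      linarith
    have h9 : 5 * κ + 5 * (P * (q + 2)) + (q + 2) ≤ L := by exact_mod_cast h1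
    rw [Nat.le_div_iff_mul_le (by norm_num)]
    have h10 : P * (q + 1 + 1) = P * (q + 2) := rfl
    omega
  · have : (r : ℝ) ≤ s := by
      exact_mod_cast hrs
    linarith
  · refine le_trans ?_ (mul_log_sub_le_log_factorial (by omega))
    have : (κ : ℝ) * (l / 2) ≤ κ * (Real.log κ - 1) :=
      mul_le_mul_of_nonneg_left (by linarith) hκ0.le
    linarith
  · have h1 : (2 : ℝ) * (κ * e) ≤ (r : ℝ) ^ (q + 1) := by
      calc (2 : ℝ) * (κ * e) ≤ 2 * (κ * (3 * l)) := by gcongr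
        _ ≤ q * ℓ := by
          have := mul_le_mul_of_nonneg_left hκ1 hl'.le
          have := mul_nonneg hl'.le hκ0.le
          linarith
        _ ≤ x * ℓ := by gcongr; linarith
        _ = x ^ (q + 1) := by rw [pow_succ, hx, mul_comm]
        _ ≤ (r : ℝ) ^ (q + 1) := by gcongr
    exact_mod_cast h1
  · have h1 : (q + 10) * L ≤ ℓ / 2 := by
      have h2 : (q : ℝ) * (2 * ((q + 10) * L)) ≤ q * ℓ := by
        have : (q : ℝ) * (q + 10) * L ≤ l * L :=
          mul_le_mul_of_nonneg_right (hM2.trans hMl) hL0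
        linarith
      have := le_of_mul_le_mul_left h2 (by linarith)
      linarith
    push_cast
    have h2 : (q + 4 : ℝ) * κ ≤ (q + 4) * L := by gcongr; omega
    linarith

end PureHeap


/-! ### Conclusion: cheap Decrease-Keys contradict the information bound -/

theorem theorem1 {K : Type*} [AddCommGroup K] [LinearOrder K] [IsOrderedAddMonoid K] [Nontrivial K]
    (ρ : ℕ) (A : PureHeap.Algorithm ρ K) (hA : A.IsValid)
    (insertCost extractMinCost decreaseKeyCost : ℕ → ℝ)
    (hcost : A.HasAmortizedCosts insertCost extractMinCost decreaseKeyCost)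
    (hinsert : insertCost =O[Filter.atTop] fun n : ℕ => Real.log n)
    (hextract : extractMinCost =O[Filter.atTop] fun n : ℕ => Real.log n) :
    ∃ ε : ℝ, 0 < ε ∧
      ∀ᶠ n : ℕ in Filter.atTop, ε * Real.log (Real.log n) ≤ decreaseKeyCost n := by
  obtain ⟨u, hu⟩ := exists_zero_lt (α := K)
  obtain ⟨C₁, hC₁, h₁⟩ := hinsert.exists_pos
  obtain ⟨C₂, hC₂, h₂⟩ := hextract.exists_pos
  set C := 2 * C₁ + C₂ with hC
  -- There will be at most `(2 * C + 3) * (n * ℓ)` suboperations with `2 * ρ + 29` bits each,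
  -- including their share of the idle rounds; 160 comes from the lower bound for `log κ!`.
  obtain ⟨q, hq⟩ := exists_nat_gt (160 * ((2 * ρ + 29) * (2 * C + 3) + 2) + 2 : ℝ)
  have hρ : (0 : ℝ) ≤ ρ := Nat.cast_nonneg ρ
  have hCρ : 0 ≤ (2 * ρ + 29) * (2 * C + 3) := by positivity
  have hq0 : (2 : ℝ) < q := by linarith
  set M : ℝ := 240 + q * (q + 10) + 40 * (q + 2) * 2 ^ q with hM
  have hM0 : 0 < M := by positivity
  have hlog : Filter.Tendsto (fun n : ℕ => Real.log n) Filter.atTop Filter.atTop :=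
    Real.tendsto_log_atTop.comp tendsto_natCast_atTop_atTop
  have hx := (isLittleO_log_rpow_atTop (r := 1 / q) (by positivity)).bound (inv_pos.2 hM0)
  refine ⟨1 / q, by positivity, ?_⟩
  filter_upwards [h₁.bound, h₂.bound, Filter.eventually_ge_atTop 1,
    hlog.eventually (Real.tendsto_log_atTop.eventually_ge_atTop M), hlog.eventually hx,
    hlog.eventually_ge_atTop 1] with n hn₁ hn₂ hn hMl hlx hℓ
  by_contra! hd
  set ℓ := Real.log n with hℓdef
  set l := Real.log ℓ with hl
  have hl0 : 0 < l := hM0.trans_le hMl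
  have hℓ0 : 0 < ℓ := by linarith
  have hn0 : (1 : ℝ) ≤ n := by exact_mod_cast hn
  rw [Real.norm_of_nonneg hℓ0.le] at hn₁ hn₂
  have ha := (le_abs_self _).trans hn₁
  have hb := (le_abs_self _).trans hn₂
  rw [Real.norm_of_nonneg hl0.le, Real.norm_of_nonneg (by positivity)] at hlx
  have hlx' : M * l ≤ ℓ ^ (1 / q : ℝ) := by
    rwa [← le_inv_mul_iff₀ hM0]
  have hxq : (ℓ ^ (1 / q : ℝ)) ^ q = ℓ := by
    rw [one_div]
    exact Real.rpow_inv_natCast_pow hℓ0.le (by rintro rfl; norm_num at hq0)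
  obtain ⟨s, Δ, J, κ, k, hs, hJ1, hJ, hκ, hk, hls, hfac, hlL, hκL, hkΔ, hsmall⟩ :=
    PureHeap.exists_parameters (by exact_mod_cast hq0.le) hn hℓdef hxq hl hM hMl hlx'
  -- With as many rounds as items, the `n` initial Inserts and the final state cost no more per
  -- round than a round itself, up to constants.
  obtain ⟨hist, T, D, E, B, hrun, hsize, hT, hcharge, hD, hE, hB, hcount⟩ :=
    PureHeap.exists_execution hA hu hs hn hJ1 hJ hκ hk n
  have h := hcost n hist hrun hsize
  rw [hT, hcharge] at h
  push_cast at h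
  set L := Nat.log s n with hL
  have hD' : (D : ℝ) ≤ κ * n + (n + n) * L + E := by exact_mod_cast hD
  have hE' : (s : ℝ) * E ≤ T := by exact_mod_cast hE
  have hκL' : (κ : ℝ) ≤ L := by exact_mod_cast hκL
  have hD0 : (0 : ℝ) ≤ D := Nat.cast_nonneg D
  have hE0 : (0 : ℝ) ≤ E := Nat.cast_nonneg E
  have hT0 : (0 : ℝ) ≤ T := Nat.cast_nonneg T
  -- There are at most `3 * L` Decrease-Keys per round besides the cuts, and `2 * l * L ≤ q * ℓ`.
  -- The cuts are covered by `s * E ≤ T` and `2 * l ≤ s`.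
  have hDl : D * l ≤ q * (3 / 2 * (n * ℓ) + T / 2) := by
    have h3 : (κ : ℝ) * n ≤ L * n := by gcongr
    have h4 : (D : ℝ) * l ≤ (3 * (L * n) + E) * l := by
      gcongr
      linarith
    have h5 := mul_le_mul_of_nonneg_right hlL (by linarith : (0 : ℝ) ≤ n)
    have h6 := mul_le_mul_of_nonneg_right hls hE0
    have h7 : 1 * (T : ℝ) ≤ q * T := by gcongr; linarith
    linarith
  have hDd : D * decreaseKeyCost n ≤ 3 / 2 * (n * ℓ) + T / 2 := by
    have h3 := mul_le_mul_of_nonneg_left hd.le hD0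
    have h4 : (D : ℝ) * (1 / q * l) = D * l / q := by ring
    rw [h4] at h3
    exact h3.trans ((div_le_iff₀' (by linarith)).2 hDl)
  -- The term `T / 2` charged for the Decrease-Keys moves to the left side. The resulting bound does
  -- not involve `q`.
  have hTle : (T : ℝ) ≤ (2 * C + 3) * (n * ℓ) := by
    have h3 := mul_le_mul_of_nonneg_left ha (by linarith : (0 : ℝ) ≤ n)
    have h4 := mul_le_mul_of_nonneg_left hb (by linarith : (0 : ℝ) ≤ n)
    rw [hC]
    linarith
  have hkB : (2 : ℝ) * (k * B) ≤ 2 * T + n := by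
    have h3 : 2 * k * B ≤ 2 * T + n := (Nat.mul_le_mul_right B hkΔ).trans hB
    rw [← mul_assoc]
    exact_mod_cast h3
  have hcount' : n * Real.log κ.factorial ≤ (2 * ρ + 28) * T + k * B +
      ((3 + J) * κ + 4 * L + 16) * n + (2 * L + 6) * n + 2 := by
    have h3 : (κ.factorial : ℝ) ^ n ≤ 2 ^ ((2 * ρ + 28) * T + k * B +
      ((3 + J) * κ + 4 * L + 16) * n + (2 * L + 6) * n + 2) := by exact_mod_cast hcount
    have h4 := Real.log_le_log (by positivity) h3
    rw [Real.log_pow, Real.log_pow] at h4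
    refine h4.trans ((mul_le_of_le_one_right (Nat.cast_nonneg _)
      (by linarith [Real.log_two_lt_d9])).trans_eq ?_)
    push_cast
    ring
  have hnℓ : (n : ℝ) * 1 ≤ n * ℓ := by gcongr
  have h3 := mul_le_mul_of_nonneg_left hfac (by linarith : (0 : ℝ) ≤ n)
  have h4 := mul_le_mul_of_nonneg_left hsmall (by linarith : (0 : ℝ) ≤ n)
  have h5 : (2 * ρ + 29) * (T : ℝ) ≤ (2 * ρ + 29) * ((2 * C + 3) * (n * ℓ)) := by gcongr
  have h6 : (n * ℓ) * q ≤ (n * ℓ) * (160 * ((2 * ρ + 29) * (2 * C + 3) + 2)) := by linarith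
  have h7 := le_of_mul_le_mul_left h6 (by positivity)
  linarith
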